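/- Setting. Let $(\mathcal X,\rho)$ be a metric space with at least two points whose class $\mathcal B$ of balls has finite VC dimension $\mathcal V_{\mathcal B}$ ($B(x,r)$ denotes the closed ball), and let $(\mathbf X,\mathbf Y)=\{(X_i,Y_i)\}_{i=1}^n$, $n\ge 1$, be an i.i.d. sample from a distribution on $\mathcal X\times\mathbb R$ with marginal $\mu$ on $\mathcal X$. The regression function $f(x)=\mathbb E[Y\mid X=x]$ is $\lambda$-Lipschitz, $\lambda>0$; the variance of $(Y\mid X=x)$ is at most $\sigma_Y^2$ for every $x$; and for every $a>0$ there is $t>0$ with $\sup_x \mathbb P(|Y-f(x)|>t\mid X=x)\le a$, the infimum of all such $t$ being denoted $t_Y(a)$. Let $K:[0,\infty)\to[0,\infty)$ be non-increasing with $K(1)>0$ and $K(u)=0$ for $u>1$. Let $r_{k,n}(x)$ be the distance from $x$ to its $k$-th nearest neighbor among the $X_i$, and $$f_{n,k}(x)=\sum_i \frac{K(\rho(x,X_i)/r_{k,n}(x))}{\sum_j K(\rho(x,X_j)/r_{k,n}(x))}\,Y_i$$ (if $r_{k,n}(x)=0$, only the $X_i$ equal to $x$ get weight, all the same). For $C,d\ge1$,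 $\mu$ is $(C,d)$-homogeneous on $B(x,r)$ if $\mu(B(x,r'))\le C\epsilon^{-d}\mu(B(x,\epsilon r'))$ for all $0<r'\le r$ and $0<\epsilon<1$. It is $(C_0,d_0)$-maximally-homogeneous ($C_0,d_0\ge1$) if, for all $x$ and $r>0$, whenever $\mu$ is $(C,d)$-homogeneous on $B(x,r)$ for some $C,d\ge1$, it is $(C_0,d_0)$-homogeneous on $B(x,r)$. Choice of $k$ at $x$. Given $\Delta\ge\max_i\rho(x,X_i)$ and $\theta\ge\ln(n/\delta)$, let $k_1$ be the highest integer in $[n]$ with $\Delta^2\theta/k_1\ge r_{k_1,n}^2(x)$, let $k_2=k_1+1$, and let $k$ minimize $\theta/k_i+r_{k_i,n}^2(x)$ over those $k_i$, $i\in\{1,2\}$, that lie in $[n]$ (ties broken arbitrarily). Theorem. Suppose $\mu$ is $(C_0,d_0)$-maximally-homogeneous, $0<\delta<1$, $\theta\ge\ln(n/\delta)$, and $$n^{4/(6+3d_0)}>\frac{\mathcal V_{\mathcal B}\ln(2n)+\ln(8/\delta)}{\theta}.$$ With probability at least $1-2\delta$ over the sample, the following holds simultaneously for all $x\in\mathcal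 X$, all $\Delta\ge\max_i\rho(x,X_i)$ and every $k$ chosen at $x$ by the above rule: for all $0<r<\Delta$ with $\mu(B(x,r))>6C_0\,\theta\,n^{-1/3}$, and all $1\le C\le C_0$, $1\le d\le d_0$ such that $\mu$ is $(C,d)$-homogeneous on $B(x,r)$, $$|f_{n,k}(x)-f(x)|^2\le\Big(\frac{2C_{n,\delta}}{\theta}+2\lambda^2\Big)(1+4\Delta^2)\Big(\frac{3C\theta}{n\,\mu(B(x,r))}\Big)^{2/(2+d)},$$ where $C_{n,\delta}=\big(\mathcal V_{\mathcal B}\,t_Y^2(\delta/2n)\,\ln(2n/\delta)+\sigma_Y^2\big)K(0)/K(1)$. -/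

import Mathlib

open MeasureTheory ProbabilityTheory Set

namespace KNN

noncomputable section

/-- A set `S` of points is shattered by a class `A` of subsets: every subset of `S` is the trace on
`S` of a member of `A`. -/
def Shatters {X : Type*} (A : Set (Set X)) (S : Set X) : Prop :=
  ∀ T ⊆ S, ∃ B ∈ A, S ∩ B = T

/-- The class `A` has finite VC dimension, equal to `V`: `V` is the largest cardinality of a finite
set shattered by `A`. -/
def HasVCDim {X : Type*} (A : Set (Set X)) (V : ℕ) : Prop :=
  IsGreatest {m : ℕ | ∃ S : Finset X, S.card = m ∧ Shatters A (S : Set X)} V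

/-- The class of all (closed) balls of a metric space. -/
def balls (X : Type*) [MetricSpace X] : Set (Set X) :=
  {B | ∃ (x : X) (r : ℝ), 0 ≤ r ∧ B = Metric.closedBall x r}

/-- `μ` is `(C, d)`-homogeneous on `B(x, r)`. -/
def Homogeneous {X : Type*} [MetricSpace X] [MeasurableSpace X] (μ : Measure X)
    (C d : ℝ) (x : X) (r : ℝ) : Prop :=
  ∀ r' : ℝ, 0 < r' → r' ≤ r → ∀ ε : ℝ, 0 < ε → ε < 1 →
    μ.real (Metric.closedBall x r') ≤ C * ε ^ (-d) * μ.real (Metric.closedBall x (ε * r'))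

/-- `μ` is `(C₀, d₀)`-maximally-homogeneous. -/
def MaximallyHomogeneous {X : Type*} [MetricSpace X] [MeasurableSpace X] (μ : Measure X)
    (C₀ d₀ : ℝ) : Prop :=
  1 ≤ C₀ ∧ 1 ≤ d₀ ∧ ∀ (x : X) (r : ℝ), 0 < r →
    (∃ C d : ℝ, 1 ≤ C ∧ 1 ≤ d ∧ Homogeneous μ C d x r) → Homogeneous μ C₀ d₀ x r

/-- The regression function `f(x) = E[Y | X = x]`, where `η x` is the law of `Y` given `X = x`. -/
def regressionFn {X : Type*} [MeasurableSpace X] (η : Kernel X ℝ) (x : X) : ℝ :=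
  ∫ y, y ∂(η x)

/-- The levels `t > 0` such that `P(|Y - f(x)| > t | X = x) ≤ a` for every `x`. -/
def tailLevels {X : Type*} [MeasurableSpace X] (η : Kernel X ℝ) (a : ℝ) : Set ℝ :=
  {t : ℝ | 0 < t ∧ ∀ x : X, (η x).real {y : ℝ | t < |y - regressionFn η x|} ≤ a}

/-- `t_Y(a)`: the infimum of the levels of uniform tail probability at most `a`. -/
def tailBound {X : Type*} [MeasurableSpace X] (η : Kernel X ℝ) (a : ℝ) : ℝ :=
  sInf (tailLevels η a)

/-- The noise has uniformly bounded tails, and variances uniformly bounded by `σ2`. -/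
structure NoiseModel {X : Type*} [MeasurableSpace X] (η : Kernel X ℝ) (σ2 : ℝ) : Prop where
  tails : ∀ a : ℝ, 0 < a → (tailLevels η a).Nonempty
  memLp : ∀ x : X, MemLp (fun y : ℝ => y) 2 (η x)
  variance_le : ∀ x : X, variance (fun y : ℝ => y) (η x) ≤ σ2

/-- An admissible weighting function on `[0, ∞)`: nonnegative, non-increasing, positive at `1`
and zero beyond `1`. -/
structure IsWeightKernel (K : ℝ → ℝ) : Prop where
  nonneg : ∀ u : ℝ, 0 ≤ u → 0 ≤ K u
  antitone : AntitoneOn K (Ici 0)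
  pos_one : 0 < K 1
  eq_zero : ∀ u : ℝ, 1 < u → K u = 0

/-- `r_{k,n}(x)`, the distance from `x` to its `k`-th nearest neighbour in the sample (meaningful
for `1 ≤ k ≤ n`): the least radius of a closed ball around `x` with at least `k` sample points. -/
def nnDist {X : Type*} [MetricSpace X] {n : ℕ} (ω : Fin n → X × ℝ) (k : ℕ) (x : X) : ℝ :=
  sInf {s : ℝ | 0 ≤ s ∧ k ≤ Nat.card {i : Fin n // dist x (ω i).1 ≤ s}}

/-- `K(ρ(x, X_i) / r_{k,n}(x))`. Since `K` vanishes beyond `1`, the case distinction changes nothing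
when `r_{k,n}(x) > 0`; when `r_{k,n}(x) = 0` it reads `K(0/0)` as `K(0)` and `K(s/0)` as `0` for
`s > 0`, so that exactly the sample points equal to `x` receive weight. -/
def rawWeight {X : Type*} [MetricSpace X] {n : ℕ} (K : ℝ → ℝ) (ω : Fin n → X × ℝ) (k : ℕ) (x : X)
    (i : Fin n) : ℝ :=
  open Classical in
  if dist x (ω i).1 ≤ nnDist ω k x then K (dist x (ω i).1 / nnDist ω k x) else 0

/-- The weighted `k`-NN regression estimate `f_{n,k}(x)`. -/
def estimate {X : Type*} [MetricSpace X] {n : ℕ} (K : ℝ → ℝ) (ω : Fin n → X × ℝ) (k : ℕ)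
    (x : X) : ℝ :=
  ∑ i, rawWeight K ω k x i / (∑ j, rawWeight K ω k x j) * (ω i).2

/-- `k` is a possible outcome of the selection rule at `x` with parameters `Δ` and `θ`: `k₁` is the
highest integer in `[n]` with `Δ² θ / k₁ ≥ r_{k₁,n}(x)²`, and `k` minimizes
`θ / k + r_{k,n}(x)²` among the integers `k₁`, `k₁ + 1` that belong to `[n]` (ties are broken
arbitrarily). -/
def IsSelected {X : Type*} [MetricSpace X] {n : ℕ} (ω : Fin n → X × ℝ) (Δ θ : ℝ) (x : X)
    (k : ℕ) : Prop :=
  ∃ k₁ : ℕ,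
    IsGreatest {m : ℕ | 1 ≤ m ∧ m ≤ n ∧ nnDist ω m x ^ 2 ≤ Δ ^ 2 * θ / (m : ℝ)} k₁ ∧
    (k = k₁ ∨ k = k₁ + 1) ∧ k ≤ n ∧
    ∀ j : ℕ, (j = k₁ ∨ j = k₁ + 1) → j ≤ n →
      θ / (k : ℝ) + nnDist ω k x ^ 2 ≤ θ / (j : ℝ) + nnDist ω j x ^ 2

/-- `C_{n,δ} = (V t_Y²(δ/2n) ln(2n/δ) + σ²) K(0) / K(1)`. -/
def noiseConst {X : Type*} [MeasurableSpace X] (η : Kernel X ℝ) (σ2 : ℝ) (K : ℝ → ℝ) (V n : ℕ)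
    (δ : ℝ) : ℝ :=
  ((V : ℝ) * tailBound η (δ / (2 * n)) ^ 2 * Real.log (2 * n / δ) + σ2) * (K 0 / K 1)

/-- The law of an i.i.d. sample of size `n` of pairs `(X, Y)` with `X ∼ μ` and `Y | X = x ∼ η x`. -/
def sampleLaw {X : Type*} [MeasurableSpace X] (μ : Measure X) (η : Kernel X ℝ) (n : ℕ) :
    Measure (Fin n → X × ℝ) :=
  Measure.pi (fun _ : Fin n => μ.compProd η)

end

end KNN

/-!
The argument has a probabilistic half, which produces one event for all points `x`, and a
deterministic half, which analyses the selection rule on that event.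

**Probability.** Off an event of probability `δ / 2` all residuals `Y_i - f(X_i)` are at most
`t = t_Y(δ / 2n)` in absolute value, so they may be replaced by their truncations at `t`. Truncation
shifts the conditional mean of the residual by at most `√(σ² δ / 2n)` (Chebyshev), a loss which the
term `σ²` of the noise level `W = V t² ln(2n/δ) + σ²` absorbs. Conditionally on the `X_i`, the
truncated residuals satisfy Hoeffding's inequality on every fixed set `I` of indices. Conditioning
is avoided by working jointly with the *cells* of the sample points, that is, with the record of
which members of a finite family of balls contain each `X_i`. By Sauer–Shelah the balls have at most
`n ^ V` traces on the sample, and a union bound gives `|∑_I ξ_i| ≤ √(2 W |I|)` for all traces `I` of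
balls, with `W` replaced by `9/8 W` on traces of more than `n / (ln(2n) + 1)` points, where the bias
of the truncation is felt (`measure_iUnion_noise_le`).

For balls `B` of large expected count `n μ(B)` two further bounds are needed:
`|I| ≥ n μ(B) / 5` and a bound for the *average* noise over `I` by `√(5.1 W / (n μ(B)))`, even if
`I` has far fewer points than expected. Both follow from a symmetrization
(`measure_iUnion_le_of_ghost`): a ghost sample of `24 n` points is added, in which `B` has at least
`23 n μ(B)` points with probability one half, and the real sample is averaged over random choices of
one entry in each row of the resulting array of `n × 25` points (`sum_traces_le`).

The finite families of balls are extended to all balls centred in the set of points all of whose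
balls have positive mass. The space is not assumed separable, but that set is, since disjoint balls
of positive mass are countable in number; this yields `exists_good_event`.

**Determinism.** The layer cake formula turns bounds for the noise on concentric balls into a bound
for the `K`-weighted average at the price of a factor `√(K(0)/K(1))` (`abs_sum_rawWeight_mul_le`).
Now let `ε = (3 C θ / (n μ(B(x,r))))^(1/(2+d))` and `κ = θ / ε²`. By homogeneity `B(x, ε r)` has
expected count at least `3 κ` (`exists_scale`), hence at least `0.6 κ` sample points, and the
selection rule picks a `k` whose radius is `O((1 + Δ) ε)`. The noise is compared with `ε² W / θ` in
three cases. If the `k`-NN ball has more than `1.3 κ` points, the first bound suffices, even when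
inflated. Otherwise, if it contains all sample points of `B(x, ε r)`, the average noise bound gives
`√(1.7 W / κ)`. In the remaining case `k` is smaller than the number of points of `B(x, ε r)`, and
the minimality of `θ / k + r_k²` among the two candidates shows that it is at most `(1 + Δ²) ε²`.
-/

namespace KNN

open scoped Classical

/-! ### Traces of balls and the Sauer–Shelah bound -/

/-- The trace of a set `B` on a family of points `z`, recorded as a finite set of indices (so that
repeated points are counted with multiplicity). -/
noncomputable def trace {X ι : Type*} [Fintype ι] (z : ι → X) (B : Set X) : Finset ι :=
  Finset.univ.filter fun i => z i ∈ B

@[simp]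
lemma mem_trace {X ι : Type*} [Fintype ι] {z : ι → X} {B : Set X} {i : ι} :
    i ∈ trace z B ↔ z i ∈ B := by
  simp [trace]

lemma one_le_of_hasVCDim_balls {X : Type*} [MetricSpace X] [Nontrivial X] {V : ℕ}
    (hV : HasVCDim (balls X) V) : 1 ≤ V := by
  obtain ⟨a, b, hab⟩ := exists_pair_ne X
  refine hV.2 ⟨{a}, by simp, ?_⟩
  intro T hT
  rw [Finset.coe_singleton] at hT ⊢
  rcases Set.subset_singleton_iff_eq.1 hT with rfl | rfl
  · refine ⟨Metric.closedBall b 0, ⟨b, 0, le_rfl, rfl⟩, ?_⟩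
    ext y
    simp only [Metric.closedBall_zero, mem_inter_iff, mem_singleton_iff, mem_empty_iff_false,
      iff_false, not_and]
    rintro rfl
    exact hab
  · exact ⟨Metric.closedBall a 0, ⟨a, 0, le_rfl, rfl⟩, by simp⟩

/-- In a space with three points, the balls shatter a pair: the third point alone is a ball. -/
lemma two_le_of_hasVCDim_balls {X : Type*} [MetricSpace X] {V : ℕ}
    (hV : HasVCDim (balls X) V) {a b c : X} (hab : a ≠ b) (hca : c ≠ a) (hcb : c ≠ b) :
    2 ≤ V := by
  refine hV.2 ⟨{a, b}, Finset.card_pair hab, ?_⟩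
  intro T hT
  rw [Finset.coe_pair] at hT ⊢
  by_cases ha : a ∈ T <;> by_cases hb : b ∈ T
  · refine ⟨Metric.closedBall a (dist a b), ⟨a, _, dist_nonneg, rfl⟩, ?_⟩
    ext y
    constructor
    · rintro ⟨rfl | rfl, -⟩ <;> assumption
    · intro hy
      refine ⟨hT hy, ?_⟩
      rcases hT hy with rfl | rfl
      · simp
      · simp [dist_comm]
  · refine ⟨Metric.closedBall a 0, ⟨a, 0, le_rfl, rfl⟩, ?_⟩
    ext y
    simp only [Metric.closedBall_zero, mem_inter_iff, mem_singleton_iff]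
    constructor
    · rintro ⟨-, rfl⟩; exact ha
    · intro hy
      refine ⟨hT hy, ?_⟩
      rcases hT hy with rfl | rfl
      · rfl
      · exact absurd hy hb
  · refine ⟨Metric.closedBall b 0, ⟨b, 0, le_rfl, rfl⟩, ?_⟩
    ext y
    simp only [Metric.closedBall_zero, mem_inter_iff, mem_singleton_iff]
    constructor
    · rintro ⟨-, rfl⟩; exact hb
    · intro hy
      refine ⟨hT hy, ?_⟩
      rcases hT hy with rfl | rfl
      · exact absurd hy ha
      · rfl
  · refine ⟨Metric.closedBall c 0, ⟨c, 0, le_rfl, rfl⟩, ?_⟩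
    ext y
    simp only [Metric.closedBall_zero, mem_inter_iff, mem_singleton_iff]
    constructor
    · rintro ⟨rfl | rfl, h⟩
      · exact absurd h.symm hca
      · exact absurd h.symm hcb
    · intro hy
      rcases hT hy with rfl | rfl
      · exact absurd hy ha
      · exact absurd hy hb

lemma sum_choose_le_pow {N V : ℕ} (hN : 2 ≤ N) (hV : 2 ≤ V) :
    ∑ k ∈ Finset.Iic V, N.choose k ≤ N ^ V := by
  have hI : ∀ m : ℕ, Finset.Iic m = Finset.range (m + 1) := by
    intro m; ext; simp
  induction V, hV using Nat.le_induction with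
  | base =>
    rw [hI]
    simp only [Finset.sum_range_succ, Finset.range_zero, Finset.sum_empty, Nat.choose_zero_right,
      Nat.choose_one_right, zero_add, Nat.choose_two_right]
    have h1 : N * (N - 1) / 2 * 2 ≤ N * (N - 1) := Nat.div_mul_le_self _ _
    obtain ⟨m, rfl⟩ := Nat.exists_eq_add_of_le hN
    have h2 : 2 + m - 1 = m + 1 := by omega
    rw [h2] at h1 ⊢
    nlinarith
  | succ V hV ih =>
    rw [hI, Finset.sum_range_succ, ← hI]
    have h1 : 2 * N.choose (V + 1) ≤ N ^ (V + 1) := by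
      calc 2 * N.choose (V + 1) ≤ (V + 1).factorial * N.choose (V + 1) := by
            gcongr
            calc 2 = Nat.factorial 2 := rfl
              _ ≤ _ := Nat.factorial_le (by omega)
        _ = N.descFactorial (V + 1) := (Nat.descFactorial_eq_factorial_mul_choose _ _).symm
        _ ≤ _ := Nat.descFactorial_le_pow _ _
    have h2 : 2 * N ^ V ≤ N ^ (V + 1) := by rw [pow_succ']; gcongr
    omega

/-- **Sauer–Shelah bound** for balls: on `N ≥ 4` points the balls have at most `N ^ V` traces. For
`V = 1`, where the Sauer–Shelah sum `1 + N` exceeds `N`, the space has just two points. -/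
lemma card_traces_le {X : Type*} [MetricSpace X] [Nontrivial X] {V : ℕ}
    (hV : HasVCDim (balls X) V) {ι : Type*} [Fintype ι] (hι : 4 ≤ Fintype.card ι) (z : ι → X)
    (𝒮 : Finset (Finset ι)) (h𝒮 : ∀ s ∈ 𝒮, ∃ B ∈ balls X, s = trace z B) :
    𝒮.card ≤ Fintype.card ι ^ V := by
  have hV1 := one_le_of_hasVCDim_balls hV
  rcases hV1.eq_or_lt with h1 | h2
  · obtain ⟨a, b, hab⟩ := exists_pair_ne X
    have hX : ∀ c : X, c = a ∨ c = b := by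
      intro c
      by_contra! hc
      have := two_le_of_hasVCDim_balls hV hab hc.1 hc.2
      omega
    have hle : 𝒮.card ≤ Fintype.card (Set ({a, b} : Set X)) := by
      choose! B hB hs using h𝒮
      rw [← Finset.card_univ]
      refine Finset.card_le_card_of_injOn (fun s => {c | (c : X) ∈ B s}) (by simp) ?_
      intro s hs' s' hs'' hss
      rw [hs s hs', hs s' hs'']
      ext i
      have : (⟨z i, hX (z i)⟩ : ({a, b} : Set X)) ∈ {c : ({a, b} : Set X) | (c : X) ∈ B s} ↔
          (⟨z i, hX (z i)⟩ : ({a, b} : Set X)) ∈ {c : ({a, b} : Set X) | (c : X) ∈ B s'} := by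
        simp only at hss
        rw [hss]
      simpa using this
    have h4 : Fintype.card (Set ({a, b} : Set X)) = 4 := by
      rw [Fintype.card_set, ← Nat.card_eq_fintype_card, Nat.card_coe_set_eq, Set.ncard_pair hab]
      norm_num
    rw [← h1, pow_one]
    omega
  · have hvc : 𝒮.vcDim ≤ V := by
      refine Finset.sup_le fun s hs => ?_
      rw [Finset.mem_shatterer] at hs
      have hinj : Set.InjOn z s := by
        intro i hi j hj hij
        by_contra hne
        obtain ⟨u, hu, hsu⟩ := hs (Finset.singleton_subset_iff.2 hi)
        obtain ⟨B, -, rfl⟩ := h𝒮 u hu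
        have h1 : i ∈ s ∩ trace z B := by rw [hsu]; simp
        have h2 : j ∈ s ∩ trace z B := by
          rw [Finset.mem_inter, mem_trace] at h1 ⊢
          exact ⟨hj, hij ▸ h1.2⟩
        rw [hsu, Finset.mem_singleton] at h2
        exact hne h2.symm
      refine hV.2 ⟨s.image z, Finset.card_image_of_injOn hinj, ?_⟩
      intro T hT
      obtain ⟨u, hu, hsu⟩ := hs (Finset.filter_subset (fun i => z i ∈ T) s)
      obtain ⟨B, hB, rfl⟩ := h𝒮 u hu
      refine ⟨B, hB, ?_⟩
      ext y
      constructor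
      · rintro ⟨hy, hyB⟩
        simp only [Finset.coe_image, mem_image, Finset.mem_coe] at hy
        obtain ⟨i, hi, rfl⟩ := hy
        have : i ∈ s ∩ trace z B := Finset.mem_inter.2 ⟨hi, mem_trace.2 hyB⟩
        rw [hsu] at this
        exact (Finset.mem_filter.1 this).2
      · intro hy
        have hy' := hT hy
        refine ⟨hy', ?_⟩
        simp only [Finset.coe_image, mem_image, Finset.mem_coe] at hy'
        obtain ⟨i, hi, rfl⟩ := hy'
        have : i ∈ s ∩ trace z B := by
          rw [hsu]; exact Finset.mem_filter.2 ⟨hi, hy⟩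
        exact mem_trace.1 (Finset.mem_inter.1 this).2
    calc 𝒮.card ≤ 𝒮.shatterer.card := Finset.card_le_card_shatterer _
      _ ≤ ∑ k ∈ Finset.Iic 𝒮.vcDim, (Fintype.card ι).choose k := Finset.card_shatterer_le_sum_vcDim
      _ ≤ ∑ k ∈ Finset.Iic V, (Fintype.card ι).choose k :=
        Finset.sum_le_sum_of_subset (Finset.Iic_subset_Iic.2 hvc)
      _ ≤ _ := sum_choose_le_pow (by omega) h2

/-! ### Finite sums: Chernoff bound and exchanges of rows -/

section FiniteSums

lemma sum_prod_eq_prod_sum {T γ : Type*} [Fintype T] [Fintype γ] [DecidableEq γ] (f : γ → T → ℝ) :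
    ∑ g : γ → T, ∏ c, f c (g c) = ∏ c, ∑ τ, f c τ := by
  rw [Finset.prod_univ_sum, Fintype.piFinset_univ]

/-- A binomial variable with mean `24 m`, `m ≥ 34`, is at least `23 m` with probability at least
one half (a Chernoff bound). -/
lemma half_le_sum_ghost {T γ : Type*} [Fintype T] [Fintype γ] [DecidableEq γ] {n : ℕ}
    (hγ : Fintype.card γ = n * 24) {p : T → ℝ} (hp : ∀ τ, 0 ≤ p τ) (hp1 : ∑ τ, p τ = 1)
    (B : Set T) {q : ℝ}
    (hq : q = ∑ τ with τ ∈ B, p τ) (hnq : 34 ≤ n * q) :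
    1 / 2 ≤ ∑ g : γ → T, (∏ c, p (g c)) *
      (if 23 * (n * q) ≤ ((trace g B).card : ℝ) then 1 else 0) := by
  have htot : ∑ g : γ → T, ∏ c, p (g c) = 1 := by
    rw [sum_prod_eq_prod_sum (fun _ => p)]; simp [hp1]
  set s : ℝ := 1 / 24 with hs
  have hpt : ∀ g : γ → T, (∏ c, p (g c)) - (∏ c, p (g c)) *
      (if 23 * (n * q) ≤ ((trace g B).card : ℝ) then 1 else 0) ≤
      Real.exp (s * (23 * (n * q))) * ∏ c, (p (g c) * if g c ∈ B then Real.exp (-s) else 1) := by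
    intro g
    have h0 : 0 ≤ ∏ c, p (g c) := Finset.prod_nonneg fun c _ => hp _
    have h1 : ∏ c, (p (g c) * if g c ∈ B then Real.exp (-s) else 1) =
        (∏ c, p (g c)) * Real.exp (-s * (trace g B).card) := by
      rw [Finset.prod_mul_distrib, Finset.prod_ite, Finset.prod_const, Finset.prod_const_one,
        mul_one, ← Real.exp_nat_mul]
      congr 2
      rw [trace]; ring
    rw [h1]
    split_ifs with h
    · rw [mul_one, sub_self]; positivity
    · rw [mul_zero, sub_zero, mul_left_comm, ← Real.exp_add]
      refine le_mul_of_one_le_right h0 (Real.one_le_exp ?_)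
      push Not at h
      have : 0 < s := by norm_num [hs]
      nlinarith
  have hq0 : 0 ≤ q := by rw [hq]; exact Finset.sum_nonneg fun τ _ => hp τ
  have hone : ∑ τ, (p τ * if τ ∈ B then Real.exp (-s) else 1) ≤
      Real.exp (-(q * (s - s ^ 2 / 2))) := by
    have h1 : ∑ τ, (p τ * if τ ∈ B then Real.exp (-s) else 1) = 1 - q * (1 - Real.exp (-s)) := by
      have : ∀ τ, (p τ * if τ ∈ B then Real.exp (-s) else 1) =
          p τ - (if τ ∈ B then p τ else 0) * (1 - Real.exp (-s)) := by
        intro τ; split_ifs <;> ring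
      simp_rw [this]
      rw [Finset.sum_sub_distrib, hp1, ← Finset.sum_mul, ← Finset.sum_filter, ← hq]
    have h2 : Real.exp (-s) ≤ 1 - s + s ^ 2 / 2 := by
      have h3 : (1 - s + s ^ 2 / 2) * (1 + s + s ^ 2 / 2) ≥ 1 := by norm_num [hs]
      have h4 : 1 + s + s ^ 2 / 2 ≤ Real.exp s := Real.quadratic_le_exp_of_nonneg (by norm_num [hs])
      have h5 : 0 < 1 - s + s ^ 2 / 2 := by norm_num [hs]
      rw [Real.exp_neg, inv_le_comm₀ (Real.exp_pos _) h5]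
      refine le_trans ?_ h4
      rw [inv_le_iff_one_le_mul₀ h5]; linarith
    rw [h1]
    have h6 := Real.add_one_le_exp (-(q * (s - s ^ 2 / 2)))
    nlinarith
  have hsum : ∑ g : γ → T, (Real.exp (s * (23 * (n * q))) *
      ∏ c, (p (g c) * if g c ∈ B then Real.exp (-s) else 1)) ≤ 1 / 2 := by
    rw [← Finset.mul_sum,
      sum_prod_eq_prod_sum (fun _ τ => p τ * if τ ∈ B then Real.exp (-s) else 1),
      Finset.prod_const, Finset.card_univ, hγ]
    have h0 : 0 ≤ ∑ τ, (p τ * if τ ∈ B then Real.exp (-s) else 1) := by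
      refine Finset.sum_nonneg fun τ _ => mul_nonneg (hp τ) ?_
      split_ifs <;> positivity
    calc _ ≤ Real.exp (s * (23 * (n * q))) * Real.exp (-(q * (s - s ^ 2 / 2))) ^ (n * 24) := by
          gcongr
      _ = Real.exp (-(n * q / 48)) := by
          rw [← Real.exp_nat_mul, ← Real.exp_add]
          congr 1
          push_cast
          rw [hs]; ring
      _ ≤ Real.exp (-(34 / 48)) := by gcongr
      _ ≤ 1 / 2 := by
          rw [Real.exp_neg, inv_le_comm₀ (Real.exp_pos _) (by norm_num)]
          have := Real.quadratic_le_exp_of_nonneg (x := 34 / 48) (by norm_num)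
          have h3 : (2 : ℝ) = Real.exp (Real.log 2) := (Real.exp_log (by norm_num)).symm
          rw [one_div, inv_inv, h3]
          gcongr
          have := Real.log_two_lt_d9
          linarith
  have := (Finset.sum_le_sum fun g (_ : g ∈ Finset.univ) => hpt g).trans hsum
  rw [Finset.sum_sub_distrib, htot] at this
  linarith

lemma trace_comp_equiv {T ι : Type*} [Fintype ι] (z : ι → T) (σ : Equiv.Perm ι) (B : Set T) :
    trace (z ∘ σ) B = (trace z B).map σ.symm.toEmbedding := by
  ext i
  simp [Finset.mem_map_equiv]

/-- **Averaging over row-wise exchanges.** For an i.i.d. array `z` on `α × κ` and the traces on it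
of finitely many sets, the exponential moment of the number of points that a trace has in column
`k₀` can be computed as if, in every row, the entry in column `k₀` were chosen at random among the
entries of the row. -/
lemma sum_traces_le {T α κ F : Type*} [Fintype T] [Fintype α] [DecidableEq α] [Fintype κ]
    [DecidableEq κ] [Fintype F] (k₀ : κ)
    {p : T → ℝ} (hp : ∀ τ, 0 ≤ p τ) (hp1 : ∑ τ, p τ = 1) (B : F → Set T)
    (h v : ℕ → ℝ) (hh : ∀ j, 0 ≤ h j) (G ε : ℝ) (hε0 : 0 ≤ ε)
    (hε : ∀ j ≤ Fintype.card α * Fintype.card κ,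
      h j * Real.exp (-((1 - Real.exp (-v j)) * (j / Fintype.card κ))) ≤ ε)
    (hG : ∀ z : α × κ → T, (∀ c, p (z c) ≠ 0) →
      ((Finset.univ.image fun b => trace z (B b)).card : ℝ) ≤ G) :
    ∑ z : α × κ → T, (∏ c, p (z c)) * ∑ I ∈ Finset.univ.image (fun b => trace z (B b)),
      h I.card * Real.exp (-v I.card * (Finset.univ.filter fun a => (a, k₀) ∈ I).card) ≤
      G * ε := by
  set Φ : (α × κ → T) → Finset (Finset (α × κ)) := fun z =>
    Finset.univ.image fun b => trace z (B b) with hΦ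
  set S : (α → κ) → ℝ := fun J => ∑ z : α × κ → T, (∏ c, p (z c)) * ∑ I ∈ Φ z,
      h I.card * Real.exp (-v I.card * (Finset.univ.filter fun a => (a, J a) ∈ I).card) with hS
  have hκ : 0 < Fintype.card κ := Fintype.card_pos_iff.2 ⟨k₀⟩
  have hinv : ∀ J, S J = S fun _ => k₀ := by
    intro J
    let σ : Equiv.Perm (α × κ) :=
      { toFun := fun c => (c.1, Equiv.swap k₀ (J c.1) c.2)
        invFun := fun c => (c.1, Equiv.swap k₀ (J c.1) c.2)
        left_inv := fun c => by simp
        right_inv := fun c => by simp }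
    have hσ : ∀ a, σ (a, k₀) = (a, J a) := fun a => by simp [σ]
    simp only [hS]
    rw [← Equiv.sum_comp (σ.symm.arrowCongr (Equiv.refl T))]
    refine Finset.sum_congr rfl fun z _ => ?_
    have hz : (σ.symm.arrowCongr (Equiv.refl T)) z = z ∘ σ := by
      ext c; simp [Equiv.arrowCongr]
    rw [hz]
    have hmap : Φ (z ∘ σ) = (Φ z).image fun I => I.map σ.symm.toEmbedding := by
      simp only [hΦ, trace_comp_equiv, Finset.image_image]
      rfl
    rw [hmap, Finset.sum_image (fun I _ I' _ hII => Finset.map_injective _ hII)]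
    congr 1
    · exact Equiv.prod_comp σ fun c => p (z c)
    · refine Finset.sum_congr rfl fun I _ => ?_
      have : ∀ a, (a, J a) ∈ I.map σ.symm.toEmbedding ↔ (a, k₀) ∈ I := by
        intro a
        rw [Finset.mem_map_equiv, Equiv.symm_symm]
        simp [σ]
      simp only [Finset.card_map, this]
  have havg : ∀ I : Finset (α × κ),
      ∑ J : α → κ, Real.exp (-v I.card * (Finset.univ.filter fun a => (a, J a) ∈ I).card) ≤
      (Fintype.card κ : ℝ) ^ Fintype.card α *
        Real.exp (-((1 - Real.exp (-v I.card)) * (I.card / Fintype.card κ))) := by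
    intro I
    set w := v I.card
    have h1 : ∀ J : α → κ, Real.exp (-w * (Finset.univ.filter fun a => (a, J a) ∈ I).card) =
        ∏ a, if (a, J a) ∈ I then Real.exp (-w) else 1 := by
      intro J
      rw [Finset.prod_ite, Finset.prod_const, Finset.prod_const_one, mul_one, ← Real.exp_nat_mul]
      congr 1; ring
    simp_rw [h1]
    rw [sum_prod_eq_prod_sum (fun a k => if (a, k) ∈ I then Real.exp (-w) else 1)]
    have h2 : ∀ a, ∑ k, (if (a, k) ∈ I then Real.exp (-w) else 1) ≤ (Fintype.card κ : ℝ) *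
        Real.exp (-((1 - Real.exp (-w)) *
          ((Finset.univ.filter fun k => (a, k) ∈ I).card / Fintype.card κ))) := by
      intro a
      have hk : (0 : ℝ) < Fintype.card κ := by exact_mod_cast hκ
      have h3 : ∑ k, (if (a, k) ∈ I then Real.exp (-w) else 1) = (Fintype.card κ : ℝ) -
          (1 - Real.exp (-w)) * (Finset.univ.filter fun k => (a, k) ∈ I).card := by
        have : ∀ k, (if (a, k) ∈ I then Real.exp (-w) else 1) =
            1 - (if (a, k) ∈ I then (1 - Real.exp (-w)) else 0) := by
          intro k; split_ifs <;> ring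
        simp_rw [this]
        rw [Finset.sum_sub_distrib, ← Finset.sum_filter]
        rw [Finset.sum_const, Finset.sum_const, nsmul_eq_mul, nsmul_eq_mul, Finset.card_univ]
        ring
      rw [h3]
      have h4 := Real.add_one_le_exp (-((1 - Real.exp (-w)) *
          (((Finset.univ.filter fun k => (a, k) ∈ I).card : ℝ) / Fintype.card κ)))
      have h5 := mul_le_mul_of_nonneg_left h4 hk.le
      refine le_trans (le_of_eq ?_) h5
      field_simp
      ring
    calc _ ≤ ∏ a, ((Fintype.card κ : ℝ) * Real.exp (-((1 - Real.exp (-w)) *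
          ((Finset.univ.filter fun k => (a, k) ∈ I).card / Fintype.card κ)))) := by
          refine Finset.prod_le_prod (fun a _ => Finset.sum_nonneg fun k _ => ?_) fun a _ => h2 a
          split_ifs <;> positivity
      _ = _ := by
          rw [Finset.prod_mul_distrib, Finset.prod_const, Finset.card_univ, ← Real.exp_sum]
          congr 2
          rw [Finset.sum_neg_distrib, ← Finset.mul_sum, ← Finset.sum_div]
          congr 3
          rw [← Nat.cast_sum]
          congr 1
          rw [Finset.card_eq_sum_card_fiberwise (f := Prod.fst) (t := Finset.univ) (by simp)]
          refine Finset.sum_congr rfl fun a _ => ?_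
          refine Finset.card_bij (fun k _ => (a, k)) ?_ ?_ ?_
          · simp
          · simp
          · rintro ⟨a', k⟩ hc
            simp only [Finset.mem_filter] at hc
            obtain ⟨hc, rfl⟩ := hc
            exact ⟨k, by simpa using hc, rfl⟩
  have hM : (0 : ℝ) < (Fintype.card κ : ℝ) ^ Fintype.card α := by
    have : (0 : ℝ) < Fintype.card κ := by exact_mod_cast hκ
    positivity
  have hsumJ : ∑ J, S J ≤ (Fintype.card κ : ℝ) ^ Fintype.card α * (G * ε) := by
    simp only [hS]
    rw [Finset.sum_comm]
    have htot : ∑ z : α × κ → T, ∏ c, p (z c) = 1 := by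
      rw [sum_prod_eq_prod_sum (fun _ => p)]; simp [hp1]
    calc _ ≤ ∑ z : α × κ → T, (∏ c, p (z c)) *
          ((Fintype.card κ : ℝ) ^ Fintype.card α * (G * ε)) := by
          refine Finset.sum_le_sum fun z _ => ?_
          rw [← Finset.mul_sum]
          by_cases hz : ∀ c, p (z c) ≠ 0
          · refine mul_le_mul_of_nonneg_left ?_ (Finset.prod_nonneg fun c _ => hp _)
            rw [Finset.sum_comm]
            calc _ ≤ ∑ I ∈ Φ z, (Fintype.card κ : ℝ) ^ Fintype.card α * ε := by
                  refine Finset.sum_le_sum fun I _ => ?_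
                  rw [← Finset.mul_sum]
                  calc _ ≤ h I.card * _ := mul_le_mul_of_nonneg_left (havg I) (hh _)
                    _ = (Fintype.card κ : ℝ) ^ Fintype.card α * (h I.card *
                      Real.exp (-((1 - Real.exp (-v I.card)) * (I.card / Fintype.card κ)))) := by
                        ring
                    _ ≤ _ := by
                        refine mul_le_mul_of_nonneg_left (hε _ ?_) hM.le
                        rw [← Fintype.card_prod]
                        exact Finset.card_le_univ I
              _ = ((Φ z).card : ℝ) * ((Fintype.card κ : ℝ) ^ Fintype.card α * ε) := by simp
              _ ≤ G * ((Fintype.card κ : ℝ) ^ Fintype.card α * ε) := by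
                  gcongr
                  exact hG z hz
              _ = _ := by ring
          · push Not at hz
            obtain ⟨c, hc⟩ := hz
            rw [Finset.prod_eq_zero (Finset.mem_univ c) hc]
            simp
      _ = _ := by rw [← Finset.sum_mul, htot, one_mul]
  have hall : ∑ J, S J = (Fintype.card κ : ℝ) ^ Fintype.card α * S fun _ => k₀ := by
    simp_rw [hinv]
    rw [Finset.sum_const, Finset.card_univ, Fintype.card_fun, nsmul_eq_mul]
    push_cast
    rfl
  rw [hall] at hsumJ
  exact le_of_mul_le_mul_left hsumJ hM

end FiniteSums

/-! ### Truncated noise and Hoeffding's inequality -/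

section Noise

/-- The noise `Y - f(X)` of a labelled point. -/
noncomputable def residual {X : Type*} [MeasurableSpace X] (η : Kernel X ℝ) (w : X × ℝ) : ℝ :=
  w.2 - regressionFn η w.1

/-- Truncation of a real number: kept if its absolute value is at most `t`, replaced by `0`
otherwise. -/
noncomputable def trunc (t u : ℝ) : ℝ := if |u| ≤ t then u else 0

lemma measurable_trunc (t : ℝ) : Measurable (trunc t) :=
  Measurable.ite (measurableSet_le continuous_abs.measurable measurable_const) measurable_id
    measurable_const

lemma abs_trunc_le {t : ℝ} (ht : 0 ≤ t) (u : ℝ) : |trunc t u| ≤ t := by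
  unfold trunc
  split_ifs with h
  · exact h
  · simpa using ht

lemma measurable_regressionFn {X : Type*} [MeasurableSpace X] (η : Kernel X ℝ) [IsMarkovKernel η] :
    Measurable (regressionFn η) :=
  (stronglyMeasurable_id.integral_kernel (κ := η)).measurable

lemma measurable_residual {X : Type*} [MeasurableSpace X] (η : Kernel X ℝ) [IsMarkovKernel η] :
    Measurable (residual η) :=
  measurable_snd.sub ((measurable_regressionFn η).comp measurable_fst)

lemma tail_le_of_tailBound {X : Type*} [MeasurableSpace X] {η : Kernel X ℝ} [IsMarkovKernel η]
    {a : ℝ} (hne : (tailLevels η a).Nonempty) (x : X) :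
    (η x).real {y | tailBound η a < |y - regressionFn η x|} ≤ a := by
  have hbdd : BddBelow (tailLevels η a) := ⟨0, fun t ht => ht.1.le⟩
  obtain ⟨u, hu, hlim, hmem⟩ := exists_seq_tendsto_sInf hne hbdd
  have ha : 0 ≤ a := measureReal_nonneg.trans ((hmem 0).2 x)
  have hset : {y | tailBound η a < |y - regressionFn η x|} =
      ⋃ k, {y | u k < |y - regressionFn η x|} := by
    ext y
    simp only [mem_ofPred_eq, mem_iUnion]
    refine ⟨fun h => ((hlim.eventually (gt_mem_nhds h)).exists), fun ⟨k, hk⟩ =>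
      (csInf_le hbdd (hmem k)).trans_lt hk⟩
  have hmono : Monotone fun k => {y | u k < |y - regressionFn η x|} :=
    fun i j hij y hy => (hu hij).trans_lt hy
  rw [measureReal_def]
  refine ENNReal.toReal_le_of_le_ofReal ha ?_
  rw [hset, hmono.measure_iUnion]
  refine iSup_le fun k => ?_
  rw [← ofReal_measureReal]
  exact ENNReal.ofReal_le_ofReal ((hmem k).2 x)

lemma tailBound_nonneg {X : Type*} [MeasurableSpace X] (η : Kernel X ℝ) (a : ℝ) :
    0 ≤ tailBound η a :=
  Real.sInf_nonneg fun _ ht => ht.1.le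

/-- The truncation of a centred variable is centred up to `√(σ² a)`, where `a` bounds the
probability of exceeding the truncation level (Cauchy–Schwarz). -/
lemma abs_integral_trunc_le (ν : Measure ℝ) [IsProbabilityMeasure ν]
    (hν : MemLp (fun y : ℝ => y) 2 ν) {σ2 a t : ℝ} (ha : 0 < a)
    (hvar : variance (fun y : ℝ => y) ν ≤ σ2)
    (htail : ν.real {y | t < |y - ∫ z, z ∂ν|} ≤ a) :
    |∫ y, trunc t (y - ∫ z, z ∂ν) ∂ν| ≤ √(σ2 * a) := by
  set c := ∫ z, z ∂ν with hc
  have hint : Integrable (fun y : ℝ => y) ν := hν.integrable (by norm_num)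
  have hres : Integrable (fun y : ℝ => y - c) ν := hint.sub (integrable_const c)
  have hsq : Integrable (fun y : ℝ => (y - c) ^ 2) ν := (hν.sub (memLp_const c)).integrable_sq
  have hvar' : ∫ y, (y - c) ^ 2 ∂ν ≤ σ2 := by
    rw [variance_eq_integral hν.aestronglyMeasurable.aemeasurable] at hvar
    simpa using hvar
  have hmeas : MeasurableSet {y : ℝ | t < |y - c|} :=
    measurableSet_lt measurable_const (by fun_prop)
  have htr : Integrable (fun y => trunc t (y - c)) ν := by
    refine hres.mono ((measurable_trunc t).comp (by fun_prop)).aestronglyMeasurable ?_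
    refine Filter.Eventually.of_forall fun y => ?_
    simp only [trunc]
    split_ifs <;> simp
  have hzero : ∫ y, (y - c) ∂ν = 0 := by
    rw [integral_sub hint (integrable_const c)]; simp [hc]
  have hdiff : |∫ y, trunc t (y - c) ∂ν| ≤ ∫ y, |trunc t (y - c) - (y - c)| ∂ν := by
    have : ∫ y, trunc t (y - c) ∂ν = ∫ y, (trunc t (y - c) - (y - c)) ∂ν := by
      rw [integral_sub htr hres, hzero, sub_zero]
    rw [this]
    exact abs_integral_le_integral_abs
  set m := |∫ y, trunc t (y - c) ∂ν| with hm
  have hm0 : 0 ≤ m := abs_nonneg _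
  -- the weighted form of the Cauchy–Schwarz inequality, with a free weight `b`
  have key : ∀ b : ℝ, 0 < b → 2 * m ≤ σ2 / b + b * a := by
    intro b hb
    have hpt : ∀ y, |trunc t (y - c) - (y - c)| ≤
        ((y - c) ^ 2 / b + b * ({y | t < |y - c|}.indicator (fun _ => (1 : ℝ)) y)) / 2 := by
      intro y
      by_cases hy : t < |y - c|
      · rw [indicator_of_mem (by exact hy), trunc, if_neg (not_le.2 hy), zero_sub, abs_neg]
        have h1 : 0 ≤ (|y - c| - b) ^ 2 / b := by positivity
        have h2 : (|y - c| - b) ^ 2 / b = (y - c) ^ 2 / b - 2 * |y - c| + b := by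
          field_simp
          rw [sub_sq, sq_abs]; ring
        linarith
      · rw [indicator_of_notMem (by exact hy), trunc, if_pos (not_lt.1 hy)]
        simp only [sub_self, abs_zero]
        positivity
    have hi2 : Integrable (fun y => ((y - c) ^ 2 / b +
        b * ({y | t < |y - c|}.indicator (fun _ => (1 : ℝ)) y)) / 2) ν :=
      ((hsq.div_const b).add
        (((integrable_const (1 : ℝ)).indicator hmeas).const_mul b)).div_const 2
    have h3 := integral_mono (htr.sub hres).abs hi2 hpt
    rw [integral_div, integral_add (hsq.div_const b)
      (((integrable_const (1 : ℝ)).indicator hmeas).const_mul b), integral_div,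
      integral_const_mul, integral_indicator_const _ hmeas, smul_eq_mul, mul_one] at h3
    have h4 : (∫ y, (y - c) ^ 2 ∂ν) / b ≤ σ2 / b := by gcongr
    have h5 : b * ν.real {y | t < |y - c|} ≤ b * a := by gcongr
    have h6 := hdiff.trans h3
    linarith
  rcases hm0.eq_or_lt with h0 | h0
  · rw [← h0]; positivity
  · refine Real.le_sqrt_of_sq_le ?_
    have := key (m / a) (by positivity)
    have h7 : m / a * a = m := by field_simp
    rw [h7, div_div_eq_mul_div] at this
    have h8 : m ≤ σ2 * a / m := by linarith
    rw [le_div_iff₀ h0] at h8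
    nlinarith

/-- Hoeffding's lemma for the truncation of a nearly centred variable, for a multiple `s` of
either sign. -/
lemma integral_exp_trunc_le (ν : Measure ℝ) [IsProbabilityMeasure ν] {c t m : ℝ} (ht : 0 ≤ t)
    (hm : |∫ y, trunc t (y - c) ∂ν| ≤ m) (s : ℝ) :
    ∫ y, Real.exp (s * trunc t (y - c)) ∂ν ≤ Real.exp (s ^ 2 * t ^ 2 / 2 + |s| * m) := by
  have hmeas : Measurable fun y => trunc t (y - c) := (measurable_trunc t).comp (by fun_prop)
  have hsub := hasSubgaussianMGF_of_mem_Icc (μ := ν) (X := fun y => trunc t (y - c)) (a := -t)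
    (b := t) hmeas.aemeasurable (Filter.Eventually.of_forall fun y => abs_le.1 (abs_trunc_le ht _))
  have h1 := hsub.mgf_le s
  set e := ∫ y, trunc t (y - c) ∂ν with he
  have hpar : (((‖t - -t‖₊ / 2) ^ 2 : NNReal) : ℝ) = t ^ 2 := by
    push_cast
    rw [sub_neg_eq_add, Real.norm_eq_abs, div_pow, sq_abs]; ring
  rw [hpar, mgf] at h1
  have h2 : ∀ y, Real.exp (s * trunc t (y - c)) =
      Real.exp (s * e) * Real.exp (s * (trunc t (y - c) - e)) := by
    intro y; rw [← Real.exp_add]; congr 1; ring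
  simp_rw [h2]
  rw [integral_const_mul]
  calc _ ≤ Real.exp (s * e) * Real.exp (t ^ 2 * s ^ 2 / 2) := by gcongr
    _ ≤ Real.exp (|s| * m) * Real.exp (t ^ 2 * s ^ 2 / 2) := by
        refine mul_le_mul_of_nonneg_right (Real.exp_le_exp.2 ?_) (Real.exp_pos _).le
        calc s * e ≤ |s * e| := le_abs_self _
          _ = |s| * |e| := abs_mul _ _
          _ ≤ |s| * m := by gcongr
    _ = _ := by rw [← Real.exp_add]; congr 1; ring

/-- The finite information about a point used to describe traces: which members of the finite
family `B` contain it. -/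
noncomputable def cell {X F : Type*} [Fintype F] (B : F → Set X) (x : X) : Finset F :=
  Finset.univ.filter fun b => x ∈ B b

@[simp]
lemma mem_cell {X F : Type*} [Fintype F] {B : F → Set X} {x : X} {b : F} :
    b ∈ cell B x ↔ x ∈ B b := by
  simp [cell]

/-- The samples whose points lie in prescribed cells. -/
def cellEvent {X F : Type*} [Fintype F] (B : F → Set X) {n : ℕ} (τ : Fin n → Finset F) :
    Set (Fin n → X × ℝ) :=
  {ω | ∀ i, cell B (ω i).1 = τ i}

lemma measurableSet_cell {X F : Type*} [MeasurableSpace X] [Fintype F] {B : F → Set X}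
    (hB : ∀ b, MeasurableSet (B b)) (τ : Finset F) : MeasurableSet (cell B ⁻¹' {τ}) := by
  have : cell B ⁻¹' {τ} = ⋂ b, {x | b ∈ τ ↔ x ∈ B b} := by
    ext x
    simp only [mem_preimage, mem_singleton_iff, mem_iInter, mem_ofPred_eq, Finset.ext_iff, mem_cell]
    exact forall_congr' fun b => Iff.comm
  rw [this]
  refine MeasurableSet.iInter fun b => ?_
  by_cases hb : b ∈ τ
  · simpa [hb] using hB b
  · simp only [hb, false_iff]
    exact (hB b).compl

lemma measurableSet_cellEvent {X F : Type*} [MeasurableSpace X] [Fintype F] {B : F → Set X}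
    (hB : ∀ b, MeasurableSet (B b)) {n : ℕ} (τ : Fin n → Finset F) :
    MeasurableSet (cellEvent B τ) := by
  have : cellEvent B τ = ⋂ i, (fun ω : Fin n → X × ℝ => (ω i).1) ⁻¹' (cell B ⁻¹' {τ i}) := by
    ext ω; simp [cellEvent]
  rw [this]
  exact MeasurableSet.iInter fun i =>
    (measurable_fst.comp (measurable_pi_apply i)) (measurableSet_cell hB _)

lemma sum_measure_cell {X F : Type*} [MeasurableSpace X] [Fintype F] {B : F → Set X}
    (hB : ∀ b, MeasurableSet (B b)) (μ : Measure X) [IsProbabilityMeasure μ]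
    (P : Finset F → Prop) :
    ∑ τ with P τ, μ.real (cell B ⁻¹' {τ}) = μ.real {x | P (cell B x)} := by
  rw [← measureReal_biUnion_finset]
  · congr 1
    ext x
    simp
  · intro τ _ τ' _ h
    refine Disjoint.preimage _ ?_
    simpa using h
  · exact fun τ _ => measurableSet_cell hB τ

/-- One factor of the exponential moment of a noise sum. -/
lemma integral_cell_exp_le {X : Type*} [MeasurableSpace X] (μ : Measure X)
    [IsProbabilityMeasure μ] (η : Kernel X ℝ) [IsMarkovKernel η] {t m : ℝ} (ht : 0 ≤ t)
    (hm : ∀ x, |∫ y, trunc t (y - regressionFn η x) ∂(η x)| ≤ m) {D : Set X}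
    (hD : MeasurableSet D) (s c : ℝ) :
    ∫ w, D.indicator (fun _ => (1 : ℝ)) w.1 * Real.exp (s * trunc t (residual η w) - c)
      ∂(μ.compProd η) ≤ μ.real D * Real.exp (s ^ 2 * t ^ 2 / 2 + |s| * m - c) := by
  have hmeas : Measurable fun w : X × ℝ =>
      D.indicator (fun _ => (1 : ℝ)) w.1 * Real.exp (s * trunc t (residual η w) - c) := by
    refine ((measurable_const.indicator hD).comp measurable_fst).mul ?_
    exact Real.measurable_exp.comp ((((measurable_trunc t).comp
      (measurable_residual η)).const_mul s).sub_const c)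
  have hint : Integrable (fun w : X × ℝ =>
      D.indicator (fun _ => (1 : ℝ)) w.1 * Real.exp (s * trunc t (residual η w) - c))
      (μ.compProd η) := by
    refine Integrable.of_bound hmeas.aestronglyMeasurable (Real.exp (|s| * t - c))
      (Filter.Eventually.of_forall fun w => ?_)
    rw [norm_mul, Real.norm_eq_abs, Real.norm_eq_abs, Real.abs_exp]
    have h1 : |D.indicator (fun _ => (1 : ℝ)) w.1| ≤ 1 := by
      unfold indicator; split_ifs <;> simp
    have h2 : s * trunc t (residual η w) ≤ |s| * t :=
      calc _ ≤ |s * trunc t (residual η w)| := le_abs_self _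
        _ = |s| * |trunc t (residual η w)| := abs_mul _ _
        _ ≤ _ := by gcongr; exact abs_trunc_le ht _
    calc _ ≤ 1 * Real.exp (|s| * t - c) := by gcongr
      _ = _ := one_mul _
  rw [Measure.integral_compProd hint]
  have h1 : ∀ x, ∫ y, D.indicator (fun _ => (1 : ℝ)) x *
      Real.exp (s * trunc t (residual η (x, y)) - c) ∂(η x) ≤
      D.indicator (fun _ => (1 : ℝ)) x * Real.exp (s ^ 2 * t ^ 2 / 2 + |s| * m - c) := by
    intro x
    rw [integral_const_mul]
    refine mul_le_mul_of_nonneg_left ?_ (indicator_nonneg (fun _ _ => zero_le_one) _)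
    have h2 : ∀ y, Real.exp (s * trunc t (residual η (x, y)) - c) =
        Real.exp (-c) * Real.exp (s * trunc t (y - regressionFn η x)) := by
      intro y; rw [← Real.exp_add, residual]; congr 1; ring
    simp_rw [h2]
    rw [integral_const_mul]
    calc _ ≤ Real.exp (-c) * Real.exp (s ^ 2 * t ^ 2 / 2 + |s| * m) := by
          gcongr
          exact integral_exp_trunc_le (η x) ht (hm x) s
      _ = _ := by rw [← Real.exp_add]; congr 1; ring
  calc _ ≤ ∫ x, D.indicator (fun _ => (1 : ℝ)) x *
        Real.exp (s ^ 2 * t ^ 2 / 2 + |s| * m - c) ∂μ := by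
        refine integral_mono (hint.integral_compProd) ?_ h1
        exact ((integrable_const _).indicator hD).mul_const _
    _ = _ := by
        rw [integral_mul_const, integral_indicator_const _ hD, smul_eq_mul, mul_one]

/-- **Hoeffding's inequality** for the sum of the truncated noise over the indices in `I`, jointly
with the cells of the sample points. -/
lemma measure_cellEvent_inter_sum_ge_le {X F : Type*} [MeasurableSpace X] [Fintype F]
    {B : F → Set X} (hB : ∀ b, MeasurableSet (B b)) (μ : Measure X) [IsProbabilityMeasure μ]
    (η : Kernel X ℝ) [IsMarkovKernel η] {n : ℕ} (τ : Fin n → Finset F) (I : Finset (Fin n))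
    {t m c e : ℝ} (ht : 0 < t) (he : |e| = 1)
    (hm : ∀ x, |∫ y, trunc t (y - regressionFn η x) ∂(η x)| ≤ m) (hc : m ≤ c) :
    (sampleLaw μ η n).real (cellEvent B τ ∩
        {ω | I.card * c ≤ e * ∑ i ∈ I, trunc t (residual η (ω i))}) ≤
      (∏ i, μ.real (cell B ⁻¹' {τ i})) * Real.exp (-(I.card * ((c - m) ^ 2 / (2 * t ^ 2)))) := by
  have : IsProbabilityMeasure (sampleLaw μ η n) := by unfold sampleLaw; infer_instance
  set s : ℝ := (c - m) / t ^ 2 with hs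
  have hs0 : 0 ≤ s := by have := sub_nonneg.2 hc; positivity
  set g : Fin n → X × ℝ → ℝ := fun i w =>
    (cell B ⁻¹' {τ i}).indicator (fun _ => (1 : ℝ)) w.1 *
      Real.exp ((if i ∈ I then s * e else 0) * trunc t (residual η w) -
        (if i ∈ I then s * c else 0)) with hg
  have hg0 : ∀ i w, 0 ≤ g i w := fun i w =>
    mul_nonneg (indicator_nonneg (fun _ _ => zero_le_one) _) (Real.exp_pos _).le
  have hgm : ∀ i, Measurable (g i) := by
    intro i
    refine ((measurable_const.indicator (measurableSet_cell hB _)).comp measurable_fst).mul ?_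
    exact Real.measurable_exp.comp ((((measurable_trunc t).comp
      (measurable_residual η)).const_mul _).sub_const _)
  have hgi : ∀ i, Integrable (g i) (μ.compProd η) := by
    intro i
    refine Integrable.of_bound (hgm i).aestronglyMeasurable (Real.exp (s * t))
      (Filter.Eventually.of_forall fun w => ?_)
    rw [Real.norm_eq_abs, abs_of_nonneg (hg0 i w)]
    have h1 : (cell B ⁻¹' {τ i}).indicator (fun _ => (1 : ℝ)) w.1 ≤ 1 := by
      unfold indicator; split_ifs <;> simp
    have hc0 : 0 ≤ c := (abs_nonneg _).trans ((hm w.1).trans hc)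
    have h2 : (if i ∈ I then s * e else 0) * trunc t (residual η w) -
        (if i ∈ I then s * c else 0) ≤ s * t := by
      split_ifs
      · have h3 : e * trunc t (residual η w) ≤ t :=
          (le_abs_self _).trans (by rw [abs_mul, he, one_mul]; exact abs_trunc_le ht.le _)
        have h4 := mul_le_mul_of_nonneg_left h3 hs0
        have h5 : 0 ≤ s * c := by positivity
        linarith
      · have : 0 ≤ s * t := by positivity
        linarith
    calc g i w ≤ 1 * Real.exp (s * t) := by simp only [hg]; gcongr
      _ = _ := one_mul _
  have hmS : MeasurableSet (cellEvent B τ ∩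
      {ω | I.card * c ≤ e * ∑ i ∈ I, trunc t (residual η (ω i))}) := by
    refine (measurableSet_cellEvent hB τ).inter (measurableSet_le measurable_const ?_)
    exact (Finset.measurable_sum _ fun i _ => (measurable_trunc t).comp
      ((measurable_residual η).comp (measurable_pi_apply i))).const_mul e
  have hpt : ∀ ω, (cellEvent B τ ∩
      {ω | I.card * c ≤ e * ∑ i ∈ I, trunc t (residual η (ω i))}).indicator
      (fun _ => (1 : ℝ)) ω ≤ ∏ i, g i (ω i) := by
    intro ω
    by_cases hω : ω ∈ cellEvent B τ ∩ {ω | I.card * c ≤ e * ∑ i ∈ I, trunc t (residual η (ω i))}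
    · rw [indicator_of_mem hω]
      simp only [hg]
      rw [Finset.prod_mul_distrib, ← Real.exp_sum, Finset.prod_eq_one, one_mul]
      · refine Real.one_le_exp ?_
        have h1 : ∑ i, ((if i ∈ I then s * e else 0) * trunc t (residual η (ω i)) -
            (if i ∈ I then s * c else 0)) =
            s * (e * ∑ i ∈ I, trunc t (residual η (ω i)) - I.card * c) := by
          simp only [ite_mul, zero_mul, Finset.sum_sub_distrib, Finset.sum_ite_mem,
            Finset.univ_inter, Finset.sum_const, nsmul_eq_mul, Finset.mul_sum]
          rw [mul_sub, Finset.mul_sum]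
          congr 1
          · exact Finset.sum_congr rfl fun i _ => by ring
          · ring
        rw [h1]
        exact mul_nonneg hs0 (sub_nonneg.2 hω.2)
      · intro i _
        rw [indicator_of_mem]
        exact hω.1 i
    · rw [indicator_of_notMem hω]
      exact Finset.prod_nonneg fun i _ => hg0 i _
  have hle : ∀ i, ∫ w, g i w ∂(μ.compProd η) ≤ μ.real (cell B ⁻¹' {τ i}) *
      (if i ∈ I then Real.exp (-((c - m) ^ 2 / (2 * t ^ 2))) else 1) := by
    intro i
    refine (integral_cell_exp_le μ η ht.le hm (measurableSet_cell hB _) _ _).trans (le_of_eq ?_)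
    congr 1
    split_ifs
    · congr 1
      rw [abs_mul, he, mul_one, abs_of_nonneg hs0, mul_pow, ← sq_abs e, he, hs]
      field_simp
      ring
    · simp
  calc _ = ∫ ω, (cellEvent B τ ∩
          {ω | I.card * c ≤ e * ∑ i ∈ I, trunc t (residual η (ω i))}).indicator
          (fun _ => (1 : ℝ)) ω ∂(sampleLaw μ η n) := by
        rw [integral_indicator_const _ hmS, smul_eq_mul, mul_one]
    _ ≤ ∫ ω, ∏ i, g i (ω i) ∂(sampleLaw μ η n) :=
        integral_mono ((integrable_const _).indicator hmS) (Integrable.fintype_prod hgi) hpt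
    _ = ∏ i, ∫ w, g i w ∂(μ.compProd η) := integral_fintype_prod_eq_prod g
    _ ≤ ∏ i, (μ.real (cell B ⁻¹' {τ i}) *
          (if i ∈ I then Real.exp (-((c - m) ^ 2 / (2 * t ^ 2))) else 1)) :=
        Finset.prod_le_prod (fun i _ => integral_nonneg (hg0 i)) fun i _ => hle i
    _ = _ := by
        rw [Finset.prod_mul_distrib, Finset.prod_ite_mem, Finset.univ_inter, Finset.prod_const,
          ← Real.exp_nat_mul]
        congr 2
        ring

/-- The probability that a sample has prescribed cells. -/
lemma measure_cellEvent {X F : Type*} [MeasurableSpace X] [Fintype F]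
    {B : F → Set X} (hB : ∀ b, MeasurableSet (B b)) (μ : Measure X) [IsProbabilityMeasure μ]
    (η : Kernel X ℝ) [IsMarkovKernel η] {n : ℕ} (τ : Fin n → Finset F) :
    (sampleLaw μ η n).real (cellEvent B τ) = ∏ i, μ.real (cell B ⁻¹' {τ i}) := by
  have h1 : cellEvent B τ = Set.univ.pi fun i => (cell B ⁻¹' {τ i}) ×ˢ (Set.univ : Set ℝ) := by
    ext ω; simp [cellEvent]
  rw [h1, sampleLaw, measureReal_def, Measure.pi_pi, ENNReal.toReal_prod]
  refine Finset.prod_congr rfl fun i _ => ?_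
  rw [Measure.compProd_apply_prod (measurableSet_cell hB _) MeasurableSet.univ]
  simp [measureReal_def]

/-- The noise exceeds the uniform tail bound at some sample point with small probability. -/
lemma measure_exists_tail_le {X : Type*} [MeasurableSpace X] (μ : Measure X)
    [IsProbabilityMeasure μ] (η : Kernel X ℝ) [IsMarkovKernel η] {n : ℕ} {a : ℝ}
    (hne : (tailLevels η a).Nonempty) :
    (sampleLaw μ η n).real {ω | ∃ i, tailBound η a < |residual η (ω i)|} ≤ n * a := by
  have : IsProbabilityMeasure (sampleLaw μ η n) := by unfold sampleLaw; infer_instance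
  have hD : MeasurableSet {w : X × ℝ | tailBound η a < |residual η w|} :=
    measurableSet_lt measurable_const (continuous_abs.measurable.comp (measurable_residual η))
  have hone : (μ.compProd η).real {w | tailBound η a < |residual η w|} ≤ a := by
    have h1 : (μ.compProd η) {w | tailBound η a < |residual η w|} ≤ ENNReal.ofReal a := by
      rw [Measure.compProd_apply hD]
      calc _ ≤ ∫⁻ _, ENNReal.ofReal a ∂μ := by
            refine lintegral_mono fun x => ?_
            rw [← ofReal_measureReal]
            exact ENNReal.ofReal_le_ofReal (tail_le_of_tailBound hne x)
        _ = _ := by simp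
    obtain ⟨t, ht⟩ := hne
    have hX : Nonempty X := by
      by_contra h
      rw [not_nonempty_iff] at h
      have := measure_univ (μ := μ)
      rw [Set.univ_eq_empty_iff.2 h, measure_empty] at this
      exact zero_ne_one this
    exact ENNReal.toReal_le_of_le_ofReal
      (measureReal_nonneg.trans (ht.2 (Classical.choice hX))) h1
  have hset : {ω : Fin n → X × ℝ | ∃ i, tailBound η a < |residual η (ω i)|} =
      ⋃ i ∈ (Finset.univ : Finset (Fin n)),
        (fun ω => ω i) ⁻¹' {w | tailBound η a < |residual η w|} := by
    ext ω; simp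
  rw [hset]
  refine (measureReal_biUnion_finset_le _ _).trans ?_
  calc _ = ∑ i : Fin n, (μ.compProd η).real {w | tailBound η a < |residual η w|} := by
        refine Finset.sum_congr rfl fun i _ => ?_
        rw [measureReal_def, measureReal_def, sampleLaw]
        rw [(measurePreserving_eval (fun _ : Fin n => μ.compProd η) i).measure_preimage
          hD.nullMeasurableSet]
    _ ≤ ∑ i : Fin n, a := Finset.sum_le_sum fun i _ => hone
    _ = _ := by simp

end Noise

/-! ### Union bounds over traces, with and without ghost samples -/

section Uniform

lemma isProbabilityMeasure_sampleLaw {X : Type*} [MeasurableSpace X] (μ : Measure X)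
    [IsProbabilityMeasure μ] (η : Kernel X ℝ) [IsMarkovKernel η] (n : ℕ) :
    IsProbabilityMeasure (sampleLaw μ η n) := by
  unfold sampleLaw; infer_instance

lemma card_traces_cell_le {X : Type*} [MetricSpace X] [Nontrivial X] [MeasurableSpace X] {V : ℕ}
    (hV : HasVCDim (balls X) V) (μ : Measure X) {F : Type*} [Fintype F] {B : F → Set X}
    (hball : ∀ b, B b ∈ balls X) {ι : Type*} [Fintype ι] [DecidableEq ι] (hι : 4 ≤ Fintype.card ι)
    (z : ι → Finset F) (hz : ∀ c, μ.real (cell B ⁻¹' {z c}) ≠ 0) :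
    (Finset.univ.image fun b => trace z {τ | b ∈ τ}).card ≤ Fintype.card ι ^ V := by
  have hne : ∀ c, ∃ x, cell B x = z c := by
    intro c
    by_contra! h
    refine hz c ?_
    have : cell B ⁻¹' {z c} = ∅ := by
      ext x; simpa using h x
    rw [this, measureReal_empty]
  choose x hx using hne
  refine card_traces_le hV hι x _ fun s hs => ?_
  obtain ⟨b, -, rfl⟩ := Finset.mem_image.1 hs
  refine ⟨B b, hball b, ?_⟩
  ext c
  rw [mem_trace, mem_trace, ← hx c]
  exact mem_cell

/-- **Union bound over traces.** -/
lemma measure_iUnion_le_of_trace {X : Type*} [MetricSpace X] [Nontrivial X] [MeasurableSpace X]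
    {V : ℕ} (hV : HasVCDim (balls X) V) (μ : Measure X) [IsProbabilityMeasure μ]
    (η : Kernel X ℝ) [IsMarkovKernel η] {F : Type*} [Fintype F] {B : F → Set X}
    (hball : ∀ b, B b ∈ balls X) (hB : ∀ b, MeasurableSet (B b)) {n : ℕ} (hn : 4 ≤ n)
    (bad : F → Set (Fin n → X × ℝ)) (badI : Finset (Fin n) → Set (Fin n → X × ℝ))
    (hbad : ∀ b, ∀ ω ∈ bad b, ω ∈ badI (trace (fun i => (ω i).1) (B b)))
    {ε : ℝ} (hε : 0 ≤ ε)
    (hprob : ∀ τ I, (sampleLaw μ η n).real (cellEvent B τ ∩ badI I) ≤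
      (∏ i, μ.real (cell B ⁻¹' {τ i})) * ε) :
    (sampleLaw μ η n).real (⋃ b, bad b) ≤ (n : ℝ) ^ V * ε := by
  have := isProbabilityMeasure_sampleLaw μ η n
  have hp1 : ∑ τ, μ.real (cell B ⁻¹' {τ}) = 1 := by
    have := sum_measure_cell hB μ (fun _ => True)
    simpa using this
  have hcover : (⋃ b, bad b) ⊆ ⋃ τ ∈ (Finset.univ : Finset (Fin n → Finset F)),
      ⋃ I ∈ Finset.univ.image (fun b => trace τ {σ | b ∈ σ}), cellEvent B τ ∩ badI I := by
    intro ω hω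
    obtain ⟨b, hb⟩ := mem_iUnion.1 hω
    simp only [mem_iUnion]
    refine ⟨fun i => cell B (ω i).1, Finset.mem_univ _, _,
      Finset.mem_image_of_mem _ (Finset.mem_univ b), fun i => rfl, ?_⟩
    convert hbad b ω hb using 2
    ext i
    simp
  calc _ ≤ (sampleLaw μ η n).real (⋃ τ ∈ (Finset.univ : Finset (Fin n → Finset F)),
        ⋃ I ∈ Finset.univ.image (fun b => trace τ {σ | b ∈ σ}), cellEvent B τ ∩ badI I) :=
        measureReal_mono hcover (measure_ne_top _ _)
    _ ≤ ∑ τ : Fin n → Finset F, ∑ I ∈ Finset.univ.image (fun b => trace τ {σ | b ∈ σ}),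
        (sampleLaw μ η n).real (cellEvent B τ ∩ badI I) :=
        (measureReal_biUnion_finset_le _ _).trans
          (Finset.sum_le_sum fun τ _ => measureReal_biUnion_finset_le _ _)
    _ ≤ ∑ τ : Fin n → Finset F, (∏ i, μ.real (cell B ⁻¹' {τ i})) * ((n : ℝ) ^ V * ε) := by
        refine Finset.sum_le_sum fun τ _ => ?_
        by_cases hz : ∀ c, μ.real (cell B ⁻¹' {τ c}) ≠ 0
        · have hcard := card_traces_cell_le hV μ hball (by simpa using hn) τ hz
          rw [Fintype.card_fin] at hcard
          calc _ ≤ ∑ I ∈ Finset.univ.image (fun b => trace τ {σ | b ∈ σ}),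
                (∏ i, μ.real (cell B ⁻¹' {τ i})) * ε := Finset.sum_le_sum fun I _ => hprob τ I
            _ = (∏ i, μ.real (cell B ⁻¹' {τ i})) *
                  (((Finset.univ.image (fun b => trace τ {σ | b ∈ σ})).card : ℝ) * ε) := by
                rw [Finset.sum_const, nsmul_eq_mul]; ring
            _ ≤ _ := by
                refine mul_le_mul_of_nonneg_left (mul_le_mul_of_nonneg_right ?_ hε)
                  (Finset.prod_nonneg fun i _ => measureReal_nonneg)
                exact_mod_cast hcard
        · push Not at hz
          obtain ⟨c, hc⟩ := hz
          rw [Finset.prod_eq_zero (Finset.mem_univ c) hc, zero_mul]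
          refine Finset.sum_nonpos fun I _ => (hprob τ I).trans ?_
          rw [Finset.prod_eq_zero (Finset.mem_univ c) hc, zero_mul]
    _ = _ := by
        rw [← Finset.sum_mul, sum_prod_eq_prod_sum (fun _ τ => μ.real (cell B ⁻¹' {τ}))]
        simp [hp1]

/-- An array with a distinguished column, as that column together with the rest of the array. -/
def arrayEquiv (α κ T : Type*) : (α → T) × (α × κ → T) ≃ (α × Option κ → T) where
  toFun p c := c.2.elim (p.1 c.1) fun k => p.2 (c.1, k)
  invFun z := (fun a => z (a, none), fun c => z (c.1, some c.2))
  left_inv p := rfl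
  right_inv z := by ext ⟨a, k⟩; cases k <;> rfl

@[simp]
lemma arrayEquiv_none {α κ T : Type*} (p : (α → T) × (α × κ → T)) (a : α) :
    arrayEquiv α κ T p (a, none) = p.1 a := rfl

@[simp]
lemma arrayEquiv_some {α κ T : Type*} (p : (α → T) × (α × κ → T)) (a : α) (k : κ) :
    arrayEquiv α κ T p (a, some k) = p.2 (a, k) := rfl

/-- **Symmetrization with ghost samples.** Let every set of a finite family of balls have expected
count at least `q₀ ≥ 34`. If the bad event of a ball of expected count at most `q` and trace `I`
has, given the cells of the sample points, probability at most `a(q) exp(-v(q) |I|)`, then, up to a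
factor `2` and the number of traces on `25 n` points, the probability that some bad event occurs is
at most the value this bound takes after averaging over a random choice of the sample out of
`25 n` points, of which `23 q` lie in the ball. -/
lemma measure_iUnion_le_of_ghost {X : Type*} [MetricSpace X] [Nontrivial X] [MeasurableSpace X]
    {V : ℕ} (hV : HasVCDim (balls X) V) (μ : Measure X) [IsProbabilityMeasure μ]
    (η : Kernel X ℝ) [IsMarkovKernel η] {F : Type*} [Fintype F] {B : F → Set X}
    (hball : ∀ b, B b ∈ balls X) (hB : ∀ b, MeasurableSet (B b)) {n : ℕ} (hn : 4 ≤ n)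
    {q₀ : ℝ} (hq₀ : 34 ≤ q₀) (hmass : ∀ b, q₀ ≤ n * μ.real (B b))
    (bad : F → Set (Fin n → X × ℝ)) (hbadm : ∀ b, MeasurableSet (bad b))
    (badq : ℝ → Finset (Fin n) → Set (Fin n → X × ℝ))
    (hbad : ∀ b, ∀ ω ∈ bad b, ∀ q, n * μ.real (B b) ≤ q →
      ω ∈ badq q (trace (fun i => (ω i).1) (B b)))
    (a v : ℝ → ℝ) (ha : ∀ q, 0 ≤ a q) {ε : ℝ} (hε0 : 0 ≤ ε)
    (hprob : ∀ τ q I, q₀ ≤ q → q ≤ 25 / 23 * n →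
      (sampleLaw μ η n).real (cellEvent B τ ∩ badq q I) ≤
        (∏ i, μ.real (cell B ⁻¹' {τ i})) * (a q * Real.exp (-v q * I.card)))
    (hε : ∀ q, q₀ ≤ q → q ≤ 25 / 23 * n →
      a q * Real.exp (-((1 - Real.exp (-v q)) * (23 / 25 * q))) ≤ ε) :
    (sampleLaw μ η n).real (⋃ b, bad b) ≤ 2 * ((25 * n : ℝ) ^ V * ε) := by
  have := isProbabilityMeasure_sampleLaw μ η n
  set P := sampleLaw μ η n with hP
  set p : Finset F → ℝ := fun τ => μ.real (cell B ⁻¹' {τ}) with hp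
  have hp0 : ∀ τ, 0 ≤ p τ := fun τ => measureReal_nonneg
  have hp1 : ∑ τ, p τ = 1 := by
    have := sum_measure_cell hB μ (fun _ => True)
    simpa using this
  have hpb : ∀ b, μ.real (B b) = ∑ τ with τ ∈ {σ : Finset F | b ∈ σ}, p τ := by
    intro b
    have := sum_measure_cell hB μ (fun τ => b ∈ τ)
    simp only [mem_cell] at this
    convert this.symm
    · ext; rfl
    · exact Iff.rfl
  let D : (Fin n × Fin 24 → Finset F) → Set F := fun g =>
    {b | 23 * (n * μ.real (B b)) ≤ ((trace g {σ | b ∈ σ}).card : ℝ)}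
  let U : (Fin n → Finset F) → (Fin n × Fin 24 → Finset F) → Set (Fin n → X × ℝ) := fun τ g =>
    cellEvent B τ ∩ ⋃ b ∈ D g, bad b
  have hUm : ∀ τ g, MeasurableSet (U τ g) := fun τ g => (measurableSet_cellEvent hB τ).inter
    (MeasurableSet.biUnion (Set.to_countable _) fun b _ => hbadm b)
  -- a ball with a bad event keeps its expected count in the ghost sample with probability 1/2
  have hhalf : ∀ τ, P.real (cellEvent B τ ∩ ⋃ b, bad b) ≤
      2 * ∑ g : Fin n × Fin 24 → Finset F, (∏ c, p (g c)) * P.real (U τ g) := by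
    intro τ
    have hm0 : MeasurableSet (cellEvent B τ ∩ ⋃ b, bad b) :=
      (measurableSet_cellEvent hB τ).inter (MeasurableSet.iUnion hbadm)
    have hpt : ∀ ω, (cellEvent B τ ∩ ⋃ b, bad b).indicator (fun _ => (1 : ℝ)) ω ≤
        2 * ∑ g : Fin n × Fin 24 → Finset F,
          (∏ c, p (g c)) * (U τ g).indicator (fun _ => (1 : ℝ)) ω := by
      intro ω
      by_cases hω : ω ∈ cellEvent B τ ∩ ⋃ b, bad b
      · rw [indicator_of_mem hω]
        obtain ⟨b, hb⟩ := mem_iUnion.1 hω.2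
        have h1 := half_le_sum_ghost (γ := Fin n × Fin 24) (n := n) (by simp) hp0 hp1
          {σ : Finset F | b ∈ σ} (by convert hpb b) (hq₀.trans (hmass b))
        have h2 : ∑ g : Fin n × Fin 24 → Finset F, (∏ c, p (g c)) *
            (if 23 * (n * μ.real (B b)) ≤ ((trace g {σ : Finset F | b ∈ σ}).card : ℝ)
              then (1 : ℝ) else 0) ≤ ∑ g : Fin n × Fin 24 → Finset F,
            (∏ c, p (g c)) * (U τ g).indicator (fun _ => (1 : ℝ)) ω := by
          refine Finset.sum_le_sum fun g _ => mul_le_mul_of_nonneg_left ?_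
            (Finset.prod_nonneg fun c _ => hp0 _)
          split_ifs with hg
          · rw [indicator_of_mem]
            exact ⟨hω.1, mem_biUnion (show b ∈ D g from hg) hb⟩
          · exact indicator_nonneg (fun _ _ => zero_le_one) _
        linarith
      · rw [indicator_of_notMem hω]
        refine mul_nonneg zero_le_two (Finset.sum_nonneg fun g _ => mul_nonneg
          (Finset.prod_nonneg fun c _ => hp0 _) (indicator_nonneg (fun _ _ => zero_le_one) _))
    have hi : ∀ g : Fin n × Fin 24 → Finset F, Integrable (fun ω => (∏ c, p (g c)) *
        (U τ g).indicator (fun _ => (1 : ℝ)) ω) P := fun g =>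
      ((integrable_const _).indicator (hUm τ g)).const_mul _
    have h3 := integral_mono ((integrable_const _).indicator hm0)
      ((integrable_finsetSum _ fun g _ => hi g).const_mul 2) hpt
    rw [integral_indicator_const _ hm0, smul_eq_mul, mul_one, integral_const_mul,
      integral_finsetSum _ fun g _ => hi g] at h3
    refine h3.trans (le_of_eq ?_)
    congr 1
    refine Finset.sum_congr rfl fun g _ => ?_
    rw [integral_const_mul, integral_indicator_const _ (hUm τ g), smul_eq_mul, mul_one]
  let h : ℕ → ℝ := fun j => if 23 * q₀ ≤ j then a (j / 23) else 0
  let w : ℕ → ℝ := fun j => v (j / 23)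
  let Φ : (Fin n × Option (Fin 24) → Finset F) → Finset (Finset (Fin n × Option (Fin 24))) :=
    fun z => Finset.univ.image fun b => trace z {σ | b ∈ σ}
  have hUle : ∀ τ g, P.real (U τ g) ≤ (∏ i, p (τ i)) *
      ∑ I ∈ Φ (arrayEquiv _ _ _ (τ, g)), h I.card *
        Real.exp (-w I.card * (Finset.univ.filter fun i => (i, none) ∈ I).card) := by
    intro τ g
    have hcover : U τ g ⊆ ⋃ I ∈ (Φ (arrayEquiv _ _ _ (τ, g))).filter
        (fun I => 23 * q₀ ≤ (I.card : ℝ)),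
        cellEvent B τ ∩ badq ((I.card : ℝ) / 23) (Finset.univ.filter fun i => (i, none) ∈ I) := by
      rintro ω ⟨hω, hωb⟩
      obtain ⟨b, hbD, hb⟩ := mem_iUnion₂.1 hωb
      have hcard : ((trace g {σ : Finset F | b ∈ σ}).card : ℝ) ≤
          ((trace (arrayEquiv _ _ _ (τ, g)) {σ : Finset F | b ∈ σ}).card : ℝ) := by
        norm_cast
        refine Finset.card_le_card_of_injOn (fun c => (c.1, some c.2)) ?_ ?_
        · intro c hc
          simpa using hc
        · intro c _ c' _ hcc
          simpa [Prod.ext_iff] using hcc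
      have hD : 23 * (n * μ.real (B b)) ≤ ((trace g {σ : Finset F | b ∈ σ}).card : ℝ) := hbD
      have h1 := hmass b
      refine mem_biUnion (x := trace (arrayEquiv _ _ _ (τ, g)) {σ : Finset F | b ∈ σ}) ?_ ⟨hω, ?_⟩
      · rw [Finset.coe_filter]
        exact ⟨Finset.mem_image_of_mem _ (Finset.mem_univ b), by linarith⟩
      · convert hbad b ω hb _ _ using 2
        · ext i
          have := hω i
          simp [← this]
        · rw [le_div_iff₀ (by norm_num)]
          linarith
    calc P.real (U τ g) ≤ ∑ I ∈ (Φ (arrayEquiv _ _ _ (τ, g))).filter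
          (fun I => 23 * q₀ ≤ (I.card : ℝ)), P.real (cellEvent B τ ∩
            badq ((I.card : ℝ) / 23) (Finset.univ.filter fun i => (i, none) ∈ I)) :=
          (measureReal_mono hcover (measure_ne_top _ _)).trans (measureReal_biUnion_finset_le _ _)
      _ ≤ ∑ I ∈ (Φ (arrayEquiv _ _ _ (τ, g))).filter (fun I => 23 * q₀ ≤ (I.card : ℝ)),
          (∏ i, p (τ i)) * (h I.card *
            Real.exp (-w I.card * (Finset.univ.filter fun i => (i, none) ∈ I).card)) := by
          refine Finset.sum_le_sum fun I hI => ?_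
          have hI2 := (Finset.mem_filter.1 hI).2
          have hI3 : (I.card : ℝ) ≤ 25 * n := by
            have := Finset.card_le_univ I
            rw [Fintype.card_prod, Fintype.card_option, Fintype.card_fin, Fintype.card_fin] at this
            have h4 : I.card ≤ 25 * n := by omega
            exact_mod_cast h4
          have h5 : h I.card = a ((I.card : ℝ) / 23) := if_pos hI2
          rw [h5]
          refine hprob τ _ _ ?_ ?_
          · rw [le_div_iff₀ (by norm_num)]; linarith
          · rw [div_le_iff₀ (by norm_num)]; linarith
      _ ≤ ∑ I ∈ Φ (arrayEquiv _ _ _ (τ, g)), (∏ i, p (τ i)) * (h I.card *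
            Real.exp (-w I.card * (Finset.univ.filter fun i => (i, none) ∈ I).card)) := by
          refine Finset.sum_le_sum_of_subset_of_nonneg (Finset.filter_subset _ _) fun I _ _ => ?_
          refine mul_nonneg (Finset.prod_nonneg fun c _ => hp0 _) (mul_nonneg ?_
            (Real.exp_pos _).le)
          simp only [h]
          split_ifs
          · exact ha _
          · exact le_rfl
      _ = _ := by rw [Finset.mul_sum]
  have hcover : (⋃ b, bad b) ⊆ ⋃ τ ∈ (Finset.univ : Finset (Fin n → Finset F)),
      (cellEvent B τ ∩ ⋃ b, bad b) := by
    intro ω hω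
    exact mem_biUnion (x := fun i => cell B (ω i).1) (Finset.mem_coe.2 (Finset.mem_univ _))
      ⟨fun i => rfl, hω⟩
  have hcardI : Fintype.card (Option (Fin 24)) = 25 := by simp
  have hfinal := sum_traces_le (T := Finset F) (α := Fin n) (κ := Option (Fin 24)) none hp0 hp1
    (fun b => {σ | b ∈ σ}) h w (fun j => by simp only [h]; split_ifs; exacts [ha _, le_rfl])
    ((25 * n : ℝ) ^ V) ε hε0 (by
      intro j hj
      rw [hcardI, Fintype.card_fin] at hj
      rw [hcardI]
      simp only [h, w]
      split_ifs with hj2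
      · have hj3 : (j : ℝ) ≤ n * 25 := by exact_mod_cast hj
        have h6 := hε ((j : ℝ) / 23) (by rw [le_div_iff₀ (by norm_num)]; linarith)
          (by rw [div_le_iff₀ (by norm_num)]; linarith)
        convert h6 using 5
        push_cast
        ring
      · simpa using hε0) (by
      intro z hz
      have h7 := card_traces_cell_le hV μ hball (ι := Fin n × Option (Fin 24)) (by
        rw [Fintype.card_prod, hcardI, Fintype.card_fin]; omega) z hz
      rw [Fintype.card_prod, hcardI, Fintype.card_fin] at h7
      have h8 : ((Finset.univ.image fun b => trace z {τ | b ∈ τ}).card : ℝ) ≤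
          ((n * 25) ^ V : ℕ) := by
        exact_mod_cast h7
      refine h8.trans (le_of_eq ?_)
      push_cast
      rw [mul_comm (n : ℝ)])
  calc P.real (⋃ b, bad b) ≤ ∑ τ : Fin n → Finset F, P.real (cellEvent B τ ∩ ⋃ b, bad b) :=
        (measureReal_mono hcover (measure_ne_top _ _)).trans (measureReal_biUnion_finset_le _ _)
    _ ≤ ∑ τ : Fin n → Finset F, 2 * ∑ g : Fin n × Fin 24 → Finset F, (∏ c, p (g c)) *
          ((∏ i, p (τ i)) * ∑ I ∈ Φ (arrayEquiv _ _ _ (τ, g)), h I.card *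
            Real.exp (-w I.card * (Finset.univ.filter fun i => (i, none) ∈ I).card)) := by
        refine Finset.sum_le_sum fun τ _ => (hhalf τ).trans ?_
        refine mul_le_mul_of_nonneg_left (Finset.sum_le_sum fun g _ => ?_) zero_le_two
        exact mul_le_mul_of_nonneg_left (hUle τ g) (Finset.prod_nonneg fun c _ => hp0 _)
    _ = 2 * ∑ z : Fin n × Option (Fin 24) → Finset F, (∏ c, p (z c)) * ∑ I ∈ Φ z, h I.card *
            Real.exp (-w I.card * (Finset.univ.filter fun i => (i, none) ∈ I).card) := by
        rw [← Finset.mul_sum, ← (arrayEquiv (Fin n) (Fin 24) (Finset F)).sum_comp,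
          Fintype.sum_prod_type]
        congr 1
        refine Finset.sum_congr rfl fun τ _ => Finset.sum_congr rfl fun g _ => ?_
        rw [← mul_assoc]
        congr 1
        rw [Fintype.prod_prod_type, Fintype.prod_prod_type]
        simp_rw [Fintype.prod_option]
        rw [Finset.prod_mul_distrib, mul_comm]
        rfl
    _ ≤ _ := by
        refine mul_le_mul_of_nonneg_left ?_ zero_le_two
        convert hfinal using 6

end Uniform

/-! ### Noise level and rates -/

section Rates

lemma sqrt_add_sqrt_le {w s b A : ℝ} (hw : 0 ≤ w) (hs : 0 ≤ s) (hb : 0 ≤ b) (hbA : b ≤ A) :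
    √(w * (A - b)) + √(s * b) ≤ √(A * (w + s)) := by
  refine Real.le_sqrt_of_sq_le ?_
  have h0 : 0 ≤ A - b := sub_nonneg.2 hbA
  have h1 : √(w * (A - b)) * √(s * b) = √(w * b) * √(s * (A - b)) := by
    rw [← Real.sqrt_mul (by positivity), ← Real.sqrt_mul (by positivity)]
    congr 1; ring
  have h2 := Real.sq_sqrt (show 0 ≤ w * (A - b) by positivity)
  have h3 := Real.sq_sqrt (show 0 ≤ s * b by positivity)
  have h4 := Real.sq_sqrt (show 0 ≤ w * b by positivity)
  have h5 := Real.sq_sqrt (show 0 ≤ s * (A - b) by positivity)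
  nlinarith [sq_nonneg (√(w * b) - √(s * (A - b)))]

/-- The variance proxy `V t² ln(2n/δ) + σ²`, i.e. `C_{n,δ}` without the factor `K(0)/K(1)`. -/
noncomputable def noiseLevel {X : Type*} [MeasurableSpace X] (η : Kernel X ℝ) (σ2 : ℝ) (V n : ℕ)
    (δ : ℝ) : ℝ :=
  (V : ℝ) * tailBound η (δ / (2 * n)) ^ 2 * Real.log (2 * n / δ) + σ2

lemma NoiseModel.nonneg {X : Type*} [MeasurableSpace X] {η : Kernel X ℝ} {σ2 : ℝ}
    (h : NoiseModel η σ2) (x : X) : 0 ≤ σ2 :=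
  (variance_nonneg _ _).trans (h.variance_le x)

/-- Deviation bound for the truncated noise on a fixed trace. The loss `δ / (4 n)` in the exponent
is the price of the bias of the truncation; it is absorbed by the term `σ²` of the noise level. -/
lemma measure_cellEvent_inter_noise_le {X F : Type*} [MeasurableSpace X] [Nonempty X] [Fintype F]
    {B : F → Set X} (hB : ∀ b, MeasurableSet (B b)) (μ : Measure X) [IsProbabilityMeasure μ]
    (η : Kernel X ℝ) [IsMarkovKernel η] {σ2 : ℝ} (hnoise : NoiseModel η σ2) (V : ℕ) {n : ℕ}
    (hn : 1 ≤ n) {δ : ℝ} (hδ0 : 0 < δ) (hδ1 : δ < 1) (τ : Fin n → Finset F) (I : Finset (Fin n))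
    {r : ℝ} (hr : δ / (4 * n) ≤ r) :
    (sampleLaw μ η n).real (cellEvent B τ ∩
        {ω | I.card * √(2 * r * noiseLevel η σ2 V n δ) <
          |∑ i ∈ I, trunc (tailBound η (δ / (2 * n))) (residual η (ω i))|}) ≤
      (∏ i, μ.real (cell B ⁻¹' {τ i})) *
        (2 * Real.exp (-(V * Real.log (2 * n / δ) * (r - δ / (4 * n))) * I.card)) := by
  have := isProbabilityMeasure_sampleLaw μ η n
  have hn0 : (0 : ℝ) < n := by exact_mod_cast hn
  have hn1 : (1 : ℝ) ≤ n := by exact_mod_cast hn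
  set a : ℝ := δ / (2 * n) with ha
  set t := tailBound η a with ht
  have ha0 : 0 < a := by positivity
  have ht0 : 0 ≤ t := tailBound_nonneg η a
  have hL : 0 ≤ Real.log (2 * n / δ) := by
    refine Real.log_nonneg ?_
    rw [le_div_iff₀ hδ0]; linarith
  have hσ : 0 ≤ σ2 := hnoise.nonneg (Classical.arbitrary X)
  have hr2 : a ≤ 2 * r := by
    have : δ / (4 * n) = a / 2 := by rw [ha]; field_simp; norm_num
    linarith
  have hprod0 : 0 ≤ ∏ i, μ.real (cell B ⁻¹' {τ i}) :=
    Finset.prod_nonneg fun i _ => measureReal_nonneg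
  have hr0 : 0 ≤ r := le_trans (by positivity) hr
  rcases ht0.eq_or_lt with h0 | htpos
  · have hempty : {ω : Fin n → X × ℝ | I.card * √(2 * r * noiseLevel η σ2 V n δ) <
          |∑ i ∈ I, trunc t (residual η (ω i))|} = ∅ := by
      ext ω
      simp only [mem_ofPred_eq, mem_empty_iff_false, iff_false, not_lt]
      have : ∀ i ∈ I, trunc t (residual η (ω i)) = 0 := by
        intro i _
        have := abs_trunc_le ht0 (residual η (ω i))
        rw [← h0] at this ⊢
        exact abs_nonpos_iff.1 this
      rw [Finset.sum_eq_zero this, abs_zero]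
      positivity
    rw [hempty, inter_empty, measureReal_empty]
    positivity
  · set c := √(2 * r * noiseLevel η σ2 V n δ) with hc
    set m := √(σ2 * a) with hm
    set w : ℝ := V * t ^ 2 * Real.log (2 * n / δ) with hw
    have hw0 : 0 ≤ w := by positivity
    have hcs : √(w * (2 * r - a)) + m ≤ c := sqrt_add_sqrt_le hw0 hσ ha0.le hr2
    have hmc : m ≤ c := by linarith [Real.sqrt_nonneg (w * (2 * r - a))]
    have hmean : ∀ x, |∫ y, trunc t (y - regressionFn η x) ∂(η x)| ≤ m := fun x =>
      abs_integral_trunc_le (η x) (hnoise.memLp x) ha0 (hnoise.variance_le x)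
        (tail_le_of_tailBound (hnoise.tails a ha0) x)
    have hexp : V * Real.log (2 * n / δ) * (r - δ / (4 * n)) ≤ (c - m) ^ 2 / (2 * t ^ 2) := by
      rw [le_div_iff₀ (by positivity)]
      have h1 : √(w * (2 * r - a)) ^ 2 ≤ (c - m) ^ 2 := by
        gcongr; linarith
      rw [Real.sq_sqrt (mul_nonneg hw0 (by linarith))] at h1
      refine le_trans (le_of_eq ?_) h1
      rw [hw, ha]; field_simp; ring
    have hside : ∀ e : ℝ, |e| = 1 → (sampleLaw μ η n).real (cellEvent B τ ∩
        {ω | I.card * c ≤ e * ∑ i ∈ I, trunc t (residual η (ω i))}) ≤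
        (∏ i, μ.real (cell B ⁻¹' {τ i})) *
          Real.exp (-(V * Real.log (2 * n / δ) * (r - δ / (4 * n))) * I.card) := by
      intro e he
      refine (measure_cellEvent_inter_sum_ge_le hB μ η τ I htpos he hmean hmc).trans ?_
      refine mul_le_mul_of_nonneg_left (Real.exp_le_exp.2 ?_) hprod0
      have := mul_le_mul_of_nonneg_left hexp (Nat.cast_nonneg (α := ℝ) I.card)
      linarith
    have hsub : cellEvent B τ ∩ {ω : Fin n → X × ℝ | I.card * c <
          |∑ i ∈ I, trunc t (residual η (ω i))|} ⊆
        (cellEvent B τ ∩ {ω | I.card * c ≤ 1 * ∑ i ∈ I, trunc t (residual η (ω i))}) ∪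
        (cellEvent B τ ∩ {ω | I.card * c ≤ -1 * ∑ i ∈ I, trunc t (residual η (ω i))}) := by
      rintro ω ⟨h1, h2⟩
      rcases lt_abs.1 (show I.card * c < |∑ i ∈ I, trunc t (residual η (ω i))| from h2) with h | h
      · exact Or.inl ⟨h1, by simpa using h.le⟩
      · exact Or.inr ⟨h1, by simpa using h.le⟩
    have h3 := (measureReal_mono hsub (measure_ne_top (sampleLaw μ η n) _)).trans
      (measureReal_union_le _ _)
    have h4 := hside 1 (by simp)
    have h5 := hside (-1) (by simp)
    linarith

/-- The numerical regime in which the theorem has content: `δ ≤ 1/2` and `ln(2n) ≥ 13`. -/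
structure Regime (n : ℕ) (δ : ℝ) : Prop where
  pos : 0 < δ
  le_half : δ ≤ 1 / 2
  log_ge : 13 ≤ Real.log (2 * n)

namespace Regime

variable {n : ℕ} {δ : ℝ}

lemma four_le (h : Regime n δ) : 4 ≤ n := by
  by_contra! hn
  have h1 : (2 * n : ℝ) ≤ 8 := by
    have : (n : ℝ) ≤ 4 := by exact_mod_cast hn.le
    linarith
  have h2 := h.log_ge
  have h3 : Real.log (2 * n) ≤ 8 := by
    rcases Nat.eq_zero_or_pos n with rfl | hn0
    · simp
    · have := Real.log_le_sub_one_of_pos (show (0 : ℝ) < 2 * n by positivity)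
      linarith
  linarith

lemma cast_pos (h : Regime n δ) : (0 : ℝ) < n := by
  have := h.four_le
  positivity

lemma log_div (h : Regime n δ) :
    Real.log (2 * n / δ) = Real.log (2 * n) + Real.log (1 / δ) := by
  have := h.cast_pos
  have := h.pos
  rw [Real.log_div (by positivity) (by positivity), one_div, Real.log_inv]; ring

lemma log_inv_ge (h : Regime n δ) : Real.log 2 ≤ Real.log (1 / δ) := by
  have := h.pos
  refine Real.log_le_log (by norm_num) ?_
  rw [le_div_iff₀ this]; linarith [h.le_half]

lemma log_inv_pos (h : Regime n δ) : 0 < Real.log (1 / δ) :=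
  (Real.log_pos (by norm_num)).trans_le h.log_inv_ge

lemma log_eight_div (h : Regime n δ) :
    Real.log (8 / δ) = 3 * Real.log 2 + Real.log (1 / δ) := by
  have := h.pos
  have h8 : (8 : ℝ) = 2 ^ 3 := by norm_num
  rw [div_eq_mul_one_div, Real.log_mul (by norm_num) (by positivity), h8, Real.log_pow]
  norm_num

lemma mul_log_le (h : Regime n δ) : δ * Real.log (2 * n / δ) ≤ (Real.log (2 * n) + 1) / 2 := by
  have h0 := h.pos
  have h1 := h.le_half
  have h2 := h.log_ge
  have h3 := Real.log_le_sub_one_of_pos (show 0 < 1 / δ by positivity)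
  have h4 : δ * Real.log (1 / δ) ≤ 1 - δ := by
    calc _ ≤ δ * (1 / δ - 1) := by gcongr
      _ = _ := by field_simp
  rw [h.log_div]
  nlinarith

end Regime

/-- The threshold `V ln(2n) + ln(8/δ)` above which expected counts are controlled. -/
noncomputable def countThreshold (V n : ℕ) (δ : ℝ) : ℝ :=
  (V : ℝ) * Real.log (2 * n) + Real.log (8 / δ)

/-- The inflation of the deviation bound for a trace with `j` points: none if `j` is at most
`n / (ln(2n) + 1)`, where the truncation bias is negligible, and `9/8` for larger traces. -/
noncomputable def inflation (n j : ℕ) : ℝ :=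
  if (j : ℝ) * (Real.log (2 * n) + 1) ≤ n then 1 else 9 / 8

lemma one_le_inflation (n j : ℕ) : 1 ≤ inflation n j := by
  unfold inflation; split_ifs <;> norm_num

lemma inflation_mono (n : ℕ) (hn : 1 ≤ n) : Monotone (inflation n) := by
  intro i j hij
  have h0 : 0 ≤ Real.log (2 * n) + 1 := by
    have : (1 : ℝ) ≤ n := by exact_mod_cast hn
    have := Real.log_nonneg (show (1 : ℝ) ≤ 2 * n by linarith)
    linarith
  unfold inflation
  have : (i : ℝ) ≤ j := by exact_mod_cast hij
  have h2 : (i : ℝ) * (Real.log (2 * n) + 1) ≤ j * (Real.log (2 * n) + 1) := by gcongr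
  split_ifs <;> linarith

end Rates

/-! ### Probabilities of the bad events -/

section Events

/-- Sum of the truncated noise over the sample points in `B`. -/
noncomputable def truncSum {X : Type*} [MeasurableSpace X] (η : Kernel X ℝ) {n : ℕ} (t : ℝ)
    (B : Set X) (ω : Fin n → X × ℝ) : ℝ :=
  ∑ i ∈ trace (fun i => (ω i).1) B, trunc t (residual η (ω i))

lemma sum_trace_eq_sum_indicator {X : Type*} {n : ℕ} (g : X × ℝ → ℝ) (B : Set X)
    (ω : Fin n → X × ℝ) :
    ∑ i ∈ trace (fun i => (ω i).1) B, g (ω i) = ∑ i, (Prod.fst ⁻¹' B).indicator g (ω i) := by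
  rw [trace, Finset.sum_filter]
  rfl

lemma measurable_sum_trace {X : Type*} [MeasurableSpace X] {n : ℕ} {g : X × ℝ → ℝ}
    (hg : Measurable g) {B : Set X} (hB : MeasurableSet B) :
    Measurable fun ω : Fin n → X × ℝ => ∑ i ∈ trace (fun i => (ω i).1) B, g (ω i) := by
  simp_rw [sum_trace_eq_sum_indicator]
  exact Finset.measurable_sum _ fun i _ =>
    (hg.indicator (measurable_fst hB)).comp (measurable_pi_apply i)

lemma measurable_truncSum {X : Type*} [MeasurableSpace X] (η : Kernel X ℝ) [IsMarkovKernel η]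
    {n : ℕ} (t : ℝ) {B : Set X} (hB : MeasurableSet B) :
    Measurable fun ω : Fin n → X × ℝ => truncSum η t B ω :=
  measurable_sum_trace ((measurable_trunc t).comp (measurable_residual η)) hB

lemma measurable_card_trace {X : Type*} [MeasurableSpace X] {n : ℕ} {B : Set X}
    (hB : MeasurableSet B) :
    Measurable fun ω : Fin n → X × ℝ => ((trace (fun i => (ω i).1) B).card : ℝ) := by
  have := measurable_sum_trace (n := n) (g := fun _ => (1 : ℝ)) measurable_const hB
  simpa using this

variable {X : Type*} [MetricSpace X] [Nontrivial X] [MeasurableSpace X]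
  {V : ℕ} {μ : Measure X} [IsProbabilityMeasure μ] {η : Kernel X ℝ} [IsMarkovKernel η]
  {F : Type*} [Fintype F] {B : F → Set X} {n : ℕ} {δ σ2 : ℝ}

/-- Uniform deviation bound for the noise over all traces. -/
lemma measure_iUnion_noise_le (hV : HasVCDim (balls X) V) (hnoise : NoiseModel η σ2)
    (hball : ∀ b, B b ∈ balls X) (hB : ∀ b, MeasurableSet (B b)) (hR : Regime n δ) :
    (sampleLaw μ η n).real (⋃ b, {ω | ((trace (fun i => (ω i).1) (B b)).card : ℝ) *
        √(2 * (inflation n (trace (fun i => (ω i).1) (B b)).card /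
          ((trace (fun i => (ω i).1) (B b)).card : ℝ)) * noiseLevel η σ2 V n δ) <
        |truncSum η (tailBound η (δ / (2 * n))) (B b) ω|}) ≤ 1.14 * δ := by
  have hV1 := one_le_of_hasVCDim_balls hV
  have hn := hR.four_le
  have hn0 := hR.cast_pos
  have hδ0 := hR.pos
  have hδ1 := hR.le_half
  set L' := Real.log (2 * n / δ) with hL'
  have hL'0 : 0 < L' := by rw [hL', hR.log_div]; linarith [hR.log_ge, hR.log_inv_pos]
  have hprob : ∀ (τ : Fin n → Finset F) (I : Finset (Fin n)),
      (sampleLaw μ η n).real (cellEvent B τ ∩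
      {ω | (I.card : ℝ) * √(2 * (inflation n I.card / (I.card : ℝ)) * noiseLevel η σ2 V n δ) <
        |∑ i ∈ I, trunc (tailBound η (δ / (2 * n))) (residual η (ω i))|}) ≤
      (∏ i, μ.real (cell B ⁻¹' {τ i})) * (2 * Real.exp (-(V * (L' - 1 / 8)))) := by
    intro τ I
    have hprod0 : 0 ≤ ∏ i, μ.real (cell B ⁻¹' {τ i}) :=
      Finset.prod_nonneg fun i _ => measureReal_nonneg
    rcases I.eq_empty_or_nonempty with rfl | hI
    · simp only [Finset.card_empty, Finset.sum_empty, abs_zero, Nat.cast_zero, zero_mul,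
        lt_self_iff_false, ofPred_false, inter_empty, measureReal_empty]
      positivity
    · have hI0 : (0 : ℝ) < I.card := by exact_mod_cast hI.card_pos
      have hIn : (I.card : ℝ) ≤ n := by
        have := Finset.card_le_univ I
        rw [Fintype.card_fin] at this
        exact_mod_cast this
      have hkey : L' - 1 / 8 ≤ L' * (inflation n I.card - δ * I.card / (4 * n)) := by
        unfold inflation
        split_ifs with hs
        · have h1 := hR.mul_log_le
          rw [← hL'] at h1
          have h2 : L' * (δ * I.card / (4 * n)) ≤ 1 / 8 := by
            rw [mul_div_assoc', div_le_iff₀ (by positivity)]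
            have := mul_le_mul_of_nonneg_right h1 hI0.le
            linarith
          linarith
        · have h2 : δ * I.card / (4 * n) ≤ 1 / 8 := by
            rw [div_le_iff₀ (by positivity)]
            nlinarith
          nlinarith
      have hr : δ / (4 * n) ≤ inflation n I.card / I.card := by
        rw [div_le_div_iff₀ (by positivity) hI0]
        have h1 := one_le_inflation n I.card
        nlinarith
      refine (measure_cellEvent_inter_noise_le hB μ η hnoise V (by omega) hδ0 (by linarith) τ I
        hr).trans ?_
      refine mul_le_mul_of_nonneg_left ?_ hprod0
      gcongr
      rw [neg_mul, neg_le_neg_iff, ← hL']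
      calc V * (L' - 1 / 8) ≤ V * (L' * (inflation n I.card - δ * I.card / (4 * n))) := by gcongr
        _ = _ := by field_simp
  have h := measure_iUnion_le_of_trace hV μ η hball hB hn
    (fun b => {ω | ((trace (fun i => (ω i).1) (B b)).card : ℝ) *
        √(2 * (inflation n (trace (fun i => (ω i).1) (B b)).card /
          ((trace (fun i => (ω i).1) (B b)).card : ℝ)) * noiseLevel η σ2 V n δ) <
        |truncSum η (tailBound η (δ / (2 * n))) (B b) ω|})
    (fun I => {ω | (I.card : ℝ) * √(2 * (inflation n I.card / (I.card : ℝ)) *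
        noiseLevel η σ2 V n δ) <
        |∑ i ∈ I, trunc (tailBound η (δ / (2 * n))) (residual η (ω i))|})
    (fun b ω hω => hω) (by positivity) hprob
  refine h.trans ?_
  have he : Real.exp (1 / 8) ≤ 1.14 := by
    have := Real.exp_bound' (x := 1 / 8) (by norm_num) (by norm_num) (n := 3) (by norm_num)
    refine this.trans ?_
    norm_num [Finset.sum_range_succ, Nat.factorial]
  have hbase : (n : ℝ) * Real.exp (-(L' - 1 / 8)) = δ / 2 * Real.exp (1 / 8) := by
    rw [neg_sub, sub_eq_add_neg, Real.exp_add, Real.exp_neg, hL', Real.exp_log (by positivity)]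
    field_simp
  have hle1 : δ / 2 * Real.exp (1 / 8) ≤ 1 := by nlinarith
  calc (n : ℝ) ^ V * (2 * Real.exp (-(V * (L' - 1 / 8))))
      = 2 * ((n : ℝ) * Real.exp (-(L' - 1 / 8))) ^ V := by
        rw [mul_pow, ← Real.exp_nat_mul]; ring_nf
    _ = 2 * (δ / 2 * Real.exp (1 / 8)) ^ V := by rw [hbase]
    _ ≤ 2 * (δ / 2 * Real.exp (1 / 8)) ^ 1 := by
        gcongr 2 * ?_
        exact pow_le_pow_of_le_one (by positivity) hle1 hV1
    _ = δ * Real.exp (1 / 8) := by ring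
    _ ≤ _ := by nlinarith

lemma pow_mul_exp_le {n V : ℕ} {δ : ℝ} (hR : Regime n δ) (e : ℝ) :
    (25 * n : ℝ) ^ V * Real.exp e ≤
      Real.exp (V * (4 * Real.log 2 + Real.log (2 * n)) + e) := by
  have hn0 := hR.cast_pos
  have h16 : (25 * n : ℝ) ≤ Real.exp (4 * Real.log 2 + Real.log (2 * n)) := by
    rw [Real.exp_add, Real.exp_log (by positivity),
      show (4 : ℝ) * Real.log 2 = (4 : ℕ) * Real.log 2 by
      norm_num, Real.exp_nat_mul, Real.exp_log (by norm_num)]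
    linarith
  rw [Real.exp_add, Real.exp_nat_mul]
  gcongr

lemma thirtyfour_le (hV1 : 1 ≤ V) (hR : Regime n δ) : 34 ≤ 3 * countThreshold V n δ := by
  have h1 := hR.log_ge
  have h2 := hR.log_inv_pos
  have h3 := hR.log_eight_div
  have h4 := Real.log_two_gt_d9
  have h5 : (1 : ℝ) ≤ V := by exact_mod_cast hV1
  unfold countThreshold
  nlinarith

/-- Balls of large expected count contain a fifth of the expected number of sample points. -/
lemma measure_iUnion_count_le (hV : HasVCDim (balls X) V)
    (hball : ∀ b, B b ∈ balls X) (hB : ∀ b, MeasurableSet (B b)) (hR : Regime n δ)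
    (hmass : ∀ b, 3 * countThreshold V n δ ≤ n * μ.real (B b)) :
    (sampleLaw μ η n).real (⋃ b, {ω | ((trace (fun i => (ω i).1) (B b)).card : ℝ) <
      0.2 * (n * μ.real (B b))}) ≤ δ / 8 := by
  have hV1 := one_le_of_hasVCDim_balls hV
  have hV1' : (1 : ℝ) ≤ V := by exact_mod_cast hV1
  set A := countThreshold V n δ with hA
  have he : Real.exp (-1.5) ≤ 0.2235 := by
    rw [Real.exp_neg, inv_le_comm₀ (Real.exp_pos _) (by norm_num)]
    have h1 : Real.exp 1.5 = Real.exp 1 * Real.exp 0.5 := by rw [← Real.exp_add]; norm_num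
    have h2 := Real.exp_one_gt_d9
    have h3 : (1.6484 : ℝ) ≤ Real.exp 0.5 := by
      have := Real.sum_le_exp_of_nonneg (x := 0.5) (by norm_num) 5
      refine le_trans ?_ this
      norm_num [Finset.sum_range_succ, Nat.factorial]
    rw [h1]
    nlinarith
  have h := measure_iUnion_le_of_ghost hV μ η hball hB hR.four_le (thirtyfour_le hV1 hR) hmass
    (fun b => {ω | ((trace (fun i => (ω i).1) (B b)).card : ℝ) < 0.2 * (n * μ.real (B b))})
    (fun b => measurableSet_lt (measurable_card_trace (hB b)) measurable_const)
    (fun q I => {_ω | (I.card : ℝ) < 0.2 * q})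
    (fun b ω hω q hq => by
      have : ((trace (fun i => (ω i).1) (B b)).card : ℝ) < 0.2 * (n * μ.real (B b)) := hω
      show ((trace (fun i => (ω i).1) (B b)).card : ℝ) < 0.2 * q
      linarith)
    (fun q => Real.exp (0.3 * q)) (fun _ => 1.5) (fun q => (Real.exp_pos _).le)
    (ε := Real.exp (-(1.24 * A))) (Real.exp_pos _).le
    (fun τ q I _ _ => by
      rw [← measure_cellEvent hB μ η τ]
      by_cases hI : (I.card : ℝ) < 0.2 * q
      · have h1 : (sampleLaw μ η n).real (cellEvent B τ ∩ {_ω | (I.card : ℝ) < 0.2 * q}) ≤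
            (sampleLaw μ η n).real (cellEvent B τ) := by
          have := isProbabilityMeasure_sampleLaw μ η n
          exact measureReal_mono inter_subset_left (measure_ne_top _ _)
        refine h1.trans (le_mul_of_one_le_right measureReal_nonneg ?_)
        rw [← Real.exp_add]
        exact Real.one_le_exp (by linarith)
      · simp only [hI, ofPred_false, inter_empty, measureReal_empty]
        positivity)
    (fun q hq _ => by
      rw [← Real.exp_add, Real.exp_le_exp]
      have h34 := thirtyfour_le hV1 hR
      rw [← hA] at h34 hq
      nlinarith)
  refine h.trans ?_
  have h1 := pow_mul_exp_le (V := V) hR (-(1.24 * A))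
  have h2 : V * (4 * Real.log 2 + Real.log (2 * n)) + -(1.24 * A) ≤
      Real.log (δ / 16) := by
    rw [hA, countThreshold, hR.log_eight_div, Real.log_div hR.pos.ne' (by norm_num),
      show (16 : ℝ) = 2 ^ 4 by norm_num, Real.log_pow]
    have h3 : Real.log (1 / δ) = -Real.log δ := by rw [one_div, Real.log_inv]
    have h4 := hR.log_inv_pos
    have h5 := Real.log_two_lt_d9
    have h6 := Real.log_two_gt_d9
    have h7 := hR.log_ge
    push_cast
    nlinarith
  have h3 : Real.exp (V * (4 * Real.log 2 + Real.log (2 * n)) + -(1.24 * A)) ≤ δ / 16 := by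
    have := hR.pos
    calc _ ≤ Real.exp (Real.log (δ / 16)) := Real.exp_le_exp.2 h2
      _ = _ := Real.exp_log (by positivity)
  linarith

/-- On balls `B` of large expected count `3 κ`, the average noise is at most `√(1.7 W / κ)`, where
`W` is the noise level, no matter how many sample points `B` actually contains. -/
lemma measure_iUnion_average_noise_le (hV : HasVCDim (balls X) V) (hnoise : NoiseModel η σ2)
    (hball : ∀ b, B b ∈ balls X) (hB : ∀ b, MeasurableSet (B b)) (hR : Regime n δ)
    (hmass : ∀ b, 3 * countThreshold V n δ ≤ n * μ.real (B b)) :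
    (sampleLaw μ η n).real (⋃ b, {ω | ((trace (fun i => (ω i).1) (B b)).card : ℝ) *
        √(2 * (2.55 / (n * μ.real (B b))) * noiseLevel η σ2 V n δ) <
        |truncSum η (tailBound η (δ / (2 * n))) (B b) ω|}) ≤ δ / 8 := by
  have hV1 := one_le_of_hasVCDim_balls hV
  have hV1' : (1 : ℝ) ≤ V := by exact_mod_cast hV1
  have hn0 := hR.cast_pos
  have hδ0 := hR.pos
  have hδ1 := hR.le_half
  set A := countThreshold V n δ with hA
  set L' := Real.log (2 * n / δ) with hL'
  have hL'e : L' = Real.log (2 * n) + Real.log (1 / δ) := hR.log_div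
  have hlog := hR.log_inv_pos
  have hLge := hR.log_ge
  have hL'0 : 0 < L' := by linarith
  set M := V * Real.log (2 * n) + Real.log (1 / δ) with hM
  have hMA : M ≤ A := by
    rw [hA, countThreshold, hR.log_eight_div]
    linarith [Real.log_two_gt_d9]
  have hMV : M ≤ V * L' := by rw [hL'e]; nlinarith
  have hW0 : 0 ≤ noiseLevel η σ2 V n δ := by
    have hσ : 0 ≤ σ2 := hnoise.nonneg (Classical.arbitrary X)
    unfold noiseLevel
    positivity
  have h34 := thirtyfour_le hV1 hR
  rw [← hA] at h34
  have he8 : Real.exp (-0.8) ≤ 0.45 := by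
    rw [Real.exp_neg, inv_le_comm₀ (Real.exp_pos _) (by norm_num)]
    have := Real.sum_le_exp_of_nonneg (x := 0.8) (by norm_num) 5
    refine le_trans ?_ this
    norm_num [Finset.sum_range_succ, Nat.factorial]
  have h := measure_iUnion_le_of_ghost hV μ η hball hB hR.four_le (thirtyfour_le hV1 hR) hmass
    (fun b => {ω | ((trace (fun i => (ω i).1) (B b)).card : ℝ) *
        √(2 * (2.55 / (n * μ.real (B b))) * noiseLevel η σ2 V n δ) <
        |truncSum η (tailBound η (δ / (2 * n))) (B b) ω|})
    (fun b => measurableSet_lt ((measurable_card_trace (hB b)).mul_const _)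
      (continuous_abs.measurable.comp (measurable_truncSum η _ (hB b))))
    (fun q I => {ω | (I.card : ℝ) * √(2 * (2.55 / q) * noiseLevel η σ2 V n δ) <
        |∑ i ∈ I, trunc (tailBound η (δ / (2 * n))) (residual η (ω i))|})
    (fun b ω hω q hq => by
      have hb := hmass b
      refine lt_of_le_of_lt ?_ (show ((trace (fun i => (ω i).1) (B b)).card : ℝ) *
        √(2 * (2.55 / (n * μ.real (B b))) * noiseLevel η σ2 V n δ) <
        |truncSum η (tailBound η (δ / (2 * n))) (B b) ω| from hω)
      have : 0 < n * μ.real (B b) := by linarith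
      gcongr)
    (fun _ => 2) (fun q => V * L' * (2.55 / q - δ / (4 * n))) (fun _ => zero_le_two)
    (ε := 2 * Real.exp (-(1.5 * M))) (by positivity)
    (fun τ q I hq hq2 => by
      refine measure_cellEvent_inter_noise_le hB μ η hnoise V (by have := hR.four_le; omega)
        hδ0 (by linarith) τ I ?_
      rw [← hA] at hq
      rw [div_le_div_iff₀ (by positivity) (by linarith)]
      nlinarith)
    (fun q hq hq2 => by
      rw [← hA] at hq
      have hq0 : 0 < q := by linarith
      gcongr 2 * Real.exp ?_
      rw [neg_le_neg_iff]
      have hv : 2.4 * (V * L') / q ≤ V * L' * (2.55 / q - δ / (4 * n)) := by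
        have h1 : δ / (4 * n) ≤ 0.15 / q := by
          rw [div_le_div_iff₀ (by positivity) hq0]
          nlinarith
        calc 2.4 * (V * L') / q = V * L' * (2.55 / q - 0.15 / q) := by field_simp; norm_num
          _ ≤ _ := by gcongr
      set v := V * L' * (2.55 / q - δ / (4 * n)) with hv'
      have hmono : Real.exp (-v) ≤ Real.exp (-(2.4 * (V * L') / q)) := by gcongr
      set y := 3 * (V * L') / q with hy
      have hy0 : 0 ≤ y := by positivity
      have hvy : 2.4 * (V * L') / q = 0.8 * y := by rw [hy]; ring
      rw [hvy] at hmono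
      rcases le_or_gt 1 y with h1 | h1
      · have h2 : Real.exp (-(0.8 * y)) ≤ Real.exp (-0.8) := by gcongr; linarith
        have h3 : 0.55 ≤ 1 - Real.exp (-v) := by linarith
        have h4 : 0.55 * (23 / 25 * q) ≤ (1 - Real.exp (-v)) * (23 / 25 * q) := by gcongr
        linarith
      · -- convexity of the exponential on `[-0.8, 0]`
        have hconv := convexOn_exp.2 (mem_univ (-0.8 : ℝ)) (mem_univ (0 : ℝ)) hy0
          (sub_nonneg.2 h1.le) (by ring)
        simp only [smul_eq_mul, mul_zero, add_zero, Real.exp_zero, mul_one] at hconv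
        rw [show y * -0.8 = -(0.8 * y) by ring] at hconv
        have h3 : 0.55 * y ≤ 1 - Real.exp (-v) := by nlinarith
        have h4 : 0.55 * y * (23 / 25 * q) ≤ (1 - Real.exp (-v)) * (23 / 25 * q) := by gcongr
        have h5 : y * q = 3 * (V * L') := by rw [hy]; field_simp
        have h6 : 0.55 * y * (23 / 25 * q) = 0.506 * (y * q) := by ring
        rw [h6, h5] at h4
        have h7 : 0 ≤ V * L' := by positivity
        linarith)
  refine h.trans ?_
  have h1 := pow_mul_exp_le (V := V) hR (-(1.5 * M))
  have h2 : V * (4 * Real.log 2 + Real.log (2 * n)) + -(1.5 * M) ≤ Real.log (δ / 32) := by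
    rw [hM, Real.log_div hR.pos.ne' (by norm_num),
      show (32 : ℝ) = 2 ^ 5 by norm_num, Real.log_pow]
    have h3 : Real.log (1 / δ) = -Real.log δ := by rw [one_div, Real.log_inv]
    have h5 := Real.log_two_lt_d9
    push_cast
    nlinarith
  have h3 : Real.exp (V * (4 * Real.log 2 + Real.log (2 * n)) + -(1.5 * M)) ≤ δ / 32 := by
    calc _ ≤ Real.exp (Real.log (δ / 32)) := Real.exp_le_exp.2 h2
      _ = _ := Real.exp_log (by positivity)
  calc _ = 4 * ((25 * n : ℝ) ^ V * Real.exp (-(1.5 * M))) := by ring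
    _ ≤ 4 * (δ / 32) := by gcongr; exact h1.trans h3
    _ = _ := by ring

end Events

/-! ### The good event -/

section GoodEvent

/-- A bound valid for all finite subfamilies of a countable family of events is valid for the
whole family. -/
lemma measure_iUnion_le_of_finset {Ω ι : Type*} [MeasurableSpace Ω] [Countable ι] (P : Measure Ω)
    [IsProbabilityMeasure P] (bad : ι → Set Ω) {ε : ℝ} (hε : 0 ≤ ε)
    (h : ∀ s : Finset ι, P.real (⋃ b : s, bad b) ≤ ε) : P.real (⋃ b, bad b) ≤ ε := by
  have hU : (⋃ b, bad b) = ⋃ s : Finset ι, ⋃ b : s, bad b := by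
    ext ω
    simp only [mem_iUnion]
    exact ⟨fun ⟨b, hb⟩ => ⟨{b}, ⟨b, by simp⟩, hb⟩, fun ⟨s, b, hb⟩ => ⟨b, hb⟩⟩
  have hdir : Directed (· ⊆ ·) fun s : Finset ι => ⋃ b : s, bad b := by
    refine directed_of_isDirected_le fun s s' hss => ?_
    exact iUnion_subset fun b => subset_iUnion (fun b : s' => bad b) ⟨b, hss b.2⟩
  rw [hU, measureReal_def, hdir.measure_iUnion]
  refine ENNReal.toReal_le_of_le_ofReal hε (iSup_le fun s => ?_)
  rw [← ofReal_measureReal]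
  exact ENNReal.ofReal_le_ofReal (h s)

/-- The points all of whose balls have positive mass form a separable set, although the space
itself need not be separable: disjoint balls of positive mass are countable in number. -/
lemma exists_countable_dense_pos {X : Type*} [MetricSpace X] [MeasurableSpace X] [BorelSpace X]
    (μ : Measure X) [IsProbabilityMeasure μ] :
    ∃ D : Set X, D.Countable ∧ ∀ x, (∀ s > 0, 0 < μ.real (Metric.closedBall x s)) →
      ∀ ε > 0, ∃ d ∈ D, dist x d < ε := by
  set S : Set X := {x | ∀ s > 0, 0 < μ.real (Metric.closedBall x s)} with hS
  have hk : ∀ k : ℕ, ∃ u : Set X, u.Countable ∧ ∀ x ∈ S, ∃ d ∈ u, dist x d ≤ 4 * (1 / (k + 1)) := by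
    intro k
    obtain ⟨u, huS, hdisj, hcov⟩ := Vitali.exists_disjoint_subfamily_covering_enlargement_closedBall
      S (fun x => x) (fun _ => (1 / (k + 1) : ℝ)) (1 / (k + 1)) (fun _ _ => le_rfl) 4 (by norm_num)
    have hpos : (0 : ℝ) < 1 / (k + 1) := by positivity
    refine ⟨u, ?_, fun x hx => ?_⟩
    · have h1 := Measure.countable_meas_pos_of_disjoint_iUnion (μ := μ)
        (As := fun x : u => Metric.closedBall (x : X) (1 / (k + 1)))
        (fun x => Metric.isClosed_closedBall.measurableSet)
        (fun x y hxy => hdisj x.2 y.2 (by simpa [Subtype.ext_iff] using hxy))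
      have h2 : {x : u | 0 < μ (Metric.closedBall (x : X) (1 / (k + 1)))} = univ := by
        ext x
        simp only [mem_ofPred_eq, mem_univ, iff_true]
        have := huS x.2 (1 / (k + 1)) hpos
        rw [measureReal_def] at this
        exact (ENNReal.toReal_pos_iff.1 this).1
      rw [h2] at h1
      exact countable_coe_iff.1 (countable_univ_iff.1 h1)
    · obtain ⟨d, hd, hsub⟩ := hcov x hx
      exact ⟨d, hd, hsub (Metric.mem_closedBall_self hpos.le)⟩
  choose u hu hcov using hk
  refine ⟨⋃ k, u k, countable_iUnion hu, fun x hx ε hε => ?_⟩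
  obtain ⟨k, hk⟩ := exists_nat_one_div_lt (show 0 < ε / 4 by positivity)
  obtain ⟨d, hd, hdist⟩ := hcov k x hx
  exact ⟨d, mem_iUnion.2 ⟨k, hd⟩, by linarith⟩

/-- Balls may be replaced by slightly larger ones from a countable family without changing their
traces on a finite set of points. -/
lemma exists_ball_same_trace {X : Type*} [MetricSpace X] {D : Set X} {n : ℕ} (z : Fin n → X) {x : X}
    (hx : ∀ ε > 0, ∃ d ∈ D, dist x d < ε) {s : ℝ} (hs : 0 ≤ s) :
    ∃ d ∈ D, ∃ q : ℚ, 0 ≤ q ∧ Metric.closedBall x s ⊆ Metric.closedBall d q ∧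
      trace z (Metric.closedBall d q) = trace z (Metric.closedBall x s) := by
  obtain ⟨e, he, hgap⟩ : ∃ e > 0, ∀ i, dist (z i) x ≤ s + 3 * e → dist (z i) x ≤ s := by
    have h1 : ∀ i, ∃ e > 0, dist (z i) x ≤ s + 3 * e → dist (z i) x ≤ s := by
      intro i
      by_cases h : dist (z i) x ≤ s
      · exact ⟨1, one_pos, fun _ => h⟩
      · push Not at h
        exact ⟨(dist (z i) x - s) / 6, by linarith, fun h2 => by linarith⟩
    choose e he hgap using h1
    rcases isEmpty_or_nonempty (Fin n) with hn | hn
    · exact ⟨1, one_pos, fun i => (hn.false i).elim⟩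
    · refine ⟨Finset.univ.inf' Finset.univ_nonempty e, ?_, fun i hi => hgap i ?_⟩
      · exact (Finset.lt_inf'_iff _).2 fun i _ => he i
      · have := Finset.inf'_le e (Finset.mem_univ i)
        linarith
  obtain ⟨d, hd, hxd⟩ := hx e he
  obtain ⟨q, hq1, hq2⟩ := exists_rat_btwn (show s + e < s + 2 * e by linarith)
  have hsub : Metric.closedBall x s ⊆ Metric.closedBall d q := by
    intro y hy
    rw [Metric.mem_closedBall] at hy ⊢
    have := dist_triangle y x d
    linarith
  refine ⟨d, hd, q, ?_, hsub, ?_⟩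
  · have : (0 : ℝ) ≤ q := by linarith
    exact_mod_cast this
  · ext i
    rw [mem_trace, mem_trace]
    refine ⟨fun h => ?_, fun h => hsub h⟩
    rw [Metric.mem_closedBall] at h ⊢
    refine hgap i ?_
    have := dist_triangle (z i) d x
    rw [dist_comm d x] at this
    linarith

/-- What holds, with probability at least `1 - 2 δ`, for the noise sums over all balls with centre
`x` and for the number of sample points in them. -/
structure GoodAt {X : Type*} [MetricSpace X] [MeasurableSpace X] (μ : Measure X) (η : Kernel X ℝ)
    (σ2 : ℝ) (V : ℕ) (δ : ℝ) {n : ℕ} (ω : Fin n → X × ℝ) (x : X) : Prop where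
  noise : ∀ s, 0 ≤ s → |∑ i ∈ trace (fun i => (ω i).1) (Metric.closedBall x s), residual η (ω i)| ≤
    ((trace (fun i => (ω i).1) (Metric.closedBall x s)).card : ℝ) *
      √(2 * (inflation n (trace (fun i => (ω i).1) (Metric.closedBall x s)).card /
        ((trace (fun i => (ω i).1) (Metric.closedBall x s)).card : ℝ)) * noiseLevel η σ2 V n δ)
  count : ∀ s, 0 ≤ s → 3 * countThreshold V n δ ≤ n * μ.real (Metric.closedBall x s) →
    0.2 * (n * μ.real (Metric.closedBall x s)) ≤
      ((trace (fun i => (ω i).1) (Metric.closedBall x s)).card : ℝ)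
  average_noise : ∀ s, 0 ≤ s → 3 * countThreshold V n δ ≤ n * μ.real (Metric.closedBall x s) →
    |∑ i ∈ trace (fun i => (ω i).1) (Metric.closedBall x s), residual η (ω i)| ≤
    ((trace (fun i => (ω i).1) (Metric.closedBall x s)).card : ℝ) *
      √(2 * (2.55 / (n * μ.real (Metric.closedBall x s))) * noiseLevel η σ2 V n δ)

/-- **The good event.** Only countably many balls matter; the complement of the event is the
measurable hull of the union of their bad events. -/
theorem exists_good_event {X : Type*} [MetricSpace X] [Nontrivial X] [MeasurableSpace X]
    [BorelSpace X] (μ : Measure X) [IsProbabilityMeasure μ] (η : Kernel X ℝ) [IsMarkovKernel η]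
    {σ2 : ℝ} (hnoise : NoiseModel η σ2) {V : ℕ} (hV : HasVCDim (balls X) V) {n : ℕ} {δ : ℝ}
    (hR : Regime n δ) :
    ∃ E : Set (Fin n → X × ℝ), MeasurableSet E ∧ 1 - 2 * δ ≤ (sampleLaw μ η n).real E ∧
      ∀ ω ∈ E, ∀ x, (∀ s > 0, 0 < μ.real (Metric.closedBall x s)) → GoodAt μ η σ2 V δ ω x := by
  have := isProbabilityMeasure_sampleLaw μ η n
  set P := sampleLaw μ η n with hP
  have hδ0 := hR.pos
  have hn0 := hR.cast_pos
  set t := tailBound η (δ / (2 * n)) with ht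
  have hW0 : 0 ≤ noiseLevel η σ2 V n δ := by
    have hσ : 0 ≤ σ2 := hnoise.nonneg (Classical.arbitrary X)
    have h1 : 0 ≤ Real.log (2 * n / δ) := by
      rw [hR.log_div]; linarith [hR.log_ge, hR.log_inv_pos]
    unfold noiseLevel
    positivity
  obtain ⟨D, hD, hdense⟩ := exists_countable_dense_pos μ
  have : Countable D := hD
  let ι := D × {q : ℚ // 0 ≤ q}
  let B : ι → Set X := fun b => Metric.closedBall (b.1 : X) ((b.2 : ℚ) : ℝ)
  have hBm : ∀ b, MeasurableSet (B b) := fun b => Metric.isClosed_closedBall.measurableSet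
  have hball : ∀ b, B b ∈ balls X := fun b => ⟨b.1, (b.2 : ℚ), by exact_mod_cast b.2.2, rfl⟩
  let ι' := {b : ι // 3 * countThreshold V n δ ≤ n * μ.real (B b)}
  let N : Set X → (Fin n → X × ℝ) → ℝ := fun B ω => ((trace (fun i => (ω i).1) B).card : ℝ)
  let bad2 : ι → Set (Fin n → X × ℝ) := fun b => {ω | N (B b) ω *
    √(2 * (inflation n (trace (fun i => (ω i).1) (B b)).card / N (B b) ω) *
      noiseLevel η σ2 V n δ) < |truncSum η t (B b) ω|}
  let bad3 : ι' → Set (Fin n → X × ℝ) := fun b => {ω | N (B b) ω < 0.2 * (n * μ.real (B b))}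
  let bad4 : ι' → Set (Fin n → X × ℝ) := fun b => {ω | N (B b) ω *
    √(2 * (2.55 / (n * μ.real (B b))) * noiseLevel η σ2 V n δ) < |truncSum η t (B b) ω|}
  let bad1 : Set (Fin n → X × ℝ) := {ω | ∃ i, t < |residual η (ω i)|}
  have h1 : P.real bad1 ≤ δ / 2 := by
    refine (measure_exists_tail_le μ η (hnoise.tails _ (by positivity))).trans (le_of_eq ?_)
    field_simp
  have h2 : P.real (⋃ b, bad2 b) ≤ 1.14 * δ :=
    measure_iUnion_le_of_finset P bad2 (by positivity) fun s =>
      measure_iUnion_noise_le (F := s) (B := fun b => B b) hV hnoise (fun b => hball b)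
        (fun b => hBm b) hR
  have h3 : P.real (⋃ b, bad3 b) ≤ δ / 8 :=
    measure_iUnion_le_of_finset P bad3 (by positivity) fun s =>
      measure_iUnion_count_le (F := s) (B := fun b => B b.1) hV (fun b => hball b.1.1)
        (fun b => hBm b.1.1) hR fun b => b.1.2
  have h4 : P.real (⋃ b, bad4 b) ≤ δ / 8 :=
    measure_iUnion_le_of_finset P bad4 (by positivity) fun s =>
      measure_iUnion_average_noise_le (F := s) (B := fun b => B b.1) hV hnoise
        (fun b => hball b.1.1) (fun b => hBm b.1.1) hR fun b => b.1.2
  set Bad := bad1 ∪ (⋃ b, bad2 b) ∪ (⋃ b, bad3 b) ∪ (⋃ b, bad4 b) with hBad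
  have hBadle : P.real Bad ≤ 2 * δ := by
    have e1 := measureReal_union_le (μ := P) (bad1 ∪ (⋃ b, bad2 b) ∪ (⋃ b, bad3 b)) (⋃ b, bad4 b)
    have e2 := measureReal_union_le (μ := P) (bad1 ∪ (⋃ b, bad2 b)) (⋃ b, bad3 b)
    have e3 := measureReal_union_le (μ := P) bad1 (⋃ b, bad2 b)
    linarith
  refine ⟨(toMeasurable P Bad)ᶜ, (measurableSet_toMeasurable P Bad).compl, ?_, ?_⟩
  · rw [probReal_compl_eq_one_sub (measurableSet_toMeasurable P Bad), measureReal_def,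
      measure_toMeasurable, ← measureReal_def]
    linarith
  · intro ω hω x hx
    have hωB : ω ∉ Bad := fun h => hω (subset_toMeasurable P Bad h)
    simp only [hBad, mem_union, mem_iUnion, not_or, not_exists] at hωB
    obtain ⟨⟨⟨g1, g2⟩, g3⟩, g4⟩ := hωB
    have hres : ∀ i, trunc t (residual η (ω i)) = residual η (ω i) := by
      intro i
      have : ¬ ∃ i, t < |residual η (ω i)| := g1
      push Not at this
      exact if_pos (this i)
    have hsum : ∀ B, truncSum η t B ω = ∑ i ∈ trace (fun i => (ω i).1) B, residual η (ω i) :=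
      fun B => Finset.sum_congr rfl fun i _ => hres i
    have key : ∀ s, 0 ≤ s → ∃ b : ι, Metric.closedBall x s ⊆ B b ∧
        trace (fun i => (ω i).1) (B b) = trace (fun i => (ω i).1) (Metric.closedBall x s) := by
      intro s hs
      obtain ⟨d, hd, q, hq, hsub, htr⟩ := exists_ball_same_trace (D := D) (fun i => (ω i).1)
        (hdense x hx) hs
      exact ⟨(⟨d, hd⟩, ⟨q, hq⟩), hsub, htr⟩
    have hmono : ∀ (s : ℝ) (b : ι), Metric.closedBall x s ⊆ B b →
        n * μ.real (Metric.closedBall x s) ≤ n * μ.real (B b) := by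
      intro s b hsub
      have := measureReal_mono (μ := μ) hsub
      gcongr
    refine ⟨fun s hs => ?_, fun s hs hm => ?_, fun s hs hm => ?_⟩
    · obtain ⟨b, -, htr⟩ := key s hs
      have := g2 b
      simp only [bad2, mem_ofPred_eq, not_lt, N, hsum, htr] at this
      exact this
    · obtain ⟨b, hsub, htr⟩ := key s hs
      have hle := hmono s b hsub
      have := g3 ⟨b, hm.trans hle⟩
      simp only [bad3, mem_ofPred_eq, not_lt, N, htr] at this
      linarith
    · obtain ⟨b, hsub, htr⟩ := key s hs
      have hle := hmono s b hsub
      have h5 := g4 ⟨b, hm.trans hle⟩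
      simp only [bad4, mem_ofPred_eq, not_lt, N, hsum, htr] at h5
      have h34 := thirtyfour_le (one_le_of_hasVCDim_balls hV) hR
      have h6 : 0 < n * μ.real (Metric.closedBall x s) := by linarith
      refine h5.trans ?_
      gcongr

end GoodEvent

/-! ### Weighted averages over nearest neighbours -/

section Estimate

variable {X : Type*} [MetricSpace X] {n : ℕ}

/-- The indices of the sample points in the closed ball `B(x, s)`. -/
noncomputable def ballTrace (ω : Fin n → X × ℝ) (x : X) (s : ℝ) : Finset (Fin n) :=
  trace (fun i => (ω i).1) (Metric.closedBall x s)

lemma mem_ballTrace {ω : Fin n → X × ℝ} {x : X} {s : ℝ} {i : Fin n} :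
    i ∈ ballTrace ω x s ↔ dist x (ω i).1 ≤ s := by
  rw [ballTrace, mem_trace, Metric.mem_closedBall, dist_comm]

lemma ballTrace_mono (ω : Fin n → X × ℝ) (x : X) {s s' : ℝ} (h : s ≤ s') :
    ballTrace ω x s ⊆ ballTrace ω x s' := fun _ hi =>
  mem_ballTrace.2 ((mem_ballTrace.1 hi).trans h)

lemma natCard_dist_le (ω : Fin n → X × ℝ) (x : X) (s : ℝ) :
    Nat.card {i : Fin n // dist x (ω i).1 ≤ s} = (ballTrace ω x s).card := by
  rw [Nat.card_eq_fintype_card, Fintype.card_subtype]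
  congr 1
  ext i
  simp [mem_ballTrace]

lemma nnDist_nonneg (ω : Fin n → X × ℝ) (k : ℕ) (x : X) : 0 ≤ nnDist ω k x :=
  Real.sInf_nonneg fun _ h => h.1

lemma nnDist_le {ω : Fin n → X × ℝ} {k : ℕ} {x : X} {s : ℝ} (hs : 0 ≤ s)
    (h : k ≤ (ballTrace ω x s).card) : nnDist ω k x ≤ s :=
  csInf_le ⟨0, fun _ h => h.1⟩ ⟨hs, by rwa [natCard_dist_le]⟩

/-- The infimum defining the `k`-th nearest neighbour distance is attained. -/
lemma le_card_ballTrace_nnDist (ω : Fin n → X × ℝ) {k : ℕ} (hk : k ≤ n) (x : X) :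
    k ≤ (ballTrace ω x (nnDist ω k x)).card := by
  set r := nnDist ω k x with hr
  obtain ⟨e, he, hgap⟩ : ∃ e > 0, ∀ i, dist x (ω i).1 < r + e → dist x (ω i).1 ≤ r := by
    have h1 : ∀ i, ∃ e > 0, dist x (ω i).1 < r + e → dist x (ω i).1 ≤ r := by
      intro i
      by_cases h : dist x (ω i).1 ≤ r
      · exact ⟨1, one_pos, fun _ => h⟩
      · push Not at h
        exact ⟨dist x (ω i).1 - r, by linarith, fun h2 => by linarith⟩
    choose e he hgap using h1
    rcases isEmpty_or_nonempty (Fin n) with hn | hn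
    · exact ⟨1, one_pos, fun i => (hn.false i).elim⟩
    · refine ⟨Finset.univ.inf' Finset.univ_nonempty e, ?_, fun i hi => hgap i ?_⟩
      · exact (Finset.lt_inf'_iff _).2 fun i _ => he i
      · have := Finset.inf'_le e (Finset.mem_univ i)
        linarith
  have hne : {s : ℝ | 0 ≤ s ∧ k ≤ Nat.card {i : Fin n // dist x (ω i).1 ≤ s}}.Nonempty := by
    refine ⟨∑ i, dist x (ω i).1, Finset.sum_nonneg fun i _ => dist_nonneg, ?_⟩
    rw [natCard_dist_le]
    have : ballTrace ω x (∑ i, dist x (ω i).1) = Finset.univ := by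
      ext i
      simp only [mem_ballTrace, Finset.mem_univ, iff_true]
      exact Finset.single_le_sum (f := fun i => dist x (ω i).1) (fun _ _ => dist_nonneg)
        (Finset.mem_univ i)
    rw [this]
    simpa using hk
  obtain ⟨s, ⟨-, hs⟩, hsr⟩ := exists_lt_of_csInf_lt hne (show nnDist ω k x < r + e by linarith)
  rw [natCard_dist_le] at hs
  refine hs.trans (Finset.card_le_card fun i hi => mem_ballTrace.2 (hgap i ?_))
  exact (mem_ballTrace.1 hi).trans_lt hsr

/-- A weighted sum is controlled by its sums over the superlevel sets of the weights (layer cake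
formula). -/
lemma abs_sum_mul_le_of_levels {ι : Type*} [Fintype ι] {k ξ : ι → ℝ} {M α β : ℝ}
    (hk0 : ∀ i, 0 ≤ k i) (hkM : ∀ i, k i ≤ M) (hM : 0 ≤ M)
    (h : ∀ s > 0, |∑ i with s ≤ k i, ξ i| ≤
      α * ((Finset.univ.filter fun i => s ≤ k i).card : ℝ) + β) :
    |∑ i, k i * ξ i| ≤ α * ∑ i, k i + β * M := by
  set g : ℝ → ℝ → ℝ := fun c s => (Ioc 0 c).indicator (fun _ => (1 : ℝ)) s with hg
  have hgi : ∀ c, Integrable (g c) volume := fun c =>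
    (integrable_indicator_iff measurableSet_Ioc).2 (integrableOn_const (by simp))
  have hgint : ∀ c, 0 ≤ c → ∫ s, g c s = c := by
    intro c hc
    rw [hg]
    simp only
    rw [integral_indicator_const _ measurableSet_Ioc]
    simp [hc]
  have h1 : ∑ i, k i * ξ i = ∫ s, ∑ i, g (k i) s * ξ i := by
    rw [integral_finsetSum _ fun i _ => (hgi _).mul_const _]
    refine Finset.sum_congr rfl fun i _ => ?_
    rw [integral_mul_const, hgint _ (hk0 i)]
  have h2 : α * ∑ i, k i + β * M = ∫ s, (α * ∑ i, g (k i) s + β * g M s) := by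
    rw [integral_add ((integrable_finsetSum _ fun i _ => hgi _).const_mul α)
      ((hgi M).const_mul β), integral_const_mul, integral_const_mul, hgint _ hM,
      integral_finsetSum _ fun i _ => hgi _]
    congr 2
    exact Finset.sum_congr rfl fun i _ => (hgint _ (hk0 i)).symm
  rw [h1, h2]
  refine abs_integral_le_integral_abs.trans (integral_mono ?_ ?_ fun s => ?_)
  · exact (integrable_finsetSum _ fun i _ => (hgi _).mul_const _).abs
  · exact ((integrable_finsetSum _ fun i _ => hgi _).const_mul α).add ((hgi M).const_mul β)
  · by_cases hs : 0 < s ∧ s ≤ M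
    · have hgk : ∀ i, g (k i) s = if s ≤ k i then 1 else 0 := by
        intro i
        simp [hg, indicator, hs.1]
      have hgM : g M s = 1 := by simp [hg, indicator, hs.1, hs.2]
      simp only [hgk, hgM, ite_mul, one_mul, zero_mul, mul_one]
      rw [← Finset.sum_filter, Finset.sum_boole]
      exact h s hs.1
    · have hgk : ∀ c, c ≤ M → g c s = 0 := by
        intro c hc
        refine indicator_of_notMem ?_ _
        rintro ⟨h3, h4⟩
        exact hs ⟨h3, h4.trans hc⟩
      simp [hgk _ (hkM _), hgk M le_rfl]

lemma rawWeight_of_mem {K : ℝ → ℝ} (hK : IsWeightKernel K) {ω : Fin n → X × ℝ} {k : ℕ} {x : X}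
    {i : Fin n} (hi : i ∈ ballTrace ω x (nnDist ω k x)) :
    rawWeight K ω k x i = K (dist x (ω i).1 / nnDist ω k x) ∧ K 1 ≤ rawWeight K ω k x i ∧
      rawWeight K ω k x i ≤ K 0 := by
  have h1 : rawWeight K ω k x i = K (dist x (ω i).1 / nnDist ω k x) := by
    unfold rawWeight
    rw [if_pos (mem_ballTrace.1 hi)]
  have h0 : 0 ≤ dist x (ω i).1 / nnDist ω k x := div_nonneg dist_nonneg (nnDist_nonneg _ _ _)
  have h2 : dist x (ω i).1 / nnDist ω k x ≤ 1 :=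
    div_le_one_of_le₀ (mem_ballTrace.1 hi) (nnDist_nonneg _ _ _)
  rw [h1]
  exact ⟨rfl, hK.antitone h0 (mem_Ici.2 zero_le_one) h2,
    hK.antitone (mem_Ici.2 le_rfl) h0 h0⟩

lemma rawWeight_of_notMem {K : ℝ → ℝ} {ω : Fin n → X × ℝ} {k : ℕ} {x : X}
    {i : Fin n} (hi : i ∉ ballTrace ω x (nnDist ω k x)) : rawWeight K ω k x i = 0 := by
  unfold rawWeight
  rw [if_neg (fun h => hi (mem_ballTrace.2 h))]

/-- **From balls to weights.** If the noise `ξ` averages to at most `c` over the `k` nearest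
neighbours and satisfies square-root bounds on all smaller concentric balls, then its weighted
average is at most `c √(K(0)/K(1))`. -/
lemma abs_sum_rawWeight_mul_le {K : ℝ → ℝ} (hK : IsWeightKernel K) {ω : Fin n → X × ℝ} {k : ℕ}
    {x : X} (ξ : Fin n → ℝ) {W c : ℝ} (hW : 0 ≤ W) (hc : 0 ≤ c)
    (hI : |∑ i ∈ ballTrace ω x (nnDist ω k x), ξ i| ≤
      ((ballTrace ω x (nnDist ω k x)).card : ℝ) * c)
    (hU : ∀ s, 0 ≤ s → s ≤ nnDist ω k x →
      |∑ i ∈ ballTrace ω x s, ξ i| ≤ √(2 * W * ((ballTrace ω x s).card : ℝ)))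
    (hWc : W ≤ ((ballTrace ω x (nnDist ω k x)).card : ℝ) * c ^ 2) :
    |∑ i, rawWeight K ω k x i * ξ i| ≤ (∑ i, rawWeight K ω k x i) * (c * √(K 0 / K 1)) := by
  set r := nnDist ω k x with hr
  set I := ballTrace ω x r with hIdef
  set N : ℝ := (I.card : ℝ) with hN
  have hK1 := hK.pos_one
  have hK01 : K 1 ≤ K 0 :=
    hK.antitone (mem_Ici.2 le_rfl) (mem_Ici.2 zero_le_one) zero_le_one
  set R := √(K 0 / K 1) with hR
  have hR1 : 1 ≤ R := by
    rw [hR, Real.one_le_sqrt, one_le_div hK1]; exact hK01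
  have hR2 : K 0 = K 1 * R ^ 2 := by
    rw [hR, Real.sq_sqrt (div_nonneg (hK1.le.trans hK01) hK1.le), mul_div_cancel₀ _ hK1.ne']
  let e : Fin n → ℝ := fun i => if i ∈ I then rawWeight K ω k x i - K 1 else 0
  have hraw : ∀ i, rawWeight K ω k x i = (if i ∈ I then K 1 else 0) + e i := by
    intro i
    by_cases hi : i ∈ I
    · simp [e, hi]
    · simp [e, hi, rawWeight_of_notMem hi]
  have he0 : ∀ i, 0 ≤ e i := by
    intro i
    by_cases hi : i ∈ I
    · simp only [e, hi, if_true]; linarith [(rawWeight_of_mem hK hi).2.1]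
    · simp [e, hi]
  have heM : ∀ i, e i ≤ K 0 - K 1 := by
    intro i
    by_cases hi : i ∈ I
    · simp only [e, hi, if_true]; linarith [(rawWeight_of_mem hK hi).2.2]
    · simp only [e, hi, if_false]; linarith
  have hlevel : ∀ s > 0, |∑ i with s ≤ e i, ξ i| ≤
      √(2 * W * ((Finset.univ.filter fun i => s ≤ e i).card : ℝ)) := by
    intro s hs
    rcases (Finset.univ.filter fun i => s ≤ e i).eq_empty_or_nonempty with h0 | hne
    · rw [h0]; simp
    · obtain ⟨j, hj, hmax⟩ := Finset.exists_max_image _ (fun i => dist x (ω i).1) hne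
      have hmemI : ∀ i, s ≤ e i → i ∈ I := by
        intro i hi
        by_contra h
        simp only [e, h, if_false] at hi
        linarith
      have hj' : s ≤ e j := (Finset.mem_filter.1 hj).2
      have hjI := hmemI j hj'
      have hset : (Finset.univ.filter fun i => s ≤ e i) = ballTrace ω x (dist x (ω j).1) := by
        ext i
        rw [mem_ballTrace]
        refine ⟨fun hi => hmax i hi, fun hi => ?_⟩
        have hiI : i ∈ I := mem_ballTrace.2 (hi.trans (mem_ballTrace.1 hjI))
        refine Finset.mem_filter.2 ⟨Finset.mem_univ _, hj'.trans ?_⟩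
        simp only [e, hiI, hjI, if_true]
        rw [(rawWeight_of_mem hK hiI).1, (rawWeight_of_mem hK hjI).1]
        have h0 := nnDist_nonneg ω k x
        refine sub_le_sub_right (hK.antitone ?_ ?_ ?_) _
        · exact div_nonneg dist_nonneg h0
        · exact div_nonneg dist_nonneg h0
        · exact div_le_div_of_nonneg_right hi h0
      rw [hset]
      exact hU _ dist_nonneg (mem_ballTrace.1 hjI)
  have hsum : ∑ i, rawWeight K ω k x i = K 1 * N + ∑ i, e i := by
    simp_rw [hraw]
    rw [Finset.sum_add_distrib, Finset.sum_ite_mem, Finset.univ_inter, Finset.sum_const,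
      nsmul_eq_mul, mul_comm]
  have hsumξ : ∑ i, rawWeight K ω k x i * ξ i = K 1 * ∑ i ∈ I, ξ i + ∑ i, e i * ξ i := by
    simp_rw [hraw, add_mul, ite_mul, zero_mul]
    rw [Finset.sum_add_distrib, Finset.sum_ite_mem, Finset.univ_inter, Finset.mul_sum]
  have hmain : |∑ i, e i * ξ i| ≤ c * R * ∑ i, e i + K 1 * N * c * (R - 1) := by
    rcases hc.eq_or_lt with h0 | hcpos
    · have hW0 : W = 0 := by
        have : N * c ^ 2 = 0 := by rw [← h0, zero_pow two_ne_zero, mul_zero]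
        linarith
      have := abs_sum_mul_le_of_levels (α := 0) (β := 0) he0 heM (by linarith) (ξ := ξ) (by
        intro s hs
        have := hlevel s hs
        rwa [hW0, mul_zero, zero_mul, Real.sqrt_zero,
          ← show 0 * ((Finset.univ.filter fun i => s ≤ e i).card : ℝ) + 0 = 0 by ring] at this)
      refine this.trans (le_of_eq ?_)
      rw [← h0]
      simp only [zero_mul, mul_zero]
    · have hN0 : 0 ≤ N := Nat.cast_nonneg _
      clear_value R N
      -- the square root is linearized with slope `c R`
      have hcR : 0 < c * R := by positivity
      have := abs_sum_mul_le_of_levels (α := c * R) (β := W / (2 * (c * R))) he0 heM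
        (by linarith) (ξ := ξ) (by
        intro s hs
        refine (hlevel s hs).trans ?_
        set u : ℝ := ((Finset.univ.filter fun i => s ≤ e i).card : ℝ) with hu
        have hu0 : 0 ≤ u := Nat.cast_nonneg _
        refine Real.sqrt_le_iff.2 ⟨add_nonneg (mul_nonneg hcR.le hu0)
          (div_nonneg hW (by linarith)), ?_⟩
        have h1 : (c * R * u + W / (2 * (c * R))) ^ 2 =
            (c * R * u - W / (2 * (c * R))) ^ 2 + 2 * W * u := by
          have h2 : W / (2 * (c * R)) * (2 * (c * R)) = W := div_mul_cancel₀ _ (by positivity)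
          linear_combination 2 * u * h2
        rw [h1]
        linarith [sq_nonneg (c * R * u - W / (2 * (c * R)))])
      refine this.trans (add_le_add_right ?_ _)
      rw [hR2, div_mul_eq_mul_div, div_le_iff₀ (by positivity)]
      have h2 : W * (K 1 * R ^ 2 - K 1) ≤ N * c ^ 2 * (K 1 * R ^ 2 - K 1) := by
        gcongr
        nlinarith
      have h3 : 0 ≤ N * c ^ 2 * K 1 * (R - 1) * (R - 1) := by
        have : 0 ≤ R - 1 := by linarith
        positivity
      nlinarith
  calc |∑ i, rawWeight K ω k x i * ξ i| ≤ |K 1 * ∑ i ∈ I, ξ i| + |∑ i, e i * ξ i| := by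
        rw [hsumξ]; exact abs_add_le _ _
    _ ≤ K 1 * (N * c) + (c * R * ∑ i, e i + K 1 * N * c * (R - 1)) := by
        refine add_le_add ?_ hmain
        rw [abs_mul, abs_of_pos hK1]
        gcongr
    _ = _ := by rw [hsum]; ring

/-- Decomposition of the error into noise and bias. -/
lemma abs_estimate_sub_le [MeasurableSpace X] {K : ℝ → ℝ} (hK : IsWeightKernel K)
    {η : Kernel X ℝ} {lam : ℝ} (hlam : 0 < lam)
    (hLip : ∀ x x' : X, |regressionFn η x - regressionFn η x'| ≤ lam * dist x x')
    {ω : Fin n → X × ℝ} {k : ℕ} (hk1 : 1 ≤ k) (hkn : k ≤ n) {x : X} {a : ℝ}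
    (ha : |∑ i, rawWeight K ω k x i * residual η (ω i)| ≤ (∑ i, rawWeight K ω k x i) * a) :
    |estimate K ω k x - regressionFn η x| ≤ a + lam * nnDist ω k x := by
  set r := nnDist ω k x with hr
  have hw0 : ∀ i, 0 ≤ rawWeight K ω k x i := by
    intro i
    by_cases hi : i ∈ ballTrace ω x r
    · exact hK.pos_one.le.trans (rawWeight_of_mem hK hi).2.1
    · rw [rawWeight_of_notMem hi]
  set s := ∑ i, rawWeight K ω k x i with hs
  have hs0 : 0 < s := by
    have hcard : 0 < (ballTrace ω x r).card := hk1.trans (le_card_ballTrace_nnDist ω hkn x)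
    obtain ⟨i, hi⟩ := Finset.card_pos.1 hcard
    exact (hK.pos_one.trans_le (rawWeight_of_mem hK hi).2.1).trans_le
      (Finset.single_le_sum (fun i _ => hw0 i) (Finset.mem_univ i))
  have hest : estimate K ω k x - regressionFn η x =
      (∑ i, rawWeight K ω k x i * residual η (ω i) +
        ∑ i, rawWeight K ω k x i * (regressionFn η (ω i).1 - regressionFn η x)) / s := by
    rw [eq_div_iff hs0.ne', sub_mul, estimate, ← Finset.sum_add_distrib, Finset.sum_mul]
    have : regressionFn η x * s = ∑ i, rawWeight K ω k x i * regressionFn η x := by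
      rw [← Finset.sum_mul, mul_comm]
    rw [this, ← Finset.sum_sub_distrib]
    refine Finset.sum_congr rfl fun i _ => ?_
    rw [residual, ← hs, mul_assoc, div_mul_eq_mul_div, ← mul_assoc, mul_div_cancel_right₀ _ hs0.ne']
    ring
  have hbias : |∑ i, rawWeight K ω k x i * (regressionFn η (ω i).1 - regressionFn η x)| ≤
      s * (lam * r) := by
    refine (Finset.abs_sum_le_sum_abs _ _).trans ?_
    rw [hs, Finset.sum_mul]
    refine Finset.sum_le_sum fun i _ => ?_
    rw [abs_mul, abs_of_nonneg (hw0 i)]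
    by_cases hi : i ∈ ballTrace ω x r
    · refine mul_le_mul_of_nonneg_left ?_ (hw0 i)
      refine (hLip _ _).trans ?_
      have := mem_ballTrace.1 hi
      rw [dist_comm] at this
      gcongr
    · rw [rawWeight_of_notMem hi]; simp
  rw [hest, abs_div, abs_of_pos hs0, div_le_iff₀ hs0]
  refine (abs_add_le _ _).trans ?_
  linarith

end Estimate

/-! ### The critical scale -/

section Numerics

/-- If some ball can have the mass that the theorem requires, then `n` is large: `n^(1/3)` exceeds
`6 ln(2n)`. -/
lemma regime_of_six_mul_lt {n : ℕ} (hn : 1 ≤ n) {δ θ : ℝ} (hδ0 : 0 < δ) (hδ : δ ≤ 1 / 2)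
    (hθ : Real.log (n / δ) ≤ θ) (h : 6 * θ < (n : ℝ) ^ (1 / 3 : ℝ)) : Regime n δ := by
  have hn1 : (1 : ℝ) ≤ n := by exact_mod_cast hn
  have hn0 : (0 : ℝ) < n := by linarith
  refine ⟨hδ0, hδ, ?_⟩
  set L := Real.log (2 * n) with hL
  have hLθ : L ≤ θ := by
    refine le_trans (Real.log_le_log (by positivity) ?_) hθ
    rw [le_div_iff₀ hδ0]; nlinarith
  have hL2 : 0.6931 < L := by
    have h1 : Real.log 2 ≤ L := Real.log_le_log (by norm_num) (by linarith)
    linarith [Real.log_two_gt_d9]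
  by_contra! hL13
  have hexp : Real.exp (L / 3) = (2 : ℝ) ^ (1 / 3 : ℝ) * (n : ℝ) ^ (1 / 3 : ℝ) := by
    rw [← Real.mul_rpow (by norm_num) hn0.le, Real.rpow_def_of_pos (by positivity)]
    congr 1; ring
  have h2 : (1.25 : ℝ) ≤ (2 : ℝ) ^ (1 / 3 : ℝ) := by
    rw [one_div]
    rw [Real.le_rpow_inv_iff_of_pos (by norm_num) (by norm_num) (by norm_num)]
    norm_num
  have hlow : 7.5 * L < Real.exp (L / 3) := by
    rw [hexp]
    have : 1.25 * (6 * θ) < (2 : ℝ) ^ (1 / 3 : ℝ) * (n : ℝ) ^ (1 / 3 : ℝ) := by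
      calc 1.25 * (6 * θ) < 1.25 * (n : ℝ) ^ (1 / 3 : ℝ) := by gcongr
        _ ≤ _ := by gcongr
    linarith
  -- on `[0, 13]` the exponential lies below its chord
  have hchord : Real.exp (L / 3) ≤ (1 - L / 13) * 1 + L / 13 * Real.exp (13 / 3) := by
    have := convexOn_exp.2 (mem_univ 0) (mem_univ (13 / 3 : ℝ))
      (show 0 ≤ 1 - L / 13 by linarith) (show 0 ≤ L / 13 by linarith) (by ring)
    simp only [smul_eq_mul, mul_zero, zero_add, Real.exp_zero] at this
    refine le_trans (le_of_eq ?_) this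
    congr 1; ring
  have h76 : Real.exp (13 / 3) ≤ 76.3 := by
    refine le_of_pow_le_pow_left₀ (n := 3) (by norm_num) (by norm_num) ?_
    rw [← Real.exp_nat_mul]
    have h1 : ((3 : ℕ) : ℝ) * (13 / 3) = ((13 : ℕ) : ℝ) * 1 := by norm_num
    rw [h1, Real.exp_nat_mul]
    calc Real.exp 1 ^ 13 ≤ 2.7183 ^ 13 := by
          gcongr
          linarith [Real.exp_one_lt_d9]
      _ ≤ _ := by norm_num
  nlinarith

/-- Traces with at most `1.3 κ` points, `κ` the critical number of points, have uninflated
deviation bounds. -/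
lemma mul_log_add_one_le {n : ℕ} (hn : 1 ≤ n) {κ : ℝ}
    (h : κ ^ 3 ≤ (n : ℝ) ^ (7 / 3 : ℝ) / 54) : 1.3 * κ * (Real.log (2 * n) + 1) ≤ n := by
  have hn1 : (1 : ℝ) ≤ n := by exact_mod_cast hn
  have hn0 : (0 : ℝ) < n := by linarith
  set u := 2 / 9 * Real.log n with hu
  have hu0 : 0 ≤ u := mul_nonneg (by norm_num) (Real.log_nonneg hn1)
  have hpow : ∀ a : ℝ, (n : ℝ) ^ a = Real.exp (9 / 2 * u * a) := by
    intro a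
    rw [Real.rpow_def_of_pos hn0, hu]
    congr 1; ring
  have hnu : (n : ℝ) = Real.exp (7 / 2 * u) * Real.exp u := by
    rw [← Real.exp_add, ← Real.rpow_one (n : ℝ), hpow]
    congr 1; ring
  have h1 : 1.3 * κ ≤ 0.344 * Real.exp (7 / 2 * u) := by
    refine le_of_pow_le_pow_left₀ (n := 3) (by norm_num) (by positivity) ?_
    rw [mul_pow, mul_pow, ← Real.exp_nat_mul]
    rw [hpow] at h
    have h2 : ((3 : ℕ) : ℝ) * (7 / 2 * u) = 9 / 2 * u * (7 / 3) := by push_cast; ring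
    rw [h2]
    have h3 := Real.exp_pos (9 / 2 * u * (7 / 3))
    linarith
  have hlog : Real.log (2 * n) + 1 ≤ 9 / 2 * u + 1.6932 := by
    rw [Real.log_mul (by norm_num) hn0.ne', hu]
    linarith [Real.log_two_lt_d9]
  have hlog0 : 0 ≤ Real.log (2 * n) + 1 := by
    have := Real.log_nonneg (show (1 : ℝ) ≤ 2 * n by linarith)
    linarith
  have hq := Real.quadratic_le_exp_of_nonneg hu0
  have hs : 0.344 * (Real.log (2 * n) + 1) ≤ Real.exp u := by
    nlinarith [sq_nonneg (u - 0.6)]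
  calc 1.3 * κ * (Real.log (2 * n) + 1)
      ≤ 0.344 * Real.exp (7 / 2 * u) * (Real.log (2 * n) + 1) := by gcongr
    _ = Real.exp (7 / 2 * u) * (0.344 * (Real.log (2 * n) + 1)) := by ring
    _ ≤ Real.exp (7 / 2 * u) * Real.exp u := by gcongr
    _ = n := hnu.symm

/-- Combination of a noise term `a` and a bias term `lam * r` (Cauchy–Schwarz). -/
lemma sq_add_mul_le {a c A θ lam r : ℝ} (hA : 0 < A) (hθ : 0 < θ) (ha : a ^ 2 ≤ 2 * c * A) :
    (a + lam * r) ^ 2 ≤ (2 * c / θ + 2 * lam ^ 2) * (θ * A + r ^ 2 / 2) := by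
  have hc : a ^ 2 / (2 * A) ≤ c := by
    rw [div_le_iff₀ (by positivity)]; linarith
  have h1 : 0 ≤ (r * a - 2 * A * lam * θ) ^ 2 / (2 * A * θ) := by positivity
  have h2 : (r * a - 2 * A * lam * θ) ^ 2 / (2 * A * θ) =
      r ^ 2 / θ * (a ^ 2 / (2 * A)) - 2 * a * lam * r + 2 * A * lam ^ 2 * θ := by
    field_simp
    ring
  have h3 : r ^ 2 / θ * (a ^ 2 / (2 * A)) ≤ r ^ 2 / θ * c := by gcongr
  have h4 : (2 * c / θ + 2 * lam ^ 2) * (θ * A + r ^ 2 / 2) =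
      2 * c * A + r ^ 2 / θ * c + 2 * A * lam ^ 2 * θ + lam ^ 2 * r ^ 2 := by
    field_simp
    ring
  rw [h4]
  nlinarith

end Numerics

section Scale

/-- The critical scale. Here `ε = (3 C θ / (n p))^(1/(2+d))` and `κ = θ / ε²`: the ball of radius
`ε r` contains about `κ` sample points, which balances variance and squared bias. -/
lemma exists_scale {n : ℕ} (hn : 1 ≤ n) {C₀ d₀ C d θ p T : ℝ} (hC : 1 ≤ C) (hCC : C ≤ C₀)
    (hd : 1 ≤ d) (hdd : d ≤ d₀) (hθ : 0 < θ) (hp1 : p ≤ 1)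
    (hp : 6 * C₀ * θ * (n : ℝ) ^ (-(1 / 3) : ℝ) < p)
    (hT : T / θ < (n : ℝ) ^ (4 / (6 + 3 * d₀))) :
    ∃ ε κ : ℝ, 0 < ε ∧ ε < 1 ∧ ε ^ 2 = (3 * C * θ / (n * p)) ^ (2 / (2 + d)) ∧ κ * ε ^ 2 = θ ∧
      C * ε ^ (-d) * (3 * κ) = n * p ∧ T ≤ κ ∧ κ ^ 3 ≤ (n : ℝ) ^ (7 / 3 : ℝ) / 54 := by
  have hn1 : (1 : ℝ) ≤ n := by exact_mod_cast hn
  have hn0 : (0 : ℝ) < n := by linarith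
  have hC0 : 0 < C := by linarith
  have hC₀0 : 0 < C₀ := by linarith
  have hd0 : 0 < d := by linarith
  have hm0 : 0 < (n : ℝ) ^ (-(1 / 3) : ℝ) := Real.rpow_pos_of_pos hn0 _
  have hp0 : 0 < p := lt_trans (by positivity) hp
  set b := 3 * C * θ / (n * p) with hb
  have hb0 : 0 < b := by positivity
  have h23 : (n : ℝ) ^ (-(2 / 3) : ℝ) * n = (n : ℝ) ^ (1 / 3 : ℝ) := by
    rw [← Real.rpow_add_one hn0.ne']; norm_num
  have h13 : (n : ℝ) ^ (-(1 / 3) : ℝ) * (n : ℝ) ^ (1 / 3 : ℝ) = 1 := by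
    rw [← Real.rpow_add hn0]; norm_num
  have hq0 : 0 < (n : ℝ) ^ (1 / 3 : ℝ) := Real.rpow_pos_of_pos hn0 _
  have hpn : 6 * C₀ * θ < p * (n : ℝ) ^ (1 / 3 : ℝ) := by
    have := mul_lt_mul_of_pos_right hp hq0
    rwa [mul_assoc, h13, mul_one] at this
  have hCθ : C * θ ≤ C₀ * θ := by gcongr
  have hbn : b ≤ (n : ℝ) ^ (-(2 / 3) : ℝ) := by
    rw [hb, div_le_iff₀ (by positivity), ← mul_assoc, h23]
    nlinarith [mul_pos hC₀0 hθ]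
  have hb1 : b < 1 := by
    rw [hb, div_lt_one (by positivity)]
    have : (n : ℝ) ^ (1 / 3 : ℝ) ≤ n := by
      conv_rhs => rw [← Real.rpow_one (n : ℝ)]
      exact Real.rpow_le_rpow_of_exponent_le hn1 (by norm_num)
    nlinarith [mul_pos hC₀0 hθ, mul_le_mul_of_nonneg_left this hp0.le]
  have h2d : 0 < 2 + d := by linarith
  set ε := b ^ (1 / (2 + d)) with hε
  have hε0 : 0 < ε := Real.rpow_pos_of_pos hb0 _
  have hε1 : ε < 1 := Real.rpow_lt_one hb0.le hb1 (by positivity)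
  have hεpow : ∀ a : ℝ, ε ^ a = b ^ (a / (2 + d)) := by
    intro a
    rw [hε, ← Real.rpow_mul hb0.le]
    congr 1; ring
  have hε2 : ε ^ 2 = b ^ (2 / (2 + d)) := by
    rw [← Real.rpow_natCast, hεpow]; norm_num
  set κ := θ / ε ^ 2 with hκ
  have hκε : κ * ε ^ 2 = θ := by rw [hκ]; field_simp
  have hinv : 1 / ε ^ 2 = b⁻¹ ^ (2 / (2 + d)) := by
    rw [hε2, Real.inv_rpow hb0.le, one_div]
  refine ⟨ε, κ, hε0, hε1, hε2, hκε, ?_, ?_, ?_⟩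
  · have h1 : ε ^ d * ε ^ 2 = b := by
      rw [← Real.rpow_natCast ε 2, ← Real.rpow_add hε0, hεpow]
      push_cast
      rw [show (d + 2) / (2 + d) = 1 by rw [add_comm]; exact div_self h2d.ne', Real.rpow_one]
    have h2 : b * (n * p) = 3 * C * θ := by rw [hb]; field_simp
    have h3 : ε ^ (-d) * ε ^ d = 1 := by
      rw [← Real.rpow_add hε0]; simp
    have h4 : 0 < ε ^ d := Real.rpow_pos_of_pos hε0 d
    have h5 : (C * ε ^ (-d) * (3 * κ)) * b = n * p * b := by
      rw [mul_comm ((n : ℝ) * p), h2, ← h1]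
      calc C * ε ^ (-d) * (3 * κ) * (ε ^ d * ε ^ 2)
          = 3 * C * (ε ^ (-d) * ε ^ d) * (κ * ε ^ 2) := by ring
        _ = _ := by rw [h3, hκε, mul_one]
    exact mul_right_cancel₀ hb0.ne' h5
  · have h1 : (n : ℝ) ^ (4 / (6 + 3 * d₀)) ≤ 1 / ε ^ 2 := by
      rw [hinv]
      have h2 : (n : ℝ) ^ (2 / 3 : ℝ) ≤ b⁻¹ := by
        rw [le_inv_comm₀ (by positivity) hb0, ← Real.rpow_neg hn0.le]
        exact hbn
      calc (n : ℝ) ^ (4 / (6 + 3 * d₀)) ≤ (n : ℝ) ^ (2 / 3 * (2 / (2 + d))) := by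
            refine Real.rpow_le_rpow_of_exponent_le hn1 ?_
            rw [div_mul_div_comm, div_le_div_iff₀ (by linarith) (by positivity)]
            linarith
        _ = ((n : ℝ) ^ (2 / 3 : ℝ)) ^ (2 / (2 + d)) := Real.rpow_mul hn0.le _ _
        _ ≤ _ := Real.rpow_le_rpow (by positivity) h2 (by positivity)
    have h3 := hT.le.trans h1
    rw [div_le_iff₀ hθ] at h3
    rw [hκ]
    linarith [show 1 / ε ^ 2 * θ = θ / ε ^ 2 by ring]
  · -- since `d ≥ 1`, the exponent `6 / (2 + d)` of `1 / b` is at most `2`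
    have h1 : (1 / ε ^ 2) ^ 3 ≤ b⁻¹ ^ 2 := by
      rw [hinv, ← Real.rpow_natCast, ← Real.rpow_natCast, ← Real.rpow_mul (by positivity)]
      refine Real.rpow_le_rpow_of_exponent_le ((one_le_inv₀ hb0).2 hb1.le) ?_
      push_cast
      rw [div_mul_eq_mul_div, div_le_iff₀ h2d]
      linarith
    have h2 : b⁻¹ ≤ n / (3 * θ) := by
      rw [hb, inv_div, div_le_div_iff₀ (by positivity) (by positivity)]
      have h3 : n * p ≤ n * 1 := by gcongr
      nlinarith [mul_pos hn0 hθ]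
    have h4 : θ ≤ (n : ℝ) ^ (1 / 3 : ℝ) / 6 := by
      have h5 : p * (n : ℝ) ^ (1 / 3 : ℝ) ≤ 1 * (n : ℝ) ^ (1 / 3 : ℝ) := by gcongr
      nlinarith
    have h73 : (n : ℝ) ^ (7 / 3 : ℝ) = (n : ℝ) ^ (1 / 3 : ℝ) * n ^ 2 := by
      rw [← Real.rpow_natCast (n : ℝ) 2, ← Real.rpow_add hn0]; norm_num
    calc κ ^ 3 = θ ^ 3 * (1 / ε ^ 2) ^ 3 := by rw [hκ]; ring
      _ ≤ θ ^ 3 * (n / (3 * θ)) ^ 2 := by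
          refine mul_le_mul_of_nonneg_left (h1.trans ?_) (by positivity)
          gcongr
      _ = θ * (n ^ 2 / 9) := by field_simp; norm_num
      _ ≤ (n : ℝ) ^ (1 / 3 : ℝ) / 6 * (n ^ 2 / 9) := by gcongr
      _ = _ := by rw [h73]; ring

end Scale

/-! ### The selection rule -/

section Selection

variable {X : Type*} [MetricSpace X] {n : ℕ}

lemma IsSelected.one_le {ω : Fin n → X × ℝ} {Δ θ : ℝ} {x : X} {k : ℕ}
    (h : IsSelected ω Δ θ x k) : 1 ≤ k := by
  obtain ⟨k₁, ⟨⟨h1, -, -⟩, -⟩, rfl | rfl, -, -⟩ := h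
  · exact h1
  · omega

lemma IsSelected.le {ω : Fin n → X × ℝ} {Δ θ : ℝ} {x : X} {k : ℕ}
    (h : IsSelected ω Δ θ x k) : k ≤ n := h.choose_spec.2.2.1

lemma card_ballTrace_le (ω : Fin n → X × ℝ) (x : X) (s : ℝ) : (ballTrace ω x s).card ≤ n :=
  (Finset.card_le_univ _).trans (by simp)

/-- Every `j ≤ κ` for which the ball of radius `ε Δ` holds at least `j` points is admissible in the
selection rule. -/
lemma sq_nnDist_le_of_le {ω : Fin n → X × ℝ} {Δ θ : ℝ} {x : X} {ε κ s : ℝ} (hκ : κ * ε ^ 2 = θ)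
    (hs0 : 0 ≤ s) (hs : s ≤ ε * Δ) {j : ℕ} (hj1 : 1 ≤ j)
    (hjm : j ≤ (ballTrace ω x s).card) (hjκ : (j : ℝ) ≤ κ) :
    nnDist ω j x ^ 2 ≤ Δ ^ 2 * θ / (j : ℝ) := by
  have hj0 : (0 : ℝ) < j := by exact_mod_cast hj1
  have h1 : nnDist ω j x ≤ ε * Δ := (nnDist_le hs0 hjm).trans hs
  have h2 : nnDist ω j x ^ 2 ≤ (ε * Δ) ^ 2 := pow_le_pow_left₀ (nnDist_nonneg _ _ _) h1 2
  refine h2.trans ?_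
  rw [le_div_iff₀ hj0, ← hκ]
  nlinarith [mul_le_mul_of_nonneg_left hjκ (sq_nonneg (ε * Δ))]

/-- The radius at the selected `k` is at most of the order of the critical scale. -/
lemma IsSelected.sq_nnDist_le {ω : Fin n → X × ℝ} {Δ θ : ℝ} {x : X} {k : ℕ}
    (h : IsSelected ω Δ θ x k) {ε κ s : ℝ} (hκ : κ * ε ^ 2 = θ) (hκ13 : 13 ≤ κ)
    (hs0 : 0 ≤ s) (hs : s ≤ ε * Δ) (hm : 0.6 * κ ≤ ((ballTrace ω x s).card : ℝ)) :
    nnDist ω k x ^ 2 ≤ 5 / 3 * (Δ ^ 2 * ε ^ 2) + 0.22 * ε ^ 2 := by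
  obtain ⟨k₁, ⟨⟨h1, h1n, h1r⟩, hmax⟩, hk, hkn, hmin⟩ := h
  have hm1 : 1 ≤ (ballTrace ω x s).card := by
    have : (1 : ℝ) ≤ ((ballTrace ω x s).card : ℝ) := by linarith
    exact_mod_cast this
  have hge : 0.6 * κ ≤ (k₁ : ℝ) := by
    have key : ∀ j : ℕ, 1 ≤ j → j ≤ (ballTrace ω x s).card → (j : ℝ) ≤ κ → j ≤ k₁ :=
      fun j hj hjm hjκ =>
        hmax ⟨hj, hjm.trans (card_ballTrace_le _ _ _), sq_nnDist_le_of_le hκ hs0 hs hj hjm hjκ⟩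
    rcases le_total ((ballTrace ω x s).card : ℝ) κ with hle | hle
    · have := key _ hm1 le_rfl hle
      exact hm.trans (by exact_mod_cast this)
    · have hfl : ⌊κ⌋₊ ≤ k₁ := by
        refine key _ (Nat.le_floor (by norm_num; linarith)) ?_ (Nat.floor_le (by linarith))
        exact Nat.floor_le_of_le hle
      have h2 : (⌊κ⌋₊ : ℝ) ≤ k₁ := by exact_mod_cast hfl
      linarith [Nat.lt_floor_add_one κ]
  have hk0 : (0 : ℝ) < k₁ := by linarith
  have hr1 : nnDist ω k₁ x ^ 2 ≤ 5 / 3 * (Δ ^ 2 * ε ^ 2) := by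
    refine h1r.trans ?_
    rw [div_le_iff₀ hk0, ← hκ]
    have := mul_le_mul_of_nonneg_left hge (show 0 ≤ Δ ^ 2 * ε ^ 2 by positivity)
    linarith
  rcases hk with rfl | rfl
  · linarith [sq_nonneg ε]
  · have h2 := hmin k₁ (Or.inl rfl) h1n
    push_cast at h2
    have h3 : θ / (k₁ : ℝ) - θ / (k₁ + 1) ≤ 0.22 * ε ^ 2 := by
      have h4 : θ / (k₁ : ℝ) - θ / (k₁ + 1) = θ / (k₁ * (k₁ + 1)) := by
        field_simp
        ring
      rw [h4, div_le_iff₀ (by positivity), ← hκ]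
      have h5 : κ ≤ 0.22 * (k₁ * (k₁ + 1)) := by nlinarith
      nlinarith [mul_le_mul_of_nonneg_left h5 (sq_nonneg ε)]
    linarith

/-- If the `k`-NN ball at the selected `k` lies strictly inside the critical ball, then the selected
value of the objective is optimal up to constants. -/
lemma IsSelected.objective_le {ω : Fin n → X × ℝ} {Δ θ : ℝ} {x : X} {k : ℕ}
    (h : IsSelected ω Δ θ x k) {ε κ s : ℝ} (hε : ε ≠ 0) (hκ : κ * ε ^ 2 = θ)
    (hs0 : 0 ≤ s) (hs : s ≤ ε * Δ) (hkm : k < (ballTrace ω x s).card) :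
    θ / (k : ℝ) + nnDist ω k x ^ 2 ≤ (1 + Δ ^ 2) * ε ^ 2 := by
  obtain ⟨k₁, ⟨⟨h1, h1n, h1r⟩, hmax⟩, hk, hkn, hmin⟩ := h
  have hε2 : 0 < ε ^ 2 := by positivity
  have hmn := card_ballTrace_le ω x s
  have hk0 : (0 : ℝ) < k₁ := by exact_mod_cast h1
  rcases le_or_gt κ (k₁ : ℝ) with hle | hlt
  · refine (hmin k₁ (Or.inl rfl) h1n).trans ?_
    have h2 : θ / (k₁ : ℝ) ≤ ε ^ 2 := by
      rw [div_le_iff₀ hk0, ← hκ]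
      nlinarith
    have h3 : Δ ^ 2 * θ / (k₁ : ℝ) ≤ Δ ^ 2 * ε ^ 2 := by
      rw [mul_div_assoc]; gcongr
    linarith
  · have hk1m : k₁ + 1 ≤ (ballTrace ω x s).card := by omega
    have hκ1 : κ < (k₁ + 1 : ℕ) := by
      by_contra! hle
      have := hmax ⟨by omega, hk1m.trans hmn,
        sq_nnDist_le_of_le hκ hs0 hs (by omega) hk1m hle⟩
      omega
    refine (hmin (k₁ + 1) (Or.inr rfl) (hk1m.trans hmn)).trans ?_
    have h2 : θ / ((k₁ + 1 : ℕ) : ℝ) ≤ ε ^ 2 := by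
      rw [div_le_iff₀ (by positivity), ← hκ]
      nlinarith
    have h3 : nnDist ω (k₁ + 1) x ^ 2 ≤ (ε * Δ) ^ 2 :=
      pow_le_pow_left₀ (nnDist_nonneg _ _ _) ((nnDist_le hs0 hk1m).trans hs) 2
    linarith [mul_pow ε Δ 2]

end Selection

section Risk

variable {X : Type*} [MetricSpace X] [MeasurableSpace X] {n : ℕ}

/-- The risk at `k` from a bound `c` for the average noise over the `k`-NN ball; `W'` is the noise
level valid on the smaller concentric balls, and `c² ≤ 2 W A` for the noise level `W`. -/
lemma sq_error_le {K : ℝ → ℝ} (hK : IsWeightKernel K)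
    {η : Kernel X ℝ} {lam σ2 : ℝ} (hlam : 0 < lam)
    (hLip : ∀ x x' : X, |regressionFn η x - regressionFn η x'| ≤ lam * dist x x')
    {ω : Fin n → X × ℝ} {V k : ℕ} (hk1 : 1 ≤ k) (hkn : k ≤ n) {x : X} {δ θ W' c A B : ℝ}
    (hθ : 0 < θ) (hA : 0 < A) (hW' : 0 ≤ W') (hc : 0 ≤ c)
    (hI : |∑ i ∈ ballTrace ω x (nnDist ω k x), residual η (ω i)| ≤
      ((ballTrace ω x (nnDist ω k x)).card : ℝ) * c)
    (hU : ∀ s, 0 ≤ s → s ≤ nnDist ω k x → |∑ i ∈ ballTrace ω x s, residual η (ω i)| ≤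
      √(2 * W' * ((ballTrace ω x s).card : ℝ)))
    (hWc : W' ≤ ((ballTrace ω x (nnDist ω k x)).card : ℝ) * c ^ 2)
    (hcA : c ^ 2 ≤ 2 * noiseLevel η σ2 V n δ * A)
    (hB : θ * A + nnDist ω k x ^ 2 / 2 ≤ B) (hV : 0 ≤ noiseLevel η σ2 V n δ) :
    |estimate K ω k x - regressionFn η x| ^ 2 ≤
      (2 * noiseConst η σ2 K V n δ / θ + 2 * lam ^ 2) * B := by
  have hK1 := hK.pos_one
  have hK0 : 0 ≤ K 0 / K 1 := div_nonneg (hK.nonneg 0 le_rfl) hK1.le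
  have h1 := abs_estimate_sub_le hK hlam hLip hk1 hkn
    (abs_sum_rawWeight_mul_le hK (fun i => residual η (ω i)) hW' hc hI hU hWc)
  have hnc : noiseConst η σ2 K V n δ = noiseLevel η σ2 V n δ * (K 0 / K 1) := rfl
  have hnc0 : 0 ≤ noiseConst η σ2 K V n δ := hnc ▸ mul_nonneg hV hK0
  calc |estimate K ω k x - regressionFn η x| ^ 2
      ≤ (c * √(K 0 / K 1) + lam * nnDist ω k x) ^ 2 := pow_le_pow_left₀ (abs_nonneg _) h1 2
    _ ≤ (2 * noiseConst η σ2 K V n δ / θ + 2 * lam ^ 2) * (θ * A + nnDist ω k x ^ 2 / 2) := by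
        refine sq_add_mul_le hA hθ ?_
        rw [mul_pow, Real.sq_sqrt hK0, hnc]
        calc c ^ 2 * (K 0 / K 1) ≤ 2 * noiseLevel η σ2 V n δ * A * (K 0 / K 1) := by gcongr
          _ = _ := by ring
    _ ≤ _ := by gcongr

lemma GoodAt.abs_sum_le {μ : Measure X} {η : Kernel X ℝ} {σ2 : ℝ} {V : ℕ} {δ : ℝ}
    {ω : Fin n → X × ℝ} {x : X} (hG : GoodAt μ η σ2 V δ ω x) {s α : ℝ} (hs : 0 ≤ s)
    (hV : 0 ≤ noiseLevel η σ2 V n δ) (hα : inflation n (ballTrace ω x s).card ≤ α) :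
    |∑ i ∈ ballTrace ω x s, residual η (ω i)| ≤
      √(2 * (α * noiseLevel η σ2 V n δ) * ((ballTrace ω x s).card : ℝ)) := by
  refine (hG.noise s hs).trans ?_
  change ((ballTrace ω x s).card : ℝ) * √(2 * (inflation n (ballTrace ω x s).card /
    ((ballTrace ω x s).card : ℝ)) * noiseLevel η σ2 V n δ) ≤ _
  set u : ℝ := ((ballTrace ω x s).card : ℝ) with hu
  have hu0 : 0 ≤ u := Nat.cast_nonneg _
  rcases hu0.eq_or_lt with h0 | hpos
  · rw [← h0, zero_mul]; exact Real.sqrt_nonneg _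
  · refine Real.le_sqrt_of_sq_le ?_
    have h1 := one_le_inflation n (ballTrace ω x s).card
    rw [mul_pow, Real.sq_sqrt (by positivity)]
    calc _ = 2 * (inflation n (ballTrace ω x s).card * noiseLevel η σ2 V n δ) * u := by
          field_simp
      _ ≤ _ := by gcongr

end Risk

/-! ### The risk bound -/

section Conclusion

variable {X : Type*} [MetricSpace X] [MeasurableSpace X] {n : ℕ}

/-- Risk bound at `k` in terms of the number of sample points in the `k`-NN ball. -/
lemma GoodAt.sq_error_le_of_inflation {μ : Measure X} {K : ℝ → ℝ} (hK : IsWeightKernel K)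
    {η : Kernel X ℝ} {lam σ2 : ℝ} (hlam : 0 < lam)
    (hLip : ∀ x x' : X, |regressionFn η x - regressionFn η x'| ≤ lam * dist x x')
    {ω : Fin n → X × ℝ} {V k : ℕ} {δ : ℝ} {x : X} (hG : GoodAt μ η σ2 V δ ω x)
    (hk1 : 1 ≤ k) (hkn : k ≤ n) {θ α B : ℝ} (hθ : 0 < θ)
    (hV : 0 ≤ noiseLevel η σ2 V n δ)
    (hα : inflation n (ballTrace ω x (nnDist ω k x)).card ≤ α)
    (hB : θ * (α / ((ballTrace ω x (nnDist ω k x)).card : ℝ)) + nnDist ω k x ^ 2 / 2 ≤ B) :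
    |estimate K ω k x - regressionFn η x| ^ 2 ≤
      (2 * noiseConst η σ2 K V n δ / θ + 2 * lam ^ 2) * B := by
  have hα0 : 0 < α := one_pos.trans_le ((one_le_inflation _ _).trans hα)
  have hcard := le_card_ballTrace_nnDist ω hkn x
  have hmono : ∀ s, s ≤ nnDist ω k x → inflation n (ballTrace ω x s).card ≤ α := fun s hs =>
    (inflation_mono n (hk1.trans hkn) (Finset.card_le_card (ballTrace_mono ω x hs))).trans hα
  have hI := hG.abs_sum_le (nnDist_nonneg ω k x) hV hα
  set N : ℝ := ((ballTrace ω x (nnDist ω k x)).card : ℝ) with hN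
  have hN0 : 0 < N := by
    rw [hN]; exact_mod_cast hk1.trans hcard
  set W := noiseLevel η σ2 V n δ with hW
  refine sq_error_le hK hlam hLip hk1 hkn (W' := α * W) (c := √(2 * (α * W) / N)) (A := α / N)
    hθ (div_pos hα0 hN0) (mul_nonneg hα0.le hV) (Real.sqrt_nonneg _) ?_
    (fun s hs0 hs => hG.abs_sum_le hs0 hV (hmono s hs)) ?_ ?_ hB hV
  · refine hI.trans (le_of_eq ?_)
    rw [← hN]
    have h1 : 2 * (α * W) * N = N ^ 2 * (2 * (α * W) / N) := by field_simp
    rw [h1, Real.sqrt_mul (sq_nonneg N), Real.sqrt_sq hN0.le]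
  · rw [← hN, Real.sq_sqrt (by positivity), mul_div_cancel₀ _ hN0.ne']
    linarith [mul_nonneg hα0.le hV]
  · rw [← hW, Real.sq_sqrt (by positivity)]
    exact le_of_eq (by ring)

/-- Risk bound at `k` when the `k`-NN ball contains all sample points of a ball of large mass: the
number of points in it is then replaced by the expected number. -/
lemma GoodAt.sq_error_le_of_mass {μ : Measure X} [IsProbabilityMeasure μ] {K : ℝ → ℝ}
    (hK : IsWeightKernel K) {η : Kernel X ℝ} {lam σ2 : ℝ} (hlam : 0 < lam)
    (hLip : ∀ x x' : X, |regressionFn η x - regressionFn η x'| ≤ lam * dist x x')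
    {ω : Fin n → X × ℝ} {V k : ℕ} {δ : ℝ} {x : X} (hG : GoodAt μ η σ2 V δ ω x)
    (hk1 : 1 ≤ k) (hkn : k ≤ n) {θ κ s B : ℝ} (hθ : 0 < θ)
    (hV : 0 ≤ noiseLevel η σ2 V n δ)
    (hα : inflation n (ballTrace ω x (nnDist ω k x)).card ≤ 1) (hκ0 : 0 < κ)
    (hT : countThreshold V n δ ≤ κ) (hs0 : 0 ≤ s)
    (hmass : 3 * κ ≤ n * μ.real (Metric.closedBall x s))
    (hcover : (ballTrace ω x s).card ≤ (ballTrace ω x (nnDist ω k x)).card)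
    (hB : θ * (0.85 / κ) + nnDist ω k x ^ 2 / 2 ≤ B) :
    |estimate K ω k x - regressionFn η x| ^ 2 ≤
      (2 * noiseConst η σ2 K V n δ / θ + 2 * lam ^ 2) * B := by
  set W := noiseLevel η σ2 V n δ with hW
  obtain ⟨s', hs'0, hs'm, htr⟩ : ∃ s', 0 ≤ s' ∧ 3 * κ ≤ n * μ.real (Metric.closedBall x s') ∧
      ballTrace ω x s' = ballTrace ω x (nnDist ω k x) := by
    rcases le_total s (nnDist ω k x) with hle | hle
    · refine ⟨nnDist ω k x, nnDist_nonneg _ _ _, hmass.trans ?_, rfl⟩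
      have := measureReal_mono (μ := μ) (Metric.closedBall_subset_closedBall (x := x) hle)
      gcongr
    · exact ⟨s, hs0, hmass, (Finset.eq_of_subset_of_card_le (ballTrace_mono ω x hle) hcover).symm⟩
  have hcount : 0.2 * (n * μ.real (Metric.closedBall x s')) ≤
      ((ballTrace ω x (nnDist ω k x)).card : ℝ) := by
    rw [← htr]; exact hG.count s' hs'0 (by linarith)
  have havg : |∑ i ∈ ballTrace ω x (nnDist ω k x), residual η (ω i)| ≤
      ((ballTrace ω x (nnDist ω k x)).card : ℝ) *
        √(2 * (2.55 / (n * μ.real (Metric.closedBall x s'))) * W) := by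
    rw [← htr]; exact hG.average_noise s' hs'0 (by linarith)
  have hmono : ∀ s, s ≤ nnDist ω k x → inflation n (ballTrace ω x s).card ≤ 1 := fun s hs =>
    (inflation_mono n (hk1.trans hkn) (Finset.card_le_card (ballTrace_mono ω x hs))).trans hα
  refine sq_error_le hK hlam hLip hk1 hkn (W' := 1 * W) (c := √(2 * (0.85 / κ) * W))
    (A := 0.85 / κ) hθ (by positivity) (by linarith) (Real.sqrt_nonneg _) (havg.trans ?_)
    (fun s hs0 hs => hG.abs_sum_le hs0 hV (hmono s hs)) ?_ ?_ hB hV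
  · have h1 : 2.55 / (n * μ.real (Metric.closedBall x s')) ≤ 0.85 / κ := by
      rw [div_le_div_iff₀ (by linarith) hκ0]
      linarith
    gcongr
  · rw [Real.sq_sqrt (by positivity)]
    have h1 : 0.6 * κ ≤ ((ballTrace ω x (nnDist ω k x)).card : ℝ) := by linarith
    have h2 : 0.6 * κ * (2 * (0.85 / κ) * W) = 1.02 * W := by field_simp; ring
    have h3 := mul_le_mul_of_nonneg_right h1 (show 0 ≤ 2 * (0.85 / κ) * W by positivity)
    linarith
  · rw [← hW, Real.sq_sqrt (by positivity)]
    exact le_of_eq (by ring)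

/-- The error bound at a selected `k`, in terms of the critical scale `ε`. -/
lemma GoodAt.sq_error_le_of_isSelected {μ : Measure X} [IsProbabilityMeasure μ] {K : ℝ → ℝ}
    (hK : IsWeightKernel K) {η : Kernel X ℝ} {lam σ2 : ℝ} (hlam : 0 < lam)
    (hLip : ∀ x x' : X, |regressionFn η x - regressionFn η x'| ≤ lam * dist x x')
    {ω : Fin n → X × ℝ} {V k : ℕ} {δ Δ θ : ℝ} {x : X} (hG : GoodAt μ η σ2 V δ ω x)
    (hk : IsSelected ω Δ θ x k) {ε κ s : ℝ} (hV : 0 ≤ noiseLevel η σ2 V n δ) (hε : 0 < ε)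
    (hκε : κ * ε ^ 2 = θ) (hκ13 : 13 ≤ κ) (hT : countThreshold V n δ ≤ κ)
    (hκn : κ ^ 3 ≤ (n : ℝ) ^ (7 / 3 : ℝ) / 54) (hs0 : 0 ≤ s) (hs : s ≤ ε * Δ)
    (hmass : 3 * κ ≤ n * μ.real (Metric.closedBall x s)) :
    |estimate K ω k x - regressionFn η x| ^ 2 ≤
      (2 * noiseConst η σ2 K V n δ / θ + 2 * lam ^ 2) * ((1 + 4 * Δ ^ 2) * ε ^ 2) := by
  have hk1 := hk.one_le
  have hkn := hk.le
  have hn := hk1.trans hkn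
  have hε2 : 0 < ε ^ 2 := by positivity
  have hκ0 : 0 < κ := by linarith
  have hθ : 0 < θ := hκε ▸ mul_pos hκ0 hε2
  have hm : 0.6 * κ ≤ ((ballTrace ω x s).card : ℝ) := by
    have : 0.2 * (n * μ.real (Metric.closedBall x s)) ≤ ((ballTrace ω x s).card : ℝ) :=
      hG.count s hs0 (by linarith)
    linarith
  have hr := hk.sq_nnDist_le hκε hκ13 hs0 hs hm
  have hΔε : 0 ≤ Δ ^ 2 * ε ^ 2 := by positivity
  have hcard := le_card_ballTrace_nnDist ω hkn x
  have hN0 : (0 : ℝ) < ((ballTrace ω x (nnDist ω k x)).card : ℝ) := by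
    exact_mod_cast hk1.trans hcard
  by_cases hinf : ((ballTrace ω x (nnDist ω k x)).card : ℝ) * (Real.log (2 * n) + 1) ≤ n
  · have hα : inflation n (ballTrace ω x (nnDist ω k x)).card ≤ 1 := by
      rw [inflation, if_pos hinf]
    by_cases hcover : (ballTrace ω x s).card ≤ (ballTrace ω x (nnDist ω k x)).card
    · refine hG.sq_error_le_of_mass hK hlam hLip hk1 hkn hθ hV hα hκ0 hT hs0 hmass hcover ?_
      have h1 : θ * (0.85 / κ) = 0.85 * ε ^ 2 := by rw [← hκε]; field_simp
      linarith
    · refine hG.sq_error_le_of_inflation hK hlam hLip hk1 hkn hθ hV hα ?_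
      have h1 := hk.objective_le hε.ne' hκε hs0 hs (by omega)
      have h2 : θ * (1 / ((ballTrace ω x (nnDist ω k x)).card : ℝ)) ≤ θ / k := by
        rw [mul_one_div]
        have h3 : (0 : ℝ) < k := by exact_mod_cast hk1
        have h4 : (k : ℝ) ≤ ((ballTrace ω x (nnDist ω k x)).card : ℝ) := by exact_mod_cast hcard
        gcongr
      linarith [sq_nonneg (nnDist ω k x)]
  · refine hG.sq_error_le_of_inflation hK hlam hLip hk1 hkn hθ hV (α := 9 / 8) ?_ ?_
    · rw [inflation, if_neg hinf]
    · -- traces with inflated bounds have at least `1.3 κ` points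
      have h1 : 1.3 * κ < ((ballTrace ω x (nnDist ω k x)).card : ℝ) := by
        by_contra! hle
        refine hinf (le_trans ?_ (mul_log_add_one_le hn hκn))
        have : 0 ≤ Real.log (2 * n) + 1 := by
          have hn1 : (1 : ℝ) ≤ n := by exact_mod_cast hn
          have := Real.log_nonneg (show (1 : ℝ) ≤ 2 * n by linarith)
          linarith
        gcongr
      have h2 : θ * (9 / 8 / ((ballTrace ω x (nnDist ω k x)).card : ℝ)) ≤ 0.87 * ε ^ 2 := by
        rw [mul_div_assoc', div_le_iff₀ hN0, ← hκε]
        have := mul_le_mul_of_nonneg_left h1.le hε2.le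
        nlinarith [mul_pos hκ0 hε2]
      linarith

end Conclusion

end KNN

theorem theorem3 {X : Type*} [MetricSpace X] [Nontrivial X] [MeasurableSpace X] [BorelSpace X]
    (μ : Measure X) [IsProbabilityMeasure μ] (η : Kernel X ℝ) [IsMarkovKernel η]
    (lam σ2 : ℝ) (hlam : 0 < lam)
    (hLip : ∀ x x' : X, |KNN.regressionFn η x - KNN.regressionFn η x'| ≤ lam * dist x x')
    (hnoise : KNN.NoiseModel η σ2)
    (K : ℝ → ℝ) (hK : KNN.IsWeightKernel K)
    (V : ℕ) (hV : KNN.HasVCDim (KNN.balls X) V)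
    (C₀ d₀ : ℝ) (hmax : KNN.MaximallyHomogeneous μ C₀ d₀)
    (n : ℕ) (hn : 1 ≤ n) (δ θ : ℝ) (hδ0 : 0 < δ) (hδ1 : δ < 1)
    (hθ : Real.log (n / δ) ≤ θ)
    (hsize : ((V : ℝ) * Real.log (2 * n) + Real.log (8 / δ)) / θ < (n : ℝ) ^ (4 / (6 + 3 * d₀))) :
    ∃ E : Set (Fin n → X × ℝ), MeasurableSet E ∧ 1 - 2 * δ ≤ (KNN.sampleLaw μ η n).real E ∧
      ∀ ω ∈ E, ∀ (x : X) (Δ : ℝ), (∀ i, dist x (ω i).1 ≤ Δ) →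
        ∀ k : ℕ, KNN.IsSelected ω Δ θ x k →
          ∀ r : ℝ, 0 < r → r < Δ →
            6 * C₀ * θ * (n : ℝ) ^ (-(1 / 3) : ℝ) < μ.real (Metric.closedBall x r) →
            ∀ C d : ℝ, 1 ≤ C → C ≤ C₀ → 1 ≤ d → d ≤ d₀ → KNN.Homogeneous μ C d x r →
              |KNN.estimate K ω k x - KNN.regressionFn η x| ^ 2 ≤
                (2 * KNN.noiseConst η σ2 K V n δ / θ + 2 * lam ^ 2) * (1 + 4 * Δ ^ 2) *
                  (3 * C * θ / (n * μ.real (Metric.closedBall x r))) ^ (2 / (2 + d)) := by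
  have hprob := KNN.isProbabilityMeasure_sampleLaw μ η n
  -- for `δ > 1/2` the empty event will do
  rcases lt_or_ge (1 / 2) δ with hδ2 | hδ2
  · refine ⟨∅, MeasurableSet.empty, ?_, fun ω hω => hω.elim⟩
    rw [measureReal_empty]; linarith
  -- if no ball can have the mass required, the assertion is void on the whole sample space
  rcases le_or_gt 1 (6 * C₀ * θ * (n : ℝ) ^ (-(1 / 3) : ℝ)) with hbig | hbig
  · refine ⟨univ, MeasurableSet.univ, ?_, ?_⟩
    · rw [probReal_univ]; linarith
    · intro ω _ x Δ _ k _ r _ _ hr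
      have := measureReal_le_one (μ := μ) (s := Metric.closedBall x r)
      linarith
  have hn1 : (1 : ℝ) ≤ n := by exact_mod_cast hn
  have hn0 : (0 : ℝ) < n := by linarith
  have hθ0 : 0 < θ := by
    refine lt_of_lt_of_le (Real.log_pos ?_) hθ
    rw [lt_div_iff₀ hδ0]; linarith
  have hC₀ := hmax.1
  have hR : KNN.Regime n δ := by
    refine KNN.regime_of_six_mul_lt hn hδ0 hδ2 hθ ?_
    have h1 : (n : ℝ) ^ (-(1 / 3) : ℝ) * (n : ℝ) ^ (1 / 3 : ℝ) = 1 := by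
      rw [← Real.rpow_add hn0]; norm_num
    have h2 : 0 < (n : ℝ) ^ (1 / 3 : ℝ) := Real.rpow_pos_of_pos hn0 _
    have h3 := mul_lt_mul_of_pos_right hbig h2
    rw [mul_assoc, h1] at h3
    nlinarith
  have hθ13 : 13 ≤ θ := by
    refine hR.log_ge.trans (le_trans (Real.log_le_log (by positivity) ?_) hθ)
    rw [le_div_iff₀ hδ0]; nlinarith
  obtain ⟨E, hE, hPE, hgood⟩ := KNN.exists_good_event μ η hnoise hV hR
  refine ⟨E, hE, hPE, ?_⟩
  intro ω hω x Δ _ k hk r hr0 hrΔ hr C d hC hCC hd hdd hhom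
  set p := μ.real (Metric.closedBall x r) with hp
  have hp0 : 0 < p := lt_of_le_of_lt (by positivity) hr
  have hpos : ∀ s > 0, 0 < μ.real (Metric.closedBall x s) := by
    intro s hs
    rcases le_or_gt r s with hrs | hsr
    · exact hp0.trans_le (measureReal_mono (Metric.closedBall_subset_closedBall hrs))
    · have h1 := hhom r hr0 le_rfl (s / r) (by positivity) ((div_lt_one hr0).2 hsr)
      rw [div_mul_cancel₀ _ hr0.ne'] at h1
      by_contra! h2
      have h3 : C * (s / r) ^ (-d) * μ.real (Metric.closedBall x s) ≤ 0 :=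
        mul_nonpos_of_nonneg_of_nonpos (by positivity) h2
      linarith
  have hσ : 0 ≤ KNN.noiseLevel η σ2 V n δ := by
    have h1 : 0 ≤ σ2 := hnoise.nonneg x
    have h2 : 0 ≤ Real.log (2 * n / δ) := by
      rw [hR.log_div]; linarith [hR.log_ge, hR.log_inv_pos]
    unfold KNN.noiseLevel
    positivity
  obtain ⟨ε, κ, hε0, hε1, hε2, hκε, hscale, hT, hκn⟩ :=
    KNN.exists_scale hn hC hCC hd hdd hθ0 measureReal_le_one hr hsize
  have hκ13 : 13 ≤ κ := by
    have h1 : ε ^ 2 ≤ 1 := pow_le_one₀ hε0.le hε1.le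
    have h2 : 0 < κ := pos_of_mul_pos_left (hκε ▸ hθ0) (sq_nonneg ε)
    nlinarith
  have hmass : 3 * κ ≤ n * μ.real (Metric.closedBall x (ε * r)) := by
    have h1 := hhom r hr0 le_rfl ε hε0 hε1
    have h2 : 0 < C * ε ^ (-d) := by positivity
    have h3 := mul_le_mul_of_nonneg_left h1 hn0.le
    rw [← hp, ← hscale] at h3
    refine le_of_mul_le_mul_left (h3.trans (le_of_eq ?_)) h2
    ring
  rw [← hε2, mul_assoc]
  exact (hgood ω hω x hpos).sq_error_le_of_isSelected hK hlam hLip hk hσ hε0 hκε hκ13 hT hκn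
    (by positivity) (by gcongr) hmass
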